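/- **Setting.** Let $\varepsilon>0$, write $v^\perp=(-v_2,v_1)$ for $v\in\mathbb R^2$, and let $\|\cdot\|$ be the Euclidean norm on $\mathbb R^2$ (and the corresponding operator norm on matrices). Given an electric field $E:[0,\infty)\times\mathbb R^2\to\mathbb R^2$ and $x^0_\varepsilon,v^0_\varepsilon\in\mathbb R^2$, let $(x_\varepsilon,v_\varepsilon)$ be the solution for $t\ge 0$ of $$\varepsilon x_\varepsilon'(t)=v_\varepsilon(t),\qquad \varepsilon v_\varepsilon'(t)=E(t,x_\varepsilon(t))-\tfrac1\varepsilon v_\varepsilon^\perp(t),\qquad x_\varepsilon(0)=x_\varepsilon^0,\quad v_\varepsilon(0)=v_\varepsilon^0,$$ and let $y_\varepsilon=x_\varepsilon-\varepsilon v_\varepsilon^\perp$ be the guiding center variable. Put $$F_y(t,\hat y,\tilde w)=-E^\perp(t,\hat y+\tilde w^\perp),\qquad F_v^\varepsilon(t,\hat y,\hat w,\tilde w)=E(t,\hat y+\hat w^\perp)-\frac{\tilde w^\perp}{\varepsilon^2}.$$ Let $\gamma=1-\frac1{\sqrt2}$, $\Delta t>0$, $t_n=n\Delta t$ and $\hat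 t_{n+1}=t_n+\frac{\Delta t}{2\gamma}$. The second-order scheme starts from $y^0_\varepsilon=x_\varepsilon^0-\varepsilon (v_\varepsilon^0)^\perp$ and $v^0_\varepsilon$, and for every $n\ge0$ it reads $$\varepsilon\frac{\tilde v^{n+1}_\varepsilon-v^n_\varepsilon}{\gamma\Delta t}=F_v^\varepsilon(t_n,y^n_\varepsilon,\varepsilon v_\varepsilon^n,\varepsilon\tilde v_\varepsilon^{n+1}),$$ $$\frac{\hat y^{n+1}_\varepsilon-y^n_\varepsilon}{\Delta t/(2\gamma)}=F_y(t_n,y_\varepsilon^n,\varepsilon\tilde v_\varepsilon^{n+1}),\qquad \varepsilon\frac{\hat v^{n+1}_\varepsilon-v^n_\varepsilon}{\Delta t/(2\gamma)}=F_v^\varepsilon(t_n,y_\varepsilon^n,\varepsilon v_\varepsilon^n,\varepsilon\tilde v_\varepsilon^{n+1}),$$ $$\frac{y^{n+1}_\varepsilon-y^n_\varepsilon}{\Delta t}=(1-\gamma)F_y(t_n,y_\varepsilon^n,\varepsilon\tilde v_\varepsilon^{n+1})+\gamma F_y(\hat t_{n+1},\hat y_\varepsilon^{n+1},\varepsilon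 v_\varepsilon^{n+1}),$$ $$\varepsilon\frac{v^{n+1}_\varepsilon-v^n_\varepsilon}{\Delta t}=(1-\gamma)F_v^\varepsilon(t_n,y_\varepsilon^n,\varepsilon v_\varepsilon^n,\varepsilon\tilde v_\varepsilon^{n+1})+\gamma F_v^\varepsilon(\hat t_{n+1},\hat y_\varepsilon^{n+1},\varepsilon\hat v_\varepsilon^{n+1},\varepsilon v_\varepsilon^{n+1}),$$ with $x_\varepsilon^n=y_\varepsilon^n+\varepsilon (v_\varepsilon^n)^\perp$. For $E\in W^{2,\infty}((0,\infty)\times\mathbb R^2)$, identified with its continuous representative on $[0,\infty)\times\mathbb R^2$, let $K_x=\|D_xE\|_{L^\infty((0,\infty)\times\mathbb R^2)}$. **Theorem.** The scheme has a unique solution: for all $\varepsilon,\Delta t>0$ and all $x_\varepsilon^0,v_\varepsilon^0$ there is exactly one family $(y_\varepsilon^n,v_\varepsilon^n,\tilde v_\varepsilon^{n+1},\hat y_\varepsilon^{n+1},\hat v_\varepsilon^{n+1})_{n\ge0}$ satisfying it. Moreover: (i) There is a universal constant $C_0$ such that for every $E\in W^{2,\infty}$ there is a constant $C$ depending only on $E$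 such that, for all $n\ge 0$, $\Delta t>0$, $\varepsilon>0$, $x_\varepsilon^0,v_\varepsilon^0\in\mathbb R^2$, $$\|x_\varepsilon^n-x_\varepsilon(t_n)\|\le C\,e^{C_0K_xt_n}(1+t_n)^3(1+\varepsilon^2+\|v_\varepsilon^0\|^2)\,\min\Big(\frac{\Delta t^2}{\varepsilon^5}(1+\varepsilon^3),\ \varepsilon+\Delta t^2\Big).$$ (ii) There is a universal constant $C_0$ such that for every $E\in W^{2,\infty}$ there is a constant $C$ depending only on $E$ such that, for all $n\ge 0$, $\Delta t>0$, $\varepsilon>0$, $x_\varepsilon^0,v_\varepsilon^0\in\mathbb R^2$, $$\|y_\varepsilon^n-y_\varepsilon(t_n)\|\le C\,e^{C_0K_xt_n}(1+t_n)^4(1+\varepsilon^2+\|v_\varepsilon^0\|^2)\,\min\Big(\frac{\Delta t^2}{\varepsilon^5}(1+\varepsilon^3),\ \varepsilon^2+\Delta t^2\Big).$$ -/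

import Mathlib

open MeasureTheory
open scoped ContDiff

/-! ### Weak derivatives and the Sobolev space of order two with bounded derivatives -/

/-- `f'` is a weak (distributional) derivative of `f` on the open set `Ω`, seen as a map with
values in linear maps: `f` and `f'` are locally integrable on `Ω` and, for every direction `w` and
every smooth `φ` with compact support inside `Ω`, `∫_Ω (∂_w φ) f = - ∫_Ω φ (f' w)`. -/
def HasWeakFDerivOn {X F : Type*} [NormedAddCommGroup X] [NormedSpace ℝ X] [MeasureSpace X]
    [NormedAddCommGroup F] [NormedSpace ℝ F] (Ω : Set X) (f : X → F) (f' : X → X →L[ℝ] F) : Prop :=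
  LocallyIntegrableOn f Ω ∧ LocallyIntegrableOn f' Ω ∧
    ∀ φ : X → ℝ, ContDiff ℝ ∞ φ → HasCompactSupport φ → tsupport φ ⊆ Ω → ∀ w : X,
      ∫ z in Ω, (fderiv ℝ φ z w) • f z = - ∫ z in Ω, φ z • f' z w

/-- `f` belongs to `W^{2,∞}(Ω)`: it is essentially bounded on `Ω`, together with its weak
derivatives of orders one and two. -/
def MemW2Infty {X F : Type*} [NormedAddCommGroup X] [NormedSpace ℝ X] [MeasureSpace X]
    [NormedAddCommGroup F] [NormedSpace ℝ F] (Ω : Set X) (f : X → F) : Prop :=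
  MemLp f ⊤ (volume.restrict Ω) ∧
    ∃ (f' : X → X →L[ℝ] F) (f'' : X → X →L[ℝ] X →L[ℝ] F),
      HasWeakFDerivOn Ω f f' ∧ MemLp f' ⊤ (volume.restrict Ω) ∧
      HasWeakFDerivOn Ω f' f'' ∧ MemLp f'' ⊤ (volume.restrict Ω)

open Classical in
/-- The weak derivative of `f` on `Ω` (determined almost everywhere in `Ω`), and `0` if there is
none. -/
noncomputable def weakFDerivOn {X F : Type*} [NormedAddCommGroup X] [NormedSpace ℝ X]
    [MeasureSpace X] [NormedAddCommGroup F] [NormedSpace ℝ F] (Ω : Set X) (f : X → F) :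
    X → X →L[ℝ] F :=
  if h : ∃ f', HasWeakFDerivOn Ω f f' then h.choose else 0

namespace GuidingCenter

/-- The plane `ℝ²` with its Euclidean norm. -/
abbrev Plane : Type := EuclideanSpace ℝ (Fin 2)

/-- `v^⊥ = (-v₂, v₁)`. -/
noncomputable def perp (v : Plane) : Plane := !₂[-v 1, v 0]

/-- The open half-space `(0, ∞) × ℝ²` of times and positions. -/
def spaceTime : Set (ℝ × Plane) := {p | 0 < p.1}

/-- The electric field `E` belongs to `W^{2,∞}((0, ∞) × ℝ²)`, and `E` denotes its continuous
representative on `[0, ∞) × ℝ²`. -/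
def FieldW2Infty (E : ℝ × Plane → Plane) : Prop :=
  ContinuousOn E {p | 0 ≤ p.1} ∧ MemW2Infty spaceTime E

/-- `K_x = ‖D_x E‖_{L^∞}`: the essential supremum over `(0, ∞) × ℝ²` of the Euclidean operator norm
of the derivative of `E` in the position variable. -/
noncomputable def Kx (E : ℝ × Plane → Plane) : ℝ :=
  (eLpNorm (fun p => (weakFDerivOn spaceTime E p).comp (ContinuousLinearMap.inr ℝ ℝ Plane)) ⊤
    (volume.restrict spaceTime)).toReal

/-- `(x, v)` is the solution on `[0, ∞)` of the characteristic system
`ε x' = v`, `ε v' = E(t, x) - v^⊥ / ε` with initial datum `(x⁰, v⁰)` at time `0`. -/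
structure IsCharacteristic (E : ℝ × Plane → Plane) (ε : ℝ) (x₀ v₀ : Plane)
    (x v : ℝ → Plane) : Prop where
  x_zero : x 0 = x₀
  v_zero : v 0 = v₀
  deriv_x : ∀ t, 0 ≤ t → ∃ a : Plane, HasDerivWithinAt x a (Set.Ici 0) t ∧ ε • a = v t
  deriv_v : ∀ t, 0 ≤ t → ∃ b : Plane, HasDerivWithinAt v b (Set.Ici 0) t ∧
    ε • b = E (t, x t) - (1 / ε) • perp (v t)

/-- The guiding center variable `y = x - ε v^⊥`. -/
noncomputable def guidingCenter (ε : ℝ) (x v : Plane) : Plane := x - ε • perp v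

/-- `γ = 1 - 1/√2`, the smallest root of `γ² - 2γ + 1/2`. -/
noncomputable def gam : ℝ := 1 - 1 / Real.sqrt 2

/-- `F_y(t, ŷ, w) = -E^⊥(t, ŷ + w^⊥)`. -/
noncomputable def Fy (E : ℝ × Plane → Plane) (t : ℝ) (yh w : Plane) : Plane :=
  -perp (E (t, yh + perp w))

/-- `F_v^ε(t, ŷ, ŵ, w) = E(t, ŷ + ŵ^⊥) - w^⊥ / ε²`; `ŷ, ŵ` are the non-stiff arguments and `w` is
the stiff one. -/
noncomputable def Fv (E : ℝ × Plane → Plane) (ε t : ℝ) (yh wh w : Plane) : Plane :=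
  E (t, yh + perp wh) - (1 / ε ^ 2) • perp w

/-- The unknowns of the scheme. For the step from `t_n = n Δt` to `t_{n+1}`, `y n, v n` are the
values at `t_n`, and `vt n, yh n, vh n` are the values `ṽ^{n+1}, ŷ^{n+1}, v̂^{n+1}` of the
intermediate stages of that step. -/
@[ext]
structure Trajectory where
  y : ℕ → Plane
  v : ℕ → Plane
  vt : ℕ → Plane
  yh : ℕ → Plane
  vh : ℕ → Plane

/-- The position `x^n = y^n + ε (v^n)^⊥`. -/
noncomputable def Trajectory.x (T : Trajectory) (ε : ℝ) (n : ℕ) : Plane := T.y n + ε • perp (T.v n)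

/-- `T` solves the second-order L-stable implicit-explicit scheme with time step `Δt = dt`, started
from the position `x₀` and the velocity `v₀`. -/
structure SolvesScheme (E : ℝ × Plane → Plane) (ε dt : ℝ) (x₀ v₀ : Plane) (T : Trajectory) :
    Prop where
  y_zero : T.y 0 = guidingCenter ε x₀ v₀
  v_zero : T.v 0 = v₀
  /-- First stage (linearly implicit in `ṽ^{n+1}`, time step `γ Δt`). -/
  stage_vt : ∀ n : ℕ, (ε / (gam * dt)) • (T.vt n - T.v n) =
    Fv E ε (n * dt) (T.y n) (ε • T.v n) (ε • T.vt n)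
  /-- Second stage (explicit, time step `Δt / (2γ)`). -/
  stage_yh : ∀ n : ℕ, (1 / (dt / (2 * gam))) • (T.yh n - T.y n) =
    Fy E (n * dt) (T.y n) (ε • T.vt n)
  stage_vh : ∀ n : ℕ, (ε / (dt / (2 * gam))) • (T.vh n - T.v n) =
    Fv E ε (n * dt) (T.y n) (ε • T.v n) (ε • T.vt n)
  /-- Last stage, with `t̂_{n+1} = t_n + Δt / (2γ)` (linearly implicit in `v^{n+1}`). -/
  step_y : ∀ n : ℕ, (1 / dt) • (T.y (n + 1) - T.y n) =
    (1 - gam) • Fy E (n * dt) (T.y n) (ε • T.vt n) +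
      gam • Fy E (n * dt + dt / (2 * gam)) (T.yh n) (ε • T.v (n + 1))
  step_v : ∀ n : ℕ, (ε / dt) • (T.v (n + 1) - T.v n) =
    (1 - gam) • Fv E ε (n * dt) (T.y n) (ε • T.v n) (ε • T.vt n) +
      gam • Fv E ε (n * dt + dt / (2 * gam)) (T.yh n) (ε • T.vh n) (ε • T.v (n + 1))

end GuidingCenter

/-!
In complex notation, with `w = ε v` and `λ = 1 / ε ^ 2`, the characteristics solve
`y' = -i e(t, y + i w)`, `w' = e(t, y + i w) - i λ w`. The estimate by
`Δt ^ 2 / ε ^ 5 * (1 + ε ^ 3)` is the classical one: the local error is of third order in `Δt`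
because `γ (2 - γ) = 1 / 2`, and a step is stable uniformly in `λ` since the amplification factor of
the implicit stages is at most one in modulus. In the uniform estimate the oscillation of `w`
averages out: the corrected guiding center `y - (i / λ) D_x e(t, y) w` of the scheme and that of the
flow both move, up to a small defect, like one step of an explicit second-order scheme for the limit
equation `z' = -i e(t, z)`. Both estimates rest on `‖w‖ = O(ε (‖v⁰‖ + ε))`, which holds for the
scheme and the flow because `w` stays near the equilibrium `-(i / λ) e(t, y)`. Weak derivatives
enter only through mollification, which shows that a field of class `W^{2,∞}` is of class `C^{1,1}`
with the same bounds.
-/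

/-! ### Mollification of weak derivatives -/

section Sobolev

open Filter Topology Convolution

section WeakDerivative

variable {X F : Type*} [NormedAddCommGroup X] [MeasureSpace X] [NormedAddCommGroup F]
  [NormedSpace ℝ F] {Ω : Set X}

theorem integrable_smul_of_tsupport_subset [OpensMeasurableSpace X] {φ : X → ℝ}
    (hφ : Continuous φ) (hc : HasCompactSupport φ) (hs : tsupport φ ⊆ Ω) {g : X → F}
    (hg : LocallyIntegrableOn g Ω) : Integrable (fun z => φ z • g z) := by
  have hcomp : IsCompact (tsupport φ) := hc
  have hintegrable : IntegrableOn (fun z => φ z • g z) (tsupport φ) :=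
    (hg.integrableOn_compact_subset hs hcomp).continuousOn_smul hφ.continuousOn hcomp
  refine (integrableOn_iff_integrable_of_support_subset fun z hz => ?_).1 hintegrable
  exact subset_tsupport φ (left_ne_zero_of_smul hz)

variable [NormedSpace ℝ X]

theorem integral_smul_apply_of_tsupport_subset [OpensMeasurableSpace X]
    {φ : X → ℝ} (hφ : Continuous φ) (hc : HasCompactSupport φ) (hs : tsupport φ ⊆ Ω)
    {g : X → X →L[ℝ] F} (hg : LocallyIntegrableOn g Ω) (w : X) :
    (∫ z, φ z • g z) w = ∫ z in Ω, φ z • g z w := by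
  rw [ContinuousLinearMap.integral_apply (integrable_smul_of_tsupport_subset hφ hc hs hg),
    setIntegral_eq_integral_of_forall_compl_eq_zero]
  · rfl
  · intro z hz
    rw [image_eq_zero_of_notMem_tsupport fun hz' => hz (hs hz'), zero_smul]

theorem HasWeakFDerivOn.ae_eq [FiniteDimensional ℝ X] [BorelSpace X] [CompleteSpace F]
    (hΩ : IsOpen Ω) {f : X → F} {f' g' : X → X →L[ℝ] F} (hf' : HasWeakFDerivOn Ω f f')
    (hg' : HasWeakFDerivOn Ω f g') : f' =ᵐ[volume.restrict Ω] g' := by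
  have hzero := hΩ.ae_eq_zero_of_integral_contDiff_smul_eq_zero (hf'.2.1.sub hg'.2.1) ?_
  · rw [EventuallyEq, ae_restrict_iff' hΩ.measurableSet]
    filter_upwards [hzero] with z hz hzΩ
    exact sub_eq_zero.1 (hz hzΩ)
  intro φ hφ hc hs
  have hcont := hφ.continuous
  simp only [Pi.sub_apply, smul_sub]
  rw [integral_sub (integrable_smul_of_tsupport_subset hcont hc hs hf'.2.1)
    (integrable_smul_of_tsupport_subset hcont hc hs hg'.2.1), sub_eq_zero]
  ext w
  rw [integral_smul_apply_of_tsupport_subset hcont hc hs hf'.2.1,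
    integral_smul_apply_of_tsupport_subset hcont hc hs hg'.2.1, ← neg_inj,
    ← hf'.2.2 φ hφ hc hs w, hg'.2.2 φ hφ hc hs w]

theorem HasWeakFDerivOn.weakFDerivOn_ae_eq [FiniteDimensional ℝ X] [BorelSpace X]
    [CompleteSpace F] (hΩ : IsOpen Ω) {f : X → F} {f' : X → X →L[ℝ] F}
    (hf' : HasWeakFDerivOn Ω f f') : weakFDerivOn Ω f =ᵐ[volume.restrict Ω] f' := by
  have hex : ∃ g', HasWeakFDerivOn Ω f g' := ⟨f', hf'⟩
  rw [weakFDerivOn, dif_pos hex]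
  exact hex.choose_spec.ae_eq hΩ hf'

theorem MemW2Infty.memLp_weakFDerivOn [FiniteDimensional ℝ X] [BorelSpace X] [CompleteSpace F]
    (hΩ : IsOpen Ω) {f : X → F} (hf : MemW2Infty Ω f) :
    MemLp (weakFDerivOn Ω f) ⊤ (volume.restrict Ω) := by
  obtain ⟨-, f', -, hf', hf'_mem, -⟩ := hf
  exact hf'_mem.ae_eq (hf'.weakFDerivOn_ae_eq hΩ).symm

end WeakDerivative

section Mollification

theorem locallyIntegrable_indicator_of_memLp_top {X F : Type*} [TopologicalSpace X]
    [MeasureSpace X] [IsLocallyFiniteMeasure (volume : Measure X)] [NormedAddCommGroup F]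
    {Ω : Set X} (hΩ : MeasurableSet Ω) {f : X → F} (hf : MemLp f ⊤ (volume.restrict Ω)) :
    LocallyIntegrable (Ω.indicator f) :=
  ((memLp_indicator_iff_restrict hΩ).2 hf).locallyIntegrable le_top

variable {X F : Type*} [NormedAddCommGroup X] [NormedSpace ℝ X] [MeasureSpace X]
  [NormedAddCommGroup F] [NormedSpace ℝ F]

/-- The mollification of `f`, extended by zero outside `Ω`, by a normed bump function. -/
noncomputable def mollify [HasContDiffBump X] (φ : ContDiffBump (0 : X)) (Ω : Set X) (f : X → F) :
    X → F :=
  convolution (φ.normed volume) (Ω.indicator f) (ContinuousLinearMap.lsmul ℝ ℝ) volume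

theorem fderiv_normed_sub [FiniteDimensional ℝ X] (φ : ContDiffBump (0 : X)) (p z : X) :
    fderiv ℝ (fun z => φ.normed volume (p - z)) z = -fderiv ℝ (φ.normed volume) (p - z) := by
  have hφ : DifferentiableAt ℝ (φ.normed volume) (p - z) :=
    (φ.contDiff_normed (n := 1)).differentiable one_ne_zero _
  have h := hφ.hasFDerivAt.comp z ((hasFDerivAt_id z).const_sub p)
  exact h.fderiv.trans (by ext; simp)

variable [FiniteDimensional ℝ X] [BorelSpace X] [(volume : Measure X).IsAddHaarMeasure]
  {φ : ContDiffBump (0 : X)} {Ω : Set X} {f : X → F}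

theorem mollify_apply (p : X) :
    mollify φ Ω f p = ∫ z, φ.normed volume (p - z) • Ω.indicator f z := by
  rw [mollify, convolution_eq_swap]
  rfl

theorem integrable_mollify (hΩ : MeasurableSet Ω) (hf : MemLp f ⊤ (volume.restrict Ω)) (p : X) :
    Integrable (fun z => φ.normed volume (p - z) • Ω.indicator f z) :=
  (φ.hasCompactSupport_normed.convolutionExists_left (ContinuousLinearMap.lsmul ℝ ℝ)
    φ.continuous_normed (locallyIntegrable_indicator_of_memLp_top hΩ hf) p).integrable_swap

theorem norm_clm_mollify_le [CompleteSpace F] {G : Type*} [NormedAddCommGroup G] [NormedSpace ℝ G]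
    [CompleteSpace G] (hΩ : MeasurableSet Ω) (hf : MemLp f ⊤ (volume.restrict Ω)) (T : F →L[ℝ] G)
    {C : ℝ} (hC : 0 ≤ C) (hT : ∀ᵐ z ∂(volume.restrict Ω), ‖T (f z)‖ ≤ C) (p : X) :
    ‖T (mollify φ Ω f p)‖ ≤ C := by
  rw [mollify_apply, ← T.integral_comp_comm (integrable_mollify hΩ hf p)]
  have hintegrable : Integrable (fun z => φ.normed volume (p - z)) :=
    φ.integrable_normed.comp_sub_left p
  have hmass : ∫ z, φ.normed volume (p - z) * C = C := by
    rw [integral_mul_const, integral_sub_left_eq_self (φ.normed volume) volume p,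
      φ.integral_normed, one_mul]
  rw [← hmass]
  refine norm_integral_le_of_norm_le (hintegrable.mul_const C) ?_
  filter_upwards [(ae_restrict_iff' hΩ).1 hT] with z hz
  rw [map_smul, norm_smul, Real.norm_of_nonneg (φ.nonneg_normed _)]
  gcongr
  · exact φ.nonneg_normed _
  · by_cases h : z ∈ Ω
    · simpa [h] using hz h
    · simpa [h] using hC

theorem norm_mollify_le [CompleteSpace F] (hΩ : MeasurableSet Ω)
    (hf : MemLp f ⊤ (volume.restrict Ω)) (p : X) :
    ‖mollify φ Ω f p‖ ≤ lpNorm f ⊤ (volume.restrict Ω) :=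
  norm_clm_mollify_le hΩ hf (ContinuousLinearMap.id ℝ F) lpNorm_nonneg
    (ae_le_lpNorm_exponent_top hf) p

theorem tsupport_normed_sub_subset (φ : ContDiffBump (0 : X)) (p : X) :
    tsupport (fun z => φ.normed volume (p - z)) ⊆ Metric.closedBall p φ.rOut := by
  refine closure_minimal (fun z hz => ?_) Metric.isClosed_closedBall
  have hz' : p - z ∈ Function.support (φ.normed volume) := hz
  rw [φ.support_normed_eq, mem_ball_zero_iff] at hz'
  rw [Metric.mem_closedBall, dist_comm, dist_eq_norm]
  exact hz'.le

theorem HasWeakFDerivOn.integral_fderiv_normed_sub {f' : X → X →L[ℝ] F}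
    (hff' : HasWeakFDerivOn Ω f f') {p : X} (hp : Metric.closedBall p φ.rOut ⊆ Ω) (w : X) :
    ∫ z in Ω, fderiv ℝ (φ.normed volume) (p - z) w • f z =
      ∫ z in Ω, φ.normed volume (p - z) • f' z w := by
  have hsupp := tsupport_normed_sub_subset φ p
  have h := hff'.2.2 (fun z => φ.normed volume (p - z))
    (φ.contDiff_normed.comp (contDiff_const.sub contDiff_id))
    (HasCompactSupport.of_support_subset_isCompact (isCompact_closedBall p φ.rOut)
      (subset_closure.trans hsupp)) (hsupp.trans hp) w
  simpa only [fderiv_normed_sub, neg_apply, neg_smul, integral_neg, neg_inj] using h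

theorem hasFDerivAt_mollify (hΩ : MeasurableSet Ω) {f' : X → X →L[ℝ] F}
    (hff' : HasWeakFDerivOn Ω f f') (hf : MemLp f ⊤ (volume.restrict Ω))
    (hf' : MemLp f' ⊤ (volume.restrict Ω)) {p : X} (hp : Metric.closedBall p φ.rOut ⊆ Ω) :
    HasFDerivAt (mollify φ Ω f) (mollify φ Ω f' p) p := by
  have hloc := locallyIntegrable_indicator_of_memLp_top hΩ hf
  refine (φ.hasCompactSupport_normed.hasFDerivAt_convolution_left
    (ContinuousLinearMap.lsmul ℝ ℝ) φ.contDiff_normed hloc p).congr_fderiv ?_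
  ext w
  have hconv := ((φ.hasCompactSupport_normed (μ := volume)).fderiv (𝕜 := ℝ)).convolutionExists_left
    (ContinuousLinearMap.precompL X (ContinuousLinearMap.lsmul ℝ ℝ : ℝ →L[ℝ] F →L[ℝ] F))
    (φ.contDiff_normed.continuous_fderiv one_ne_zero) hloc p
  rw [convolution_eq_swap, ContinuousLinearMap.integral_apply hconv.integrable_swap, mollify_apply,
    ContinuousLinearMap.integral_apply (integrable_mollify hΩ hf' p)]
  have hparts := hff'.integral_fderiv_normed_sub hp w
  rw [← integral_indicator hΩ, ← integral_indicator hΩ] at hparts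
  convert hparts using 3 with z z
  · by_cases hz : z ∈ Ω <;> simp [hz, ContinuousLinearMap.precompL_apply]
  · by_cases hz : z ∈ Ω <;> simp [hz]

theorem tendsto_mollify [CompleteSpace F] {Ω' : Set X} (hΩ : MeasurableSet Ω) (hΩ' : Ω ⊆ Ω')
    (hf : MemLp f ⊤ (volume.restrict Ω)) {φ : ℕ → ContDiffBump (0 : X)} {k : ℕ → X} {p : X}
    (hφ : Tendsto (fun n => (φ n).rOut) atTop (𝓝 0)) (hk : Tendsto k atTop (𝓝 p))
    (hball : ∀ n, Metric.closedBall (k n) (φ n).rOut ⊆ Ω) (hc : ContinuousWithinAt f Ω' p) :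
    Tendsto (fun n => mollify (φ n) Ω f (k n)) atTop (𝓝 (f p)) := by
  rw [Metric.tendsto_nhds]
  intro ε hε
  obtain ⟨δ, hδ, hd⟩ := Metric.continuousWithinAt_iff.1 hc (ε / 2) (by positivity)
  filter_upwards [hφ.eventually_lt_const (half_pos hδ),
    hk.eventually (Metric.ball_mem_nhds p (half_pos hδ))] with n hr hkp
  refine (dist_convolution_le (by positivity : 0 ≤ ε / 2) (φ n).support_normed_eq.subset
    (fun x => (φ n).nonneg_normed x) (φ n).integral_normed
    (locallyIntegrable_indicator_of_memLp_top hΩ hf).aestronglyMeasurable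
    fun x hx => ?_).trans_lt (half_lt_self hε)
  have hxΩ := hball n (Metric.ball_subset_closedBall hx)
  rw [Set.indicator_of_mem hxΩ]
  refine (hd (hΩ' hxΩ) ?_).le
  calc dist x p ≤ dist x (k n) + dist (k n) p := dist_triangle _ _ _
    _ < δ / 2 + δ / 2 := add_lt_add (lt_trans hx hr) hkp
    _ = δ := by ring

end Mollification

section C11

variable {X Y F G : Type*} [NormedAddCommGroup X] [NormedSpace ℝ X] [NormedAddCommGroup Y]
  [NormedSpace ℝ Y] [NormedAddCommGroup F] [NormedSpace ℝ F] [NormedAddCommGroup G]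
  [NormedSpace ℝ G]

/-- `f` is of class `C^{1,1}` on `s` with derivative `D`: the constant `B` bounds `f`, `D`, the
Lipschitz constant of `D` and the quadratic Taylor remainder of `f`. The set `s` need not be open;
the estimates hold up to its boundary. -/
structure HasC11BoundOn (B : ℝ) (s : Set X) (f : X → F) (D : X → X →L[ℝ] F) : Prop where
  norm_le : ∀ p ∈ s, ‖f p‖ ≤ B
  norm_deriv_le : ∀ p ∈ s, ‖D p‖ ≤ B
  norm_taylor_le : ∀ p ∈ s, ∀ q ∈ s, ‖f q - f p - D p (q - p)‖ ≤ B * ‖q - p‖ ^ 2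
  norm_deriv_sub_le : ∀ p ∈ s, ∀ q ∈ s, ‖D q - D p‖ ≤ B * ‖q - p‖

variable {B K : ℝ} {s : Set X} {f : X → F} {D : X → X →L[ℝ] F}

theorem HasC11BoundOn.mono (h : HasC11BoundOn B s f D) {B' : ℝ} (hB : B ≤ B') :
    HasC11BoundOn B' s f D where
  norm_le p hp := (h.norm_le p hp).trans hB
  norm_deriv_le p hp := (h.norm_deriv_le p hp).trans hB
  norm_taylor_le p hp q hq := (h.norm_taylor_le p hp q hq).trans (by gcongr)
  norm_deriv_sub_le p hp q hq := (h.norm_deriv_sub_le p hp q hq).trans (by gcongr)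

theorem HasC11BoundOn.hasFDerivWithinAt (h : HasC11BoundOn B s f D) {p : X} (hp : p ∈ s) :
    HasFDerivWithinAt f (D p) s p := by
  refine .of_isLittleO <| Asymptotics.IsBigO.trans_isLittleO (g := fun q => ‖q - p‖ ^ 2)
    (.of_bound B ?_) (.mono ?_ nhdsWithin_le_nhds)
  · filter_upwards [self_mem_nhdsWithin] with q hq
    simpa using h.norm_taylor_le p hp q hq
  · exact (Asymptotics.isLittleO_norm_pow_id one_lt_two).comp_tendsto
      (tendsto_sub_nhds_zero_iff.2 tendsto_id)

theorem HasC11BoundOn.comp_isometry (h : HasC11BoundOn B s f D) (M : Y →ₗᵢ[ℝ] X)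
    (L : F →ₗᵢ[ℝ] G) (hB : 0 ≤ B) :
    HasC11BoundOn B (M ⁻¹' s) (fun p => L (f (M p)))
      (fun p => (L.toContinuousLinearMap.comp (D (M p))).comp M.toContinuousLinearMap) where
  norm_le p hp := by simpa only [L.norm_map] using h.norm_le _ hp
  norm_deriv_le p hp := by
    refine ContinuousLinearMap.opNorm_le_bound _ hB fun v => ?_
    simpa using (D (M p)).le_of_opNorm_le (h.norm_deriv_le _ hp) (M v)
  norm_taylor_le p hp q hq := by
    simpa [← map_sub] using h.norm_taylor_le _ hp _ hq
  norm_deriv_sub_le p hp q hq := by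
    refine ContinuousLinearMap.opNorm_le_bound _ (by positivity) fun v => ?_
    have hD := (D (M q) - D (M p)).le_of_opNorm_le (h.norm_deriv_sub_le _ hp _ hq) (M v)
    simpa [← map_sub] using hD

theorem HasC11BoundOn.of_hasFDerivAt {D' : X → X →L[ℝ] X →L[ℝ] F} (hs : Convex ℝ s)
    (hf : ∀ p ∈ s, HasFDerivAt f (D p) p) (hD : ∀ p ∈ s, HasFDerivAt D (D' p) p)
    (hf_le : ∀ p ∈ s, ‖f p‖ ≤ B) (hD_le : ∀ p ∈ s, ‖D p‖ ≤ B) (hD'_le : ∀ p ∈ s, ‖D' p‖ ≤ B) :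
    HasC11BoundOn B s f D := by
  have hlip : ∀ p ∈ s, ∀ q ∈ s, ‖D q - D p‖ ≤ B * ‖q - p‖ := fun p hp q hq =>
    hs.norm_image_sub_le_of_norm_hasFDerivWithin_le
      (fun x hx => (hD x hx).hasFDerivWithinAt) hD'_le hp hq
  refine ⟨hf_le, hD_le, fun p hp q hq => ?_, hlip⟩
  have hB : 0 ≤ B := (norm_nonneg _).trans (hf_le p hp)
  have hseg : segment ℝ p q ⊆ s := hs.segment_subset hp hq
  calc ‖f q - f p - D p (q - p)‖ ≤ B * ‖q - p‖ * ‖q - p‖ :=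
        (convex_segment p q).norm_image_sub_le_of_norm_hasFDerivWithin_le'
          (fun x hx => (hf x (hseg hx)).hasFDerivWithinAt)
          (fun x hx => (hlip p hp x (hseg hx)).trans
            (by gcongr; exact norm_sub_le_of_mem_segment hx))
          (left_mem_segment ℝ p q) (right_mem_segment ℝ p q)
    _ = B * ‖q - p‖ ^ 2 := by ring

theorem HasC11BoundOn.exists_of_tendsto [FiniteDimensional ℝ X] [FiniteDimensional ℝ F]
    (P : (X →L[ℝ] F) →L[ℝ] G) {t : ℕ → Set X} {g : ℕ → X → F} {g' : ℕ → X → X →L[ℝ] F}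
    (hg : ∀ n, HasC11BoundOn B (t n) (g n) (g' n)) (hP : ∀ n, ∀ p ∈ t n, ‖P (g' n p)‖ ≤ K)
    {k : ℕ → X → X} (hkt : ∀ n, ∀ p ∈ s, k n p ∈ t n)
    (hk : ∀ p ∈ s, Tendsto (fun n => k n p) atTop (𝓝 p))
    (hf : ∀ p ∈ s, Tendsto (fun n => g n (k n p)) atTop (𝓝 (f p))) :
    ∃ D, HasC11BoundOn B s f D ∧ ∀ p ∈ s, ‖P (D p)‖ ≤ K := by
  let U : Ultrafilter ℕ := Ultrafilter.of atTop
  have hU : (U : Filter ℕ) ≤ atTop := Ultrafilter.of_le _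
  have hlim : ∀ p, ∃ L, p ∈ s → Tendsto (fun n => g' n (k n p)) U (𝓝 L) := by
    intro p
    by_cases hp : p ∈ s
    · have : ProperSpace (X →L[ℝ] F) := FiniteDimensional.proper ℝ _
      obtain ⟨L, -, hL⟩ := (isCompact_closedBall (0 : X →L[ℝ] F) B).ultrafilter_le_nhds
        (U.map fun n => g' n (k n p)) (by
          rw [Ultrafilter.coe_map, le_principal_iff, mem_map]
          exact univ_mem' fun n => by simpa using (hg n).norm_deriv_le _ (hkt n p hp))
      exact ⟨L, fun _ => hL⟩
    · exact ⟨0, fun hp' => absurd hp' hp⟩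
  choose D hD using hlim
  have hkU p (hp : p ∈ s) := (hk p hp).mono_left hU
  have hfU p (hp : p ∈ s) := (hf p hp).mono_left hU
  refine ⟨D, ⟨fun p hp => ?_, fun p hp => ?_, fun p hp q hq => ?_, fun p hp q hq => ?_⟩,
    fun p hp => ?_⟩
  · exact le_of_tendsto' (hfU p hp).norm fun n => (hg n).norm_le _ (hkt n p hp)
  · exact le_of_tendsto' (hD p hp).norm fun n => (hg n).norm_deriv_le _ (hkt n p hp)
  · have hsub := (hkU q hq).sub (hkU p hp)
    have happly : Tendsto (fun n => g' n (k n p) (k n q - k n p)) U (𝓝 (D p (q - p))) :=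
      ((isBoundedBilinearMap_apply (𝕜 := ℝ)).continuous.tendsto _).comp
        ((hD p hp).prodMk_nhds hsub)
    exact le_of_tendsto_of_tendsto' (((hfU q hq).sub (hfU p hp)).sub happly).norm
      ((hsub.norm.pow 2).const_mul B)
      fun n => (hg n).norm_taylor_le _ (hkt n p hp) _ (hkt n q hq)
  · exact le_of_tendsto_of_tendsto' ((hD q hq).sub (hD p hp)).norm
      (((hkU q hq).sub (hkU p hp)).norm.const_mul B)
      fun n => (hg n).norm_deriv_sub_le _ (hkt n p hp) _ (hkt n q hq)
  · exact le_of_tendsto' ((P.continuous.tendsto _).comp (hD p hp)).norm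
      fun n => hP n _ (hkt n p hp)

theorem closedBall_combo_subset_of_mem_closure {Ω : Set X} (hΩ : Convex ℝ Ω) {x₀ : X} {r : ℝ}
    (hr : 0 < r) (hball : Metric.ball x₀ r ⊆ Ω) {p : X} (hp : p ∈ closure Ω) {a : ℝ} (ha : 0 < a)
    (ha' : a ≤ 1) : Metric.closedBall ((1 - a) • p + a • x₀) (a * (r / 2)) ⊆ Ω := by
  intro z hz
  rw [mem_closedBall_iff_norm] at hz
  set d := z - ((1 - a) • p + a • x₀) with hd
  have hmem : x₀ + a⁻¹ • d ∈ interior Ω := by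
    refine interior_maximal hball Metric.isOpen_ball ?_
    rw [mem_ball_iff_norm, add_sub_cancel_left, norm_smul, norm_inv, Real.norm_of_nonneg ha.le,
      inv_mul_lt_iff₀ ha]
    exact hz.trans_lt (by gcongr; exact half_lt_self hr)
  have hz_eq : z = (1 - a) • p + a • (x₀ + a⁻¹ • d) := by
    rw [smul_add, smul_inv_smul₀ ha.ne', hd]
    abel
  rw [hz_eq]
  exact interior_subset (hΩ.combo_closure_interior_mem_interior hp hmem (by linarith) ha (by ring))

theorem convex_setOf_closedBall_subset {Ω : Set X} (hΩ : Convex ℝ Ω) (r : ℝ) :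
    Convex ℝ {p | Metric.closedBall p r ⊆ Ω} := by
  intro p hp q hq a b ha hb hab z hz
  have hmem (o : X) : o + (z - (a • p + b • q)) ∈ Metric.closedBall o r := by
    rwa [mem_closedBall_iff_norm, add_sub_cancel_left, ← mem_closedBall_iff_norm]
  have h := hΩ (hp (hmem p)) (hq (hmem q)) ha hb hab
  convert h using 1
  rw [smul_add, smul_add, add_add_add_comm, ← add_smul, hab, one_smul]
  abel

theorem hasC11BoundOn_mollify [FiniteDimensional ℝ X] [MeasureSpace X] [BorelSpace X]
    [(volume : Measure X).IsAddHaarMeasure] [CompleteSpace F] {Ω : Set X} (hΩ : IsOpen Ω)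
    (hconv : Convex ℝ Ω) {f' : X → X →L[ℝ] F} {f'' : X → X →L[ℝ] X →L[ℝ] F}
    (hf : MemLp f ⊤ (volume.restrict Ω)) (hff' : HasWeakFDerivOn Ω f f')
    (hf' : MemLp f' ⊤ (volume.restrict Ω)) (hff'' : HasWeakFDerivOn Ω f' f'')
    (hf'' : MemLp f'' ⊤ (volume.restrict Ω)) (φ : ContDiffBump (0 : X)) :
    HasC11BoundOn (max (lpNorm f ⊤ (volume.restrict Ω)) (max (lpNorm f' ⊤ (volume.restrict Ω))
      (lpNorm f'' ⊤ (volume.restrict Ω)))) {p | Metric.closedBall p φ.rOut ⊆ Ω}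
      (mollify φ Ω f) (mollify φ Ω f') :=
  have hΩ' := hΩ.measurableSet
  .of_hasFDerivAt (convex_setOf_closedBall_subset hconv _)
    (fun _ hp => hasFDerivAt_mollify hΩ' hff' hf hf' hp)
    (fun _ hp => hasFDerivAt_mollify hΩ' hff'' hf' hf'' hp)
    (fun p _ => (norm_mollify_le hΩ' hf p).trans (le_max_left _ _))
    (fun p _ => (norm_mollify_le hΩ' hf' p).trans ((le_max_left _ _).trans (le_max_right _ _)))
    (fun p _ => (norm_mollify_le hΩ' hf'' p).trans ((le_max_right _ _).trans (le_max_right _ _)))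

theorem MemW2Infty.exists_hasC11BoundOn [FiniteDimensional ℝ X] [MeasureSpace X] [BorelSpace X]
    [(volume : Measure X).IsAddHaarMeasure] [FiniteDimensional ℝ F] [CompleteSpace G] {Ω : Set X}
    (hf : MemW2Infty Ω f) (hΩ : IsOpen Ω) (hconv : Convex ℝ Ω) (hne : Ω.Nonempty)
    (hcont : ContinuousOn f (closure Ω)) (P : (X →L[ℝ] F) →L[ℝ] G) (hK : 0 ≤ K)
    (hP : ∀ᵐ p ∂(volume.restrict Ω), ‖P (weakFDerivOn Ω f p)‖ ≤ K) :
    ∃ (B : ℝ) (D : X → X →L[ℝ] F), HasC11BoundOn B (closure Ω) f D ∧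
      ∀ p ∈ closure Ω, ‖P (D p)‖ ≤ K := by
  have : CompleteSpace F := FiniteDimensional.complete ℝ F
  obtain ⟨hf_mem, f', f'', hff', hf', hff'', hf''⟩ := hf
  obtain ⟨x₀, hx₀⟩ := hne
  obtain ⟨r, hr, hball⟩ := Metric.isOpen_iff.1 hΩ x₀ hx₀
  have hPf' : ∀ᵐ p ∂(volume.restrict Ω), ‖P (f' p)‖ ≤ K := by
    filter_upwards [hP, hff'.weakFDerivOn_ae_eq hΩ] with p hp hp'
    rwa [← hp']
  -- Shrinking towards `x₀` keeps the support of the mollifier inside `Ω`.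
  let a : ℕ → ℝ := fun n => 1 / (n + 1)
  have ha_pos n : 0 < a n := by positivity
  have ha_le n : a n ≤ 1 := div_le_one_of_le₀ (by simp) (by positivity)
  have ha : Tendsto a atTop (𝓝 0) := tendsto_one_div_add_atTop_nhds_zero_nat
  have hρ n : 0 < a n * (r / 2) := mul_pos (ha_pos n) (half_pos hr)
  let φ : ℕ → ContDiffBump (0 : X) := fun n => ⟨_, _, half_pos (hρ n), half_lt_self (hρ n)⟩
  have hkt : ∀ n, ∀ p ∈ closure Ω, Metric.closedBall ((1 - a n) • p + a n • x₀) (φ n).rOut ⊆ Ω :=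
    fun n p hp => closedBall_combo_subset_of_mem_closure hconv hr hball hp (ha_pos n) (ha_le n)
  have hk (p : X) : Tendsto (fun n => (1 - a n) • p + a n • x₀) atTop (𝓝 p) := by
    simpa using ((ha.const_sub 1).smul_const p).add (ha.smul_const x₀)
  exact ⟨_, HasC11BoundOn.exists_of_tendsto P
    (fun n => hasC11BoundOn_mollify hΩ hconv hf_mem hff' hf' hff'' hf'' (φ n))
    (fun n p _ => norm_clm_mollify_le hΩ.measurableSet hf' P hK hPf' p) hkt (fun p _ => hk p)
    fun p hp => tendsto_mollify hΩ.measurableSet subset_closure hf_mem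
      (by simpa using ha.mul_const (r / 2)) (hk p) (fun n => hkt n p hp) (hcont p hp)⟩

end C11

end Sobolev

namespace GuidingCenter
open Complex (I)

section ComplexField

/-- The identification of the plane with `ℂ`. -/
noncomputable def toComplex : Plane ≃ₗᵢ[ℝ] ℂ := Complex.orthonormalBasisOneI.repr.symm

theorem toComplex_apply (v : Plane) : toComplex v = v 0 + v 1 * Complex.I := by
  simp [toComplex]

theorem toComplex_perp (v : Plane) : toComplex (perp v) = Complex.I * toComplex v := by
  rw [toComplex_apply, toComplex_apply]
  simp only [perp, Matrix.cons_val_zero, Matrix.cons_val_one]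
  push_cast
  linear_combination (v 1 : ℂ) * Complex.I_mul_I.symm

/-- The electric field in complex notation. -/
noncomputable def complexField (E : ℝ × Plane → Plane) (p : ℝ × ℂ) : ℂ :=
  toComplex (E (p.1, toComplex.symm p.2))

theorem toComplex_field (E : ℝ × Plane → Plane) (t : ℝ) (x : Plane) :
    toComplex (E (t, x)) = complexField E (t, toComplex x) := by
  simp [complexField]

/-- Bounds on a planar field `e` on `[0, ∞) × ℂ`: it is of class `C^{1,1}` with derivative `D` and
constant `B`, and its derivative in the position is bounded by `K`. The normalizations `1 ≤ B` and
`K ≤ B` make powers of `B` comparable. -/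
structure FieldBounds (B K : ℝ) (e : ℝ × ℂ → ℂ) (D : ℝ × ℂ → ℝ × ℂ →L[ℝ] ℂ) : Prop
    extends HasC11BoundOn B {p : ℝ × ℂ | 0 ≤ p.1} e D where
  one_le : 1 ≤ B
  K_nonneg : 0 ≤ K
  K_le : K ≤ B
  norm_deriv_inr_le : ∀ p : ℝ × ℂ, 0 ≤ p.1 → ∀ z, ‖D p (0, z)‖ ≤ K * ‖z‖

theorem isOpen_spaceTime : IsOpen spaceTime := isOpen_lt continuous_const continuous_fst

theorem convex_spaceTime : Convex ℝ spaceTime :=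
  (convex_Ioi (0 : ℝ)).linear_preimage (LinearMap.fst ℝ ℝ Plane)

theorem closure_spaceTime : closure spaceTime = {p : ℝ × Plane | 0 ≤ p.1} := by
  have h : spaceTime = Set.Ioi (0 : ℝ) ×ˢ (Set.univ : Set Plane) := by
    ext; simp [spaceTime]
  rw [h, closure_prod_eq, closure_Ioi, closure_univ]
  ext
  simp

theorem FieldW2Infty.ae_norm_deriv_inr_le {E : ℝ × Plane → Plane} (hE : FieldW2Infty E) :
    ∀ᵐ p ∂(volume.restrict spaceTime),
      ‖ContinuousLinearMap.precomp Plane (ContinuousLinearMap.inr ℝ ℝ Plane)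
        (weakFDerivOn spaceTime E p)‖ ≤ Kx E := by
  have hmem := (ContinuousLinearMap.precomp Plane (ContinuousLinearMap.inr ℝ ℝ Plane)).comp_memLp'
    (hE.2.memLp_weakFDerivOn isOpen_spaceTime)
  have hKx : Kx E = lpNorm _ ⊤ _ := toReal_eLpNorm hmem.aestronglyMeasurable
  rw [hKx]
  exact ae_le_lpNorm_exponent_top hmem

theorem Kx_nonneg (E : ℝ × Plane → Plane) : 0 ≤ Kx E := ENNReal.toReal_nonneg

theorem FieldW2Infty.exists_fieldBounds {E : ℝ × Plane → Plane} (hE : FieldW2Infty E) :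
    ∃ (B : ℝ) (D : ℝ × ℂ → ℝ × ℂ →L[ℝ] ℂ), FieldBounds B (Kx E) (complexField E) D := by
  have : (volume : Measure (ℝ × Plane)).IsAddHaarMeasure :=
    inferInstanceAs ((volume : Measure ℝ).prod (volume : Measure Plane)).IsAddHaarMeasure
  obtain ⟨B, D, hD, hDx⟩ := hE.2.exists_hasC11BoundOn isOpen_spaceTime convex_spaceTime
    ⟨(1, 0), zero_lt_one' ℝ⟩ (closure_spaceTime ▸ hE.1) _ (Kx_nonneg E) hE.ae_norm_deriv_inr_le
  rw [closure_spaceTime] at hD hDx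
  let M : ℝ × ℂ →ₗᵢ[ℝ] ℝ × Plane :=
    ⟨LinearMap.prodMap LinearMap.id toComplex.symm.toLinearEquiv.toLinearMap,
      fun p => by simp [Prod.norm_def]⟩
  have hB : B ≤ max B (max 1 (Kx E)) := le_max_left _ _
  exact ⟨_, _, (hD.mono hB).comp_isometry M toComplex.toLinearIsometry (by positivity),
    (le_max_left _ _).trans (le_max_right _ _), Kx_nonneg E,
    (le_max_right _ _).trans (le_max_right _ _), fun p hp z => by
      simpa [M] using ContinuousLinearMap.le_of_opNorm_le _ (hDx (M p) hp) (toComplex.symm z)⟩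

variable {B K : ℝ} {e : ℝ × ℂ → ℂ} {D : ℝ × ℂ → ℝ × ℂ →L[ℝ] ℂ}

theorem FieldBounds.B_pos (h : FieldBounds B K e D) : 0 < B := one_pos.trans_le h.one_le

theorem FieldBounds.norm_sub_le_time (h : FieldBounds B K e D) {s t : ℝ} (hs : 0 ≤ s)
    (ht : 0 ≤ t) (x : ℂ) : ‖e (t, x) - e (s, x)‖ ≤ B * |t - s| := by
  have hd : ∀ τ ∈ Set.Ici (0 : ℝ), HasDerivWithinAt (fun τ => e (τ, x)) (D (τ, x) (1, 0))
      (Set.Ici 0) τ := fun τ hτ =>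
    (h.hasFDerivWithinAt (p := (τ, x)) hτ).comp_hasDerivWithinAt τ
      ((hasDerivWithinAt_id τ _).prodMk (hasDerivWithinAt_const τ _ x)) (fun _ hq => hq)
  refine (convex_Ici 0).norm_image_sub_le_of_norm_hasDerivWithin_le hd (fun τ hτ => ?_) hs ht
  exact ((D (τ, x)).le_of_opNorm_le (h.norm_deriv_le (τ, x) hτ) _).trans (by simp [Prod.norm_def])

theorem FieldBounds.norm_sub_le_space (h : FieldBounds B K e D) {t : ℝ} (ht : 0 ≤ t) (x y : ℂ) :
    ‖e (t, y) - e (t, x)‖ ≤ K * ‖y - x‖ := by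
  have hd : ∀ z ∈ (Set.univ : Set ℂ), HasFDerivWithinAt (fun z => e (t, z))
      ((D (t, z)).comp (ContinuousLinearMap.inr ℝ ℝ ℂ)) Set.univ z := fun z _ =>
    (h.hasFDerivWithinAt (p := (t, z)) ht).comp z
      (hasFDerivAt_prodMk_right t z).hasFDerivWithinAt (fun _ _ => ht)
  refine convex_univ.norm_image_sub_le_of_norm_hasFDerivWithin_le hd (fun z _ => ?_)
    (Set.mem_univ _) (Set.mem_univ _)
  exact ContinuousLinearMap.opNorm_le_bound _ h.K_nonneg (h.norm_deriv_inr_le (t, z) ht)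

theorem FieldBounds.norm_sub_le (h : FieldBounds B K e D) {s t : ℝ} (hs : 0 ≤ s) (ht : 0 ≤ t)
    (x y : ℂ) : ‖e (t, y) - e (s, x)‖ ≤ B * |t - s| + K * ‖y - x‖ := by
  rw [← sub_add_sub_cancel' (e (t, x))]
  exact norm_add_le_of_le (h.norm_sub_le_time hs ht x) (h.norm_sub_le_space ht x y)

end ComplexField

/-! ### The scheme and the characteristics in complex notation -/

section Scheme

theorem gam_sq : gam ^ 2 = 2 * gam - 1 / 2 := by
  have h : (1 / √2) ^ 2 = (1 / 2 : ℝ) := by norm_num [div_pow]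
  rw [gam]
  linear_combination h

theorem one_fourth_lt_gam : 1 / 4 < gam := by
  have h : 1 / √2 ≤ 3 / 4 - 1 / 100 := by
    rw [div_le_iff₀ (by positivity)]
    nlinarith [Real.sq_sqrt (zero_le_two (α := ℝ)), Real.sqrt_nonneg 2]
  rw [gam]
  linarith

theorem gam_lt_one_third : gam < 1 / 3 := by
  have h : 2 / 3 < 1 / √2 := by
    rw [lt_div_iff₀ (by positivity)]
    nlinarith [Real.sq_sqrt (zero_le_two (α := ℝ)), Real.sqrt_nonneg 2]
  rw [gam]
  linarith

theorem gam_pos : 0 < gam := lt_trans (by norm_num) one_fourth_lt_gam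

theorem div_two_mul_gam (dt : ℝ) : dt / (2 * gam) = (2 - gam) * dt := by
  have h := gam_pos
  rw [div_eq_iff (by positivity)]
  linear_combination (2 * dt) * gam_sq

/-- The velocity stages of one step of size `dt`, in complex notation, for the unknown `w = ε v`
and with `lam = 1 / ε ^ 2`. The forces are frozen at `g₀` for the first two stages and at `g₁` for
the last one. Recall that `2 - γ = 1 / (2γ)`. -/
structure LinearStages (lam dt : ℝ) (g₀ g₁ w wt wh w' : ℂ) : Prop where
  wt_eq : wt = w + gam * dt * (g₀ - I * lam * wt)
  wh_eq : wh = w + (2 - gam) * dt * (g₀ - I * lam * wt)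
  w'_eq : w' = w + dt * ((1 - gam) * (g₀ - I * lam * wt) + gam * (g₁ - I * lam * w'))

/-- One step of the scheme, of size `dt` from the time `t`, in complex notation, for the unknowns
`y` and `w = ε v` and with `lam = 1 / ε ^ 2`. -/
structure ImexStep (e : ℝ × ℂ → ℂ) (lam dt t : ℝ) (y w wt yh wh y' w' : ℂ) : Prop
    extends LinearStages lam dt (e (t, y + I * w)) (e (t + (2 - gam) * dt, yh + I * wh))
      w wt wh w' where
  yh_eq : yh = y - I * ((2 - gam) * dt * e (t, y + I * wt))
  y'_eq : y' = y - I * (dt * ((1 - gam) * e (t, y + I * wt) +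
    gam * e (t + (2 - gam) * dt, yh + I * w')))

/-- The factor `1 + i γ λ Δt` inverted in the linearly implicit stages. -/
noncomputable def implicitFactor (lam dt : ℝ) : ℂ := 1 + I * (gam * lam * dt : ℝ)

theorem implicitFactor_ne_zero (lam dt : ℝ) : implicitFactor lam dt ≠ 0 := by
  intro h
  simpa [implicitFactor] using congrArg Complex.re h

theorem eq_add_mul_sub_iff (lam dt : ℝ) (a b g : ℂ) :
    a = b + gam * dt * (g - I * lam * a) ↔ a = (b + gam * dt * g) / implicitFactor lam dt := by
  rw [eq_div_iff (implicitFactor_ne_zero lam dt), implicitFactor]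
  push_cast
  constructor <;> intro h <;> linear_combination h

theorem existsUnique_imexStep (e : ℝ × ℂ → ℂ) (lam dt t : ℝ) (y w : ℂ) :
    ∃! p : (ℂ × ℂ × ℂ) × (ℂ × ℂ),
      ImexStep e lam dt t y w p.1.1 p.1.2.1 p.1.2.2 p.2.1 p.2.2 := by
  let d := implicitFactor lam dt
  let g₀ := e (t, y + I * w)
  let wt := (w + gam * dt * g₀) / d
  let yh := y - I * ((2 - gam) * dt * e (t, y + I * wt))
  let wh := w + (2 - gam) * dt * (g₀ - I * lam * wt)
  let w' := (w + dt * (1 - gam) * (g₀ - I * lam * wt) +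
    gam * dt * e (t + (2 - gam) * dt, yh + I * wh)) / d
  have hwt : wt = w + gam * dt * (g₀ - I * lam * wt) := (eq_add_mul_sub_iff _ _ _ _ _).2 rfl
  have hw' : w' = w + dt * (1 - gam) * (g₀ - I * lam * wt) +
      gam * dt * (e (t + (2 - gam) * dt, yh + I * wh) - I * lam * w') :=
    (eq_add_mul_sub_iff _ _ _ _ _).2 rfl
  let y' := y - I * (dt * ((1 - gam) * e (t, y + I * wt) +
    gam * e (t + (2 - gam) * dt, yh + I * w')))
  refine ⟨((wt, yh, wh), (y', w')), ⟨⟨hwt, rfl, by linear_combination hw'⟩, rfl, rfl⟩, ?_⟩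
  rintro ⟨⟨wt₂, yh₂, wh₂⟩, y'₂, w'₂⟩ ⟨⟨hwt₂, hwh₂, hw'₂⟩, hyh₂, hy'₂⟩
  dsimp only at hwt₂ hwh₂ hw'₂ hyh₂ hy'₂
  obtain rfl : wt₂ = wt := (eq_add_mul_sub_iff _ _ _ _ _).1 hwt₂
  obtain rfl : yh₂ = yh := hyh₂
  obtain rfl : wh₂ = wh := hwh₂
  obtain rfl : w'₂ = w' := (eq_add_mul_sub_iff _ _ _ _ _).1 (by linear_combination hw'₂)
  rw [hy'₂]

theorem existsUnique_seq {α β : Type*} (a : α) {R : ℕ → α → β → α → Prop}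
    (hR : ∀ n s, ∃! p : β × α, R n s p.1 p.2) :
    ∃! u : (ℕ → α) × (ℕ → β), u.1 0 = a ∧ ∀ n, R n (u.1 n) (u.2 n) (u.1 (n + 1)) := by
  choose F hF hF_unique using hR
  let s : ℕ → α := fun n => Nat.rec a (fun n s => (F n s).2) n
  refine ⟨(s, fun n => (F n (s n)).1), ⟨rfl, fun n => hF n (s n)⟩, ?_⟩
  rintro ⟨s₂, r₂⟩ ⟨h0, h⟩
  dsimp only at h0 h
  have hstep n : (r₂ n, s₂ (n + 1)) = F n (s₂ n) := hF_unique n _ _ (h n)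
  have hs n : s₂ n = s n := by
    induction n with
    | zero => exact h0
    | succ n ih => exact (congrArg Prod.snd (hstep n)).trans (by rw [ih])
  exact Prod.ext (funext hs) (funext fun n => (congrArg Prod.fst (hstep n)).trans (by rw [hs]))

theorem toComplex_Fy (E : ℝ × Plane → Plane) (t : ℝ) (yh w : Plane) :
    toComplex (Fy E t yh w) =
      -(I * complexField E (t, toComplex yh + I * toComplex w)) := by
  rw [Fy, map_neg, toComplex_perp, toComplex_field, map_add, toComplex_perp]

theorem toComplex_Fv (E : ℝ × Plane → Plane) (ε t : ℝ) (yh wh w : Plane) :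
    toComplex (Fv E ε t yh wh w) = complexField E (t, toComplex yh + I * toComplex wh) -
      I * (1 / ε ^ 2 : ℝ) * toComplex w := by
  rw [Fv, map_sub, map_smul, toComplex_perp, toComplex_field, map_add, toComplex_perp,
    Complex.real_smul]
  ring

theorem div_smul_sub_eq_iff {r s : ℝ} (hr : r ≠ 0) (u v F : Plane) :
    (s / r) • (u - v) = F ↔ s * toComplex u = s * toComplex v + r * toComplex F := by
  have hr' : (r : ℂ) ≠ 0 := Complex.ofReal_ne_zero.2 hr
  rw [← toComplex.injective.eq_iff, map_smul, map_sub, Complex.real_smul, Complex.ofReal_div,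
    div_mul_eq_mul_div, div_eq_iff hr']
  constructor <;> intro h <;> linear_combination h

theorem velocity_stage_iff (E : ℝ × Plane → Plane) (ε t : ℝ) {r : ℝ} (hr : r ≠ 0)
    (y v vt v' : Plane) :
    (ε / r) • (v' - v) = Fv E ε t y (ε • v) (ε • vt) ↔
      ε * toComplex v' = ε * toComplex v + r *
        (complexField E (t, toComplex y + I * (ε * toComplex v)) -
          I * (1 / ε ^ 2 : ℝ) * (ε * toComplex vt)) := by
  rw [div_smul_sub_eq_iff hr, toComplex_Fv, map_smul, map_smul, Complex.real_smul,
    Complex.real_smul]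

theorem position_stage_iff (E : ℝ × Plane → Plane) (ε t : ℝ) {r : ℝ} (hr : r ≠ 0)
    (y vt yh : Plane) :
    (1 / r) • (yh - y) = Fy E t y (ε • vt) ↔ toComplex yh =
      toComplex y - I * (r * complexField E (t, toComplex y + I * (ε * toComplex vt))) := by
  rw [div_smul_sub_eq_iff hr, toComplex_Fy, map_smul, Complex.real_smul, Complex.ofReal_one,
    one_mul, one_mul, mul_neg, ← sub_eq_add_neg, mul_left_comm]

theorem velocity_step_iff (E : ℝ × Plane → Plane) (ε t t' : ℝ) {dt : ℝ} (hdt : dt ≠ 0)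
    (y v vt yh vh v' : Plane) :
    (ε / dt) • (v' - v) = (1 - gam) • Fv E ε t y (ε • v) (ε • vt) +
        gam • Fv E ε t' yh (ε • vh) (ε • v') ↔
      ε * toComplex v' = ε * toComplex v + dt *
        ((1 - gam) * (complexField E (t, toComplex y + I * (ε * toComplex v)) -
          I * (1 / ε ^ 2 : ℝ) * (ε * toComplex vt)) +
        gam * (complexField E (t', toComplex yh + I * (ε * toComplex vh)) -
          I * (1 / ε ^ 2 : ℝ) * (ε * toComplex v'))) := by
  rw [div_smul_sub_eq_iff hdt, map_add, map_smul, map_smul, toComplex_Fv, toComplex_Fv]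
  simp only [map_smul, Complex.real_smul]
  push_cast
  rfl

theorem position_step_iff (E : ℝ × Plane → Plane) (ε t t' : ℝ) {dt : ℝ} (hdt : dt ≠ 0)
    (y vt yh y' v' : Plane) :
    (1 / dt) • (y' - y) = (1 - gam) • Fy E t y (ε • vt) + gam • Fy E t' yh (ε • v') ↔
      toComplex y' = toComplex y - I * (dt *
        ((1 - gam) * complexField E (t, toComplex y + I * (ε * toComplex vt)) +
          gam * complexField E (t', toComplex yh + I * (ε * toComplex v')))) := by
  rw [div_smul_sub_eq_iff hdt, map_add, map_smul, map_smul, toComplex_Fy, toComplex_Fy]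
  simp only [map_smul, Complex.real_smul]
  push_cast
  constructor <;> intro h <;> linear_combination h

theorem solvesScheme_iff {E : ℝ × Plane → Plane} {ε dt : ℝ} (hdt : dt ≠ 0) {x₀ v₀ : Plane}
    {T : Trajectory} : SolvesScheme E ε dt x₀ v₀ T ↔
      (T.y 0 = guidingCenter ε x₀ v₀ ∧ T.v 0 = v₀) ∧
      ∀ n : ℕ, ImexStep (complexField E) (1 / ε ^ 2) dt (n * dt) (toComplex (T.y n))
        (ε * toComplex (T.v n)) (ε * toComplex (T.vt n)) (toComplex (T.yh n))
        (ε * toComplex (T.vh n)) (toComplex (T.y (n + 1))) (ε * toComplex (T.v (n + 1))) := by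
  have hγ : gam * dt ≠ 0 := mul_ne_zero gam_pos.ne' hdt
  have hc : (2 - gam) * dt ≠ 0 := mul_ne_zero (by linarith [gam_lt_one_third]) hdt
  constructor
  · rintro ⟨hy₀, hv₀, hvt, hyh, hvh, hy', hv'⟩
    simp only [div_two_mul_gam] at hyh hvh hy' hv'
    refine ⟨⟨hy₀, hv₀⟩, fun n => ⟨⟨?_, ?_, ?_⟩, ?_, ?_⟩⟩
    · exact_mod_cast (velocity_stage_iff E ε _ hγ _ _ _ _).1 (hvt n)
    · exact_mod_cast (velocity_stage_iff E ε _ hc _ _ _ _).1 (hvh n)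
    · exact (velocity_step_iff E ε _ _ hdt _ _ _ _ _ _).1 (hv' n)
    · exact_mod_cast (position_stage_iff E ε _ hc _ _ _).1 (hyh n)
    · exact (position_step_iff E ε _ _ hdt _ _ _ _ _).1 (hy' n)
  · rintro ⟨⟨hy₀, hv₀⟩, h⟩
    refine ⟨hy₀, hv₀, fun n => ?_, fun n => ?_, fun n => ?_, fun n => ?_, fun n => ?_⟩ <;>
      try rw [div_two_mul_gam]
    · exact (velocity_stage_iff E ε _ hγ _ _ _ _).2 (by exact_mod_cast (h n).wt_eq)
    · exact (position_stage_iff E ε _ hc _ _ _).2 (by exact_mod_cast (h n).yh_eq)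
    · exact (velocity_stage_iff E ε _ hc _ _ _ _).2 (by exact_mod_cast (h n).wh_eq)
    · exact (position_step_iff E ε _ _ hdt _ _ _ _ _).2 (h n).y'_eq
    · exact (velocity_step_iff E ε _ _ hdt _ _ _ _ _ _).2 (h n).w'_eq

/-- Trajectories in complex notation, split into the states `(y, ε v)` at the times `t_n` and the
stages `(ε ṽ, ŷ, ε v̂)` of the steps. -/
noncomputable def Trajectory.equivComplex {ε : ℝ} (hε : ε ≠ 0) :
    Trajectory ≃ (ℕ → ℂ × ℂ) × (ℕ → ℂ × ℂ × ℂ) where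
  toFun T := (fun n => (toComplex (T.y n), ε * toComplex (T.v n)),
    fun n => (ε * toComplex (T.vt n), toComplex (T.yh n), ε * toComplex (T.vh n)))
  invFun u := ⟨fun n => toComplex.symm (u.1 n).1, fun n => toComplex.symm ((ε : ℂ)⁻¹ * (u.1 n).2),
    fun n => toComplex.symm ((ε : ℂ)⁻¹ * (u.2 n).1), fun n => toComplex.symm (u.2 n).2.1,
    fun n => toComplex.symm ((ε : ℂ)⁻¹ * (u.2 n).2.2)⟩
  left_inv T := by simp [hε]
  right_inv u := by simp [hε]

theorem existsUnique_solvesScheme (E : ℝ × Plane → Plane) {ε dt : ℝ} (hε : ε ≠ 0) (hdt : dt ≠ 0)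
    (x₀ v₀ : Plane) : ∃! T : Trajectory, SolvesScheme E ε dt x₀ v₀ T := by
  have hε' : (ε : ℂ) ≠ 0 := Complex.ofReal_ne_zero.2 hε
  refine ((Trajectory.equivComplex hε).existsUnique_congr fun {T} => ?_).2
    (existsUnique_seq (toComplex (guidingCenter ε x₀ v₀), ε * toComplex v₀)
      (R := fun n s r s' => ImexStep (complexField E) (1 / ε ^ 2) dt (n * dt) s.1 s.2
        r.1 r.2.1 r.2.2 s'.1 s'.2)
      fun n s => existsUnique_imexStep (complexField E) (1 / ε ^ 2) dt (n * dt) s.1 s.2)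
  rw [solvesScheme_iff hdt]
  simp [Trajectory.equivComplex, hε']

end Scheme

section Flow

/-- The characteristic system for the guiding center `y` and `w = ε v`, in complex notation and
with `lam = 1 / ε ^ 2`. -/
structure IsFlow (e : ℝ × ℂ → ℂ) (lam : ℝ) (y w : ℝ → ℂ) : Prop where
  deriv_y : ∀ t, 0 ≤ t →
    HasDerivWithinAt y (-(I * e (t, y t + I * w t))) (Set.Ici 0) t
  deriv_w : ∀ t, 0 ≤ t →
    HasDerivWithinAt w (e (t, y t + I * w t) - I * lam * w t) (Set.Ici 0) t

theorem toComplex_guidingCenter (ε : ℝ) (x v : Plane) :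
    toComplex (guidingCenter ε x v) = toComplex x - I * (ε * toComplex v) := by
  rw [guidingCenter, map_sub, map_smul, toComplex_perp, Complex.real_smul, mul_left_comm]

theorem hasDerivWithinAt_toComplex_comp {u : ℝ → Plane} {a : Plane} {s : Set ℝ} {t : ℝ}
    (hu : HasDerivWithinAt u a s t) :
    HasDerivWithinAt (fun t => toComplex (u t)) (toComplex a) s t :=
  (toComplex.toContinuousLinearEquiv : Plane →L[ℝ] ℂ).hasFDerivAt.comp_hasDerivWithinAt t hu

variable {E : ℝ × Plane → Plane} {ε : ℝ} {x₀ v₀ : Plane} {x v : ℝ → Plane}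

theorem IsCharacteristic.hasDerivWithinAt_position (hε : ε ≠ 0)
    (h : IsCharacteristic E ε x₀ v₀ x v) {t : ℝ} (ht : 0 ≤ t) :
    HasDerivWithinAt (fun t => toComplex (x t)) ((1 / ε ^ 2 : ℝ) * (ε * toComplex (v t)))
      (Set.Ici 0) t := by
  obtain ⟨a, ha, ha_eq⟩ := h.deriv_x t ht
  refine (hasDerivWithinAt_toComplex_comp ha).congr_deriv ?_
  rw [← ha_eq, map_smul, Complex.real_smul]
  push_cast
  field_simp [Complex.ofReal_ne_zero.2 hε]

theorem IsCharacteristic.hasDerivWithinAt_velocity (hε : ε ≠ 0)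
    (h : IsCharacteristic E ε x₀ v₀ x v) {t : ℝ} (ht : 0 ≤ t) :
    HasDerivWithinAt (fun t => ε * toComplex (v t)) (complexField E (t, toComplex (x t)) -
      I * (1 / ε ^ 2 : ℝ) * (ε * toComplex (v t))) (Set.Ici 0) t := by
  obtain ⟨b, hb, hb_eq⟩ := h.deriv_v t ht
  refine ((hasDerivWithinAt_toComplex_comp hb).const_mul (ε : ℂ)).congr_deriv ?_
  rw [← Complex.real_smul, ← map_smul, hb_eq, map_sub, map_smul, toComplex_perp, toComplex_field,
    Complex.real_smul]
  push_cast
  field_simp [Complex.ofReal_ne_zero.2 hε]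

theorem IsCharacteristic.isFlow (hε : ε ≠ 0) (h : IsCharacteristic E ε x₀ v₀ x v) :
    IsFlow (complexField E) (1 / ε ^ 2) (fun t => toComplex (guidingCenter ε (x t) (v t)))
      (fun t => ε * toComplex (v t)) := by
  simp only [toComplex_guidingCenter]
  constructor <;> intro t ht <;> simp only [sub_add_cancel]
  · refine ((h.hasDerivWithinAt_position hε ht).sub
      ((h.hasDerivWithinAt_velocity hε ht).const_mul I)).congr_deriv ?_
    linear_combination ((1 / ε ^ 2 : ℝ) * (ε * toComplex (v t)) : ℂ) * Complex.I_sq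
  · exact h.hasDerivWithinAt_velocity hε ht

end Flow

/-! ### Stability and a priori bounds -/

section Gronwall

theorem gronwallBound_le {δ K r x : ℝ} (hK : 0 ≤ K) (hr : 0 ≤ r) :
    gronwallBound δ K r x ≤ Real.exp (K * x) * (δ + r * x) := by
  rcases hK.eq_or_lt with rfl | hK
  · simp [gronwallBound_K0]
  have hexp : Real.exp (K * x) - 1 ≤ K * x * Real.exp (K * x) := by
    have h := mul_le_mul_of_nonneg_left (Real.add_one_le_exp (-(K * x))) (Real.exp_nonneg (K * x))
    rw [← Real.exp_add, add_neg_cancel, Real.exp_zero] at h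
    linarith
  calc gronwallBound δ K r x = δ * Real.exp (K * x) + r / K * (Real.exp (K * x) - 1) := by
        rw [gronwallBound_of_K_ne_0 hK.ne']
    _ ≤ δ * Real.exp (K * x) + r / K * (K * x * Real.exp (K * x)) := by gcongr
    _ = Real.exp (K * x) * (δ + r * x) := by field_simp

theorem le_exp_mul_of_succ_le {a : ℕ → ℝ} {c r : ℝ} (hc : 0 ≤ c) (hr : 0 ≤ r) {N : ℕ}
    (h : ∀ n < N, a (n + 1) ≤ Real.exp c * (a n + r)) {n : ℕ} (hn : n ≤ N) :
    a n ≤ Real.exp (c * n) * (a 0 + n * r) := by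
  induction n with
  | zero => simp
  | succ n ih =>
    have hr_le : r ≤ Real.exp (c * n) * r :=
      le_mul_of_one_le_left hr (Real.one_le_exp (by positivity))
    calc a (n + 1) ≤ Real.exp c * (a n + r) := h n hn
      _ ≤ Real.exp c * (Real.exp (c * n) * (a 0 + n * r) + Real.exp (c * n) * r) := by
        gcongr
        exact ih (Nat.le_of_succ_le hn)
      _ = Real.exp c * Real.exp (c * n) * (a 0 + (n + 1) * r) := by ring
      _ = Real.exp (c * (n + 1 : ℕ)) * (a 0 + (n + 1 : ℕ) * r) := by
        rw [← Real.exp_add, Nat.cast_succ, mul_add_one, add_comm c]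

end Gronwall

section LinearStages

variable {lam dt : ℝ} {g₀ g₁ w wt wh w' : ℂ}

theorem norm_implicitFactor_sq (lam dt : ℝ) :
    ‖implicitFactor lam dt‖ ^ 2 = 1 + (gam * lam * dt) ^ 2 := by
  rw [implicitFactor, ← Complex.normSq_eq_norm_sq, Complex.normSq_apply]
  simp
  ring

theorem one_le_norm_implicitFactor (lam dt : ℝ) : 1 ≤ ‖implicitFactor lam dt‖ := by
  simpa [implicitFactor] using Complex.re_le_norm (implicitFactor lam dt)

theorem le_norm_implicitFactor (lam dt : ℝ) : gam * lam * dt ≤ ‖implicitFactor lam dt‖ := by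
  simpa [implicitFactor] using Complex.im_le_norm (implicitFactor lam dt)

theorem norm_amplification_le (lam dt : ℝ) :
    ‖1 + I * ((2 * gam - 1) * lam * dt : ℝ)‖ ≤ ‖implicitFactor lam dt‖ ^ 2 := by
  have hnum : ‖1 + I * ((2 * gam - 1) * lam * dt : ℝ)‖ ^ 2 = 1 + 2 * (gam * lam * dt) ^ 2 := by
    rw [← Complex.normSq_eq_norm_sq, Complex.normSq_apply]
    simp
    linear_combination (2 * (lam * dt) ^ 2) * gam_sq
  refine le_of_sq_le_sq ?_ (by positivity)
  rw [hnum, norm_implicitFactor_sq]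
  nlinarith [sq_nonneg ((gam * lam * dt) ^ 2)]

theorem LinearStages.sub (h : LinearStages lam dt g₀ g₁ w wt wh w') {f₀ f₁ v vt vh v' : ℂ}
    (h₂ : LinearStages lam dt f₀ f₁ v vt vh v') :
    LinearStages lam dt (g₀ - f₀) (g₁ - f₁) (w - v) (wt - vt) (wh - vh) (w' - v') := by
  constructor
  · linear_combination h.wt_eq - h₂.wt_eq
  · linear_combination h.wh_eq - h₂.wh_eq
  · linear_combination h.w'_eq - h₂.w'_eq

theorem LinearStages.add_equilibrium (h : LinearStages lam dt g₀ g₁ w wt wh w') (hlam : lam ≠ 0)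
    (c : ℂ) : LinearStages lam dt (g₀ - c) (g₁ - c) (w + I * c / lam) (wt + I * c / lam)
      (wh + I * c / lam) (w' + I * c / lam) := by
  have hc : I * lam * (I * c / lam) = -c := by
    field_simp [Complex.ofReal_ne_zero.2 hlam]
    linear_combination c * Complex.I_sq
  constructor
  · linear_combination h.wt_eq + gam * dt * hc
  · linear_combination h.wh_eq + (2 - gam) * dt * hc
  · linear_combination h.w'_eq + dt * hc

theorem LinearStages.implicitFactor_mul_wt (h : LinearStages lam dt g₀ g₁ w wt wh w') :
    implicitFactor lam dt * wt = w + gam * dt * g₀ := by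
  rw [implicitFactor]
  push_cast
  linear_combination h.wt_eq

theorem LinearStages.implicitFactor_sq_mul_w' (h : LinearStages lam dt g₀ g₁ w wt wh w') :
    implicitFactor lam dt ^ 2 * w' = (1 + I * ((2 * gam - 1) * lam * dt : ℝ)) * w +
      ((1 - gam) * dt : ℝ) * g₀ + implicitFactor lam dt * ((gam * dt : ℝ) * g₁) := by
  have hwt := h.implicitFactor_mul_wt
  rw [implicitFactor] at *
  push_cast at *
  linear_combination (1 + I * (gam * lam * dt)) * h.w'_eq - (1 - gam) * dt * I * lam * hwt

theorem LinearStages.norm_wt_le (h : LinearStages lam dt g₀ g₁ w wt wh w') (hdt : 0 ≤ dt) :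
    ‖wt‖ ≤ ‖w‖ + dt * ‖g₀‖ := by
  have hγ := gam_pos
  have hγ1 : gam ≤ 1 := by linarith [gam_lt_one_third]
  calc ‖wt‖ ≤ ‖implicitFactor lam dt‖ * ‖wt‖ :=
        le_mul_of_one_le_left (norm_nonneg _) (one_le_norm_implicitFactor lam dt)
    _ = ‖w + (gam * dt : ℝ) * g₀‖ := by
        rw [← norm_mul, h.implicitFactor_mul_wt]; push_cast; rfl
    _ ≤ ‖w‖ + gam * dt * ‖g₀‖ := by
        refine (norm_add_le _ _).trans_eq ?_
        rw [norm_mul, Complex.norm_of_nonneg (by positivity)]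
    _ ≤ ‖w‖ + dt * ‖g₀‖ := by
        gcongr
        exact mul_le_of_le_one_left hdt hγ1

theorem LinearStages.norm_wh_le (h : LinearStages lam dt g₀ g₁ w wt wh w') (hdt : 0 ≤ dt) :
    ‖wh‖ ≤ 15 * ‖w‖ + 7 * (dt * ‖g₀‖) := by
  have hγ := one_fourth_lt_gam
  have hγ' := gam_pos
  have hγ2 := gam_lt_one_third
  have hwh : wh = w + ((2 - gam) / gam : ℝ) * (wt - w) := by
    push_cast
    field_simp [Complex.ofReal_ne_zero.2 hγ'.ne']
    linear_combination gam * h.wh_eq - (2 - gam) * h.wt_eq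
  have hratio : (2 - gam) / gam ≤ 7 := by
    rw [div_le_iff₀ hγ']
    linarith
  have hratio_nonneg : 0 ≤ (2 - gam) / gam := div_nonneg (by linarith) hγ'.le
  calc ‖wh‖ ≤ ‖w‖ + (2 - gam) / gam * ‖wt - w‖ := by
        rw [hwh]
        refine (norm_add_le _ _).trans_eq ?_
        rw [norm_mul, Complex.norm_of_nonneg hratio_nonneg]
    _ ≤ ‖w‖ + 7 * (‖w‖ + dt * ‖g₀‖ + ‖w‖) := by
        gcongr
        exact norm_sub_le_of_le (h.norm_wt_le hdt) le_rfl
    _ = 15 * ‖w‖ + 7 * (dt * ‖g₀‖) := by ring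

/-- L-stability: the amplification factor is at most one in modulus, and the part `dt * c₁` of the
last force is damped by the stiff term. -/
theorem LinearStages.norm_w'_le (h : LinearStages lam dt g₀ g₁ w wt wh w') (hlam : 0 < lam)
    (hdt : 0 ≤ dt) {c₀ c₁ : ℝ} (hc₀ : 0 ≤ c₀) (hc₁ : 0 ≤ c₁) (hg : ‖g₁‖ ≤ c₀ + dt * c₁) :
    ‖w'‖ ≤ ‖w‖ + dt * ‖g₀‖ + dt * c₀ + dt * (c₁ / lam) := by
  have hγ := gam_pos
  have hγ' : gam ≤ 1 := by linarith [gam_lt_one_third]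
  set d := ‖implicitFactor lam dt‖
  have hd1 : 1 ≤ d := one_le_norm_implicitFactor lam dt
  have hd2 : gam * lam * dt ≤ d := le_norm_implicitFactor lam dt
  have hg₀ : (1 - gam) * dt * ‖g₀‖ ≤ d ^ 2 * (dt * ‖g₀‖) := by
    rw [mul_assoc]
    gcongr
    nlinarith
  have hg₁ : gam * dt * ‖g₁‖ ≤ d * (dt * c₀ + dt * (c₁ / lam)) := by
    calc gam * dt * ‖g₁‖ ≤ gam * dt * (c₀ + dt * c₁) := by gcongr
      _ = gam * (dt * c₀) + gam * lam * dt * (dt * (c₁ / lam)) := by field_simp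
      _ ≤ d * (dt * c₀) + d * (dt * (c₁ / lam)) := by
          gcongr
          exact hγ'.trans hd1
      _ = d * (dt * c₀ + dt * (c₁ / lam)) := by ring
  have key : d ^ 2 * ‖w'‖ ≤ d ^ 2 * (‖w‖ + dt * ‖g₀‖ + dt * c₀ + dt * (c₁ / lam)) := by
    calc d ^ 2 * ‖w'‖ = ‖implicitFactor lam dt ^ 2 * w'‖ := by rw [norm_mul, norm_pow]
      _ ≤ d ^ 2 * ‖w‖ + (1 - gam) * dt * ‖g₀‖ + d * (gam * dt * ‖g₁‖) := by
          rw [h.implicitFactor_sq_mul_w']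
          refine norm_add₃_le.trans ?_
          simp only [norm_mul]
          rw [Complex.norm_of_nonneg (mul_nonneg (sub_nonneg.2 hγ') hdt),
            Complex.norm_of_nonneg (mul_nonneg hγ.le hdt)]
          gcongr
          exact norm_amplification_le lam dt
      _ ≤ d ^ 2 * ‖w‖ + d ^ 2 * (dt * ‖g₀‖) + d * (d * (dt * c₀ + dt * (c₁ / lam))) := by
          gcongr
      _ = d ^ 2 * (‖w‖ + dt * ‖g₀‖ + dt * c₀ + dt * (c₁ / lam)) := by ring
  exact le_of_mul_le_mul_left key (by positivity)

end LinearStages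

section Stability

variable {B K lam dt t : ℝ} {e : ℝ × ℂ → ℂ} {D : ℝ × ℂ → ℝ × ℂ →L[ℝ] ℂ}

theorem norm_add_I_mul_sub_le (a b c d : ℂ) :
    ‖(a + I * b) - (c + I * d)‖ ≤ ‖a - c‖ + ‖b - d‖ := by
  calc ‖(a + I * b) - (c + I * d)‖ = ‖(a - c) + I * (b - d)‖ := by ring_nf
    _ ≤ ‖a - c‖ + ‖b - d‖ := (norm_add_le _ _).trans_eq (by simp)

theorem norm_gam_combo_le {a b : ℂ} {α β : ℝ} (ha : ‖a‖ ≤ α) (hb : ‖b‖ ≤ β) :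
    ‖(1 - gam) * a + gam * b‖ ≤ (1 - gam) * α + gam * β := by
  have hγ := gam_pos
  have hγ' : 0 ≤ 1 - gam := by linarith [gam_lt_one_third]
  have hcast : (1 - gam : ℂ) = (1 - gam : ℝ) := by push_cast; rfl
  refine (norm_add_le _ _).trans ?_
  rw [norm_mul, norm_mul, hcast, Complex.norm_of_nonneg hγ', Complex.norm_of_nonneg hγ.le]
  gcongr

theorem norm_stage_increment_le (hdt : 0 ≤ dt) (a : ℂ) :
    ‖I * ((2 - gam) * dt * a)‖ ≤ 2 * dt * ‖a‖ := by
  have hγ := gam_pos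
  have hγ' : 0 ≤ 2 - gam := by linarith [gam_lt_one_third]
  have hcast : (2 - gam : ℂ) = (2 - gam : ℝ) := by push_cast; rfl
  rw [norm_mul, norm_mul, norm_mul, Complex.norm_I, one_mul, hcast, Complex.norm_of_nonneg hγ',
    Complex.norm_of_nonneg hdt]
  gcongr
  linarith

theorem stage_time_nonneg (hdt : 0 ≤ dt) (ht : 0 ≤ t) : 0 ≤ t + (2 - gam) * dt :=
  add_nonneg ht (mul_nonneg (by linarith [gam_lt_one_third]) hdt)

theorem FieldBounds.norm_sub_le_position (hE : FieldBounds B K e D) (ht : 0 ≤ t) (y w z v : ℂ) :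
    ‖e (t, y + I * w) - e (t, z + I * v)‖ ≤ K * (‖y - z‖ + ‖w - v‖) :=
  (hE.norm_sub_le_space ht _ _).trans
    (mul_le_mul_of_nonneg_left (norm_add_I_mul_sub_le _ _ _ _) hE.K_nonneg)

variable {y w wt yh wh y' w' z v vt zh vh z' v' : ℂ}

theorem ImexStep.norm_wt_sub_le (hE : FieldBounds B K e D) (hdt : 0 ≤ dt) (ht : 0 ≤ t)
    (h : ImexStep e lam dt t y w wt yh wh y' w') (h₂ : ImexStep e lam dt t z v vt zh vh z' v') :
    ‖wt - vt‖ ≤ (1 + K * dt) * (‖y - z‖ + ‖w - v‖) := by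
  have hstage := (h.toLinearStages.sub h₂.toLinearStages).norm_wt_le hdt
  have hg := mul_le_mul_of_nonneg_left (hE.norm_sub_le_position ht y w z v) hdt
  linarith [norm_nonneg (y - z)]

theorem ImexStep.norm_yh_sub_le (hE : FieldBounds B K e D) (hdt : 0 ≤ dt) (ht : 0 ≤ t)
    (h : ImexStep e lam dt t y w wt yh wh y' w') (h₂ : ImexStep e lam dt t z v vt zh vh z' v') :
    ‖yh - zh‖ ≤ 5 * (1 + K * dt) ^ 2 * (‖y - z‖ + ‖w - v‖) := by
  have hK := hE.K_nonneg
  set N := ‖y - z‖ + ‖w - v‖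
  have hy : ‖y - z‖ ≤ N := le_add_of_nonneg_right (norm_nonneg _)
  have ha : 0 ≤ K * dt := by positivity
  calc ‖yh - zh‖ = ‖(y - z) - I * ((2 - gam) * dt * (e (t, y + I * wt) - e (t, z + I * vt)))‖ := by
        rw [h.yh_eq, h₂.yh_eq]; ring_nf
    _ ≤ ‖y - z‖ + 2 * dt * ‖e (t, y + I * wt) - e (t, z + I * vt)‖ :=
        norm_sub_le_of_le le_rfl (norm_stage_increment_le hdt _)
    _ ≤ N + 2 * dt * (K * (N + (1 + K * dt) * N)) := by
        gcongr
        exact (hE.norm_sub_le_position ht _ _ _ _).trans (by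
          gcongr; exact h.norm_wt_sub_le hE hdt ht h₂)
    _ = (1 + 4 * (K * dt) + 2 * (K * dt) ^ 2) * N := by ring
    _ ≤ 5 * (1 + K * dt) ^ 2 * N := by
        gcongr
        nlinarith

theorem ImexStep.norm_wh_sub_le (hE : FieldBounds B K e D) (hdt : 0 ≤ dt) (ht : 0 ≤ t)
    (h : ImexStep e lam dt t y w wt yh wh y' w') (h₂ : ImexStep e lam dt t z v vt zh vh z' v') :
    ‖wh - vh‖ ≤ 15 * (1 + K * dt) * (‖y - z‖ + ‖w - v‖) := by
  have hstage := (h.toLinearStages.sub h₂.toLinearStages).norm_wh_le hdt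
  have hg := mul_le_mul_of_nonneg_left (hE.norm_sub_le_position ht y w z v) hdt
  have hK := hE.K_nonneg
  have hN : 0 ≤ K * dt * (‖y - z‖ + ‖w - v‖) := by positivity
  linarith [norm_nonneg (y - z)]

theorem ImexStep.norm_w'_sub_le (hE : FieldBounds B K e D) (hlam : 0 < lam) (hdt : 0 ≤ dt)
    (ht : 0 ≤ t) (h : ImexStep e lam dt t y w wt yh wh y' w')
    (h₂ : ImexStep e lam dt t z v vt zh vh z' v') :
    ‖w' - v'‖ ≤ ‖w - v‖ + 21 * (K * dt) * (1 + K * dt) ^ 2 * (‖y - z‖ + ‖w - v‖) := by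
  have hK := hE.K_nonneg
  set a := K * dt with ha
  have ha0 : 0 ≤ a := by positivity
  set N := ‖y - z‖ + ‖w - v‖
  have hg₀ : dt * ‖e (t, y + I * w) - e (t, z + I * v)‖ ≤ a * N := by
    refine (mul_le_mul_of_nonneg_left (hE.norm_sub_le_position ht y w z v) hdt).trans_eq ?_
    ring
  have hg₁ : ‖e (t + (2 - gam) * dt, yh + I * wh) - e (t + (2 - gam) * dt, zh + I * vh)‖ ≤
      K * (20 * (1 + a) ^ 2 * N) + dt * 0 := by
    have hle : 15 * (1 + a) * N ≤ 15 * (1 + a) ^ 2 * N := by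
      gcongr
      nlinarith
    rw [mul_zero, add_zero]
    refine (hE.norm_sub_le_position (stage_time_nonneg hdt ht) _ _ _ _).trans ?_
    gcongr
    linarith [h.norm_yh_sub_le hE hdt ht h₂, h.norm_wh_sub_le hE hdt ht h₂]
  have hle : a * N ≤ a * (1 + a) ^ 2 * N := by
    gcongr
    exact le_mul_of_one_le_right ha0 (by nlinarith)
  calc ‖w' - v'‖ ≤ ‖w - v‖ + dt * ‖e (t, y + I * w) - e (t, z + I * v)‖ +
        dt * (K * (20 * (1 + a) ^ 2 * N)) + dt * (0 / lam) :=
        (h.toLinearStages.sub h₂.toLinearStages).norm_w'_le hlam hdt (by positivity) le_rfl hg₁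
    _ ≤ ‖w - v‖ + a * (1 + a) ^ 2 * N + 20 * a * (1 + a) ^ 2 * N := by
        rw [zero_div, mul_zero, add_zero, ha]
        linarith
    _ = ‖w - v‖ + 21 * a * (1 + a) ^ 2 * N := by ring

theorem ImexStep.norm_y'_sub_le (hE : FieldBounds B K e D) (hlam : 0 < lam) (hdt : 0 ≤ dt)
    (ht : 0 ≤ t) (h : ImexStep e lam dt t y w wt yh wh y' w')
    (h₂ : ImexStep e lam dt t z v vt zh vh z' v') :
    ‖y' - z'‖ ≤ ‖y - z‖ + 11 * (K * dt) * (1 + K * dt) ^ 3 * (‖y - z‖ + ‖w - v‖) := by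
  have hK := hE.K_nonneg
  have hwt := h.norm_wt_sub_le hE hdt ht h₂
  have hyh := h.norm_yh_sub_le hE hdt ht h₂
  have hw' := h.norm_w'_sub_le hE hlam hdt ht h₂
  set a := K * dt with ha
  have ha0 : 0 ≤ a := by positivity
  set N := ‖y - z‖ + ‖w - v‖
  have hy : ‖y - z‖ ≤ N := le_add_of_nonneg_right (norm_nonneg _)
  have hw : ‖w - v‖ ≤ N := le_add_of_nonneg_left (norm_nonneg _)
  have hstart : ‖y - z‖ + ‖wt - vt‖ ≤ 2 * ((1 + a) ^ 3 * N) := by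
    have : (2 + a) * N ≤ 2 * (1 + a) ^ 3 * N := by
      gcongr
      nlinarith [pow_nonneg ha0 2, pow_nonneg ha0 3]
    linarith
  have hend : ‖yh - zh‖ + ‖w' - v'‖ ≤ 27 * ((1 + a) ^ 3 * N) := by
    have : (5 * (1 + a) ^ 2 + (1 + 21 * a * (1 + a) ^ 2)) * N ≤ 27 * (1 + a) ^ 3 * N := by
      gcongr
      nlinarith [pow_nonneg ha0 2, pow_nonneg ha0 3]
    linarith
  calc ‖y' - z'‖ = ‖(y - z) - I * (dt * ((1 - gam) * (e (t, y + I * wt) - e (t, z + I * vt)) +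
        gam * (e (t + (2 - gam) * dt, yh + I * w') - e (t + (2 - gam) * dt, zh + I * v'))))‖ := by
        rw [h.y'_eq, h₂.y'_eq]; ring_nf
    _ ≤ ‖y - z‖ + dt * ((1 - gam) * (K * (‖y - z‖ + ‖wt - vt‖)) +
        gam * (K * (‖yh - zh‖ + ‖w' - v'‖))) := by
        refine norm_sub_le_of_le le_rfl ?_
        rw [norm_mul, norm_mul, Complex.norm_I, one_mul, Complex.norm_of_nonneg hdt]
        gcongr
        exact norm_gam_combo_le (hE.norm_sub_le_position ht _ _ _ _)
          (hE.norm_sub_le_position (stage_time_nonneg hdt ht) _ _ _ _)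
    _ = ‖y - z‖ + a * ((1 - gam) * (‖y - z‖ + ‖wt - vt‖) + gam * (‖yh - zh‖ + ‖w' - v'‖)) := by
        rw [ha]; ring
    _ ≤ ‖y - z‖ + a * (1 * (2 * ((1 + a) ^ 3 * N)) + 1 / 3 * (27 * ((1 + a) ^ 3 * N))) := by
        have hγ := gam_pos
        have hγ' := gam_lt_one_third
        gcongr
        linarith
    _ = ‖y - z‖ + 11 * a * (1 + a) ^ 3 * N := by ring

theorem ImexStep.stability (hE : FieldBounds B K e D) (hlam : 0 < lam) (hdt : 0 ≤ dt)
    (ht : 0 ≤ t) (h : ImexStep e lam dt t y w wt yh wh y' w')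
    (h₂ : ImexStep e lam dt t z v vt zh vh z' v') :
    ‖y' - z'‖ + ‖w' - v'‖ ≤ Real.exp (35 * K * dt) * (‖y - z‖ + ‖w - v‖) := by
  have hy := h.norm_y'_sub_le hE hlam hdt ht h₂
  have hw := h.norm_w'_sub_le hE hlam hdt ht h₂
  have hK := hE.K_nonneg
  set a := K * dt with ha
  have ha0 : 0 ≤ a := by positivity
  set N := ‖y - z‖ + ‖w - v‖
  calc ‖y' - z'‖ + ‖w' - v'‖ ≤ (1 + 11 * a * (1 + a) ^ 3 + 21 * a * (1 + a) ^ 2) * N := by linarith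
    _ ≤ (1 + a) ^ 3 * (1 + 32 * a) * N := by
        gcongr
        nlinarith [pow_nonneg ha0 2, pow_nonneg ha0 3, pow_nonneg ha0 4]
    _ ≤ Real.exp a ^ 3 * Real.exp (32 * a) * N := by
        gcongr <;> linarith [Real.add_one_le_exp a, Real.add_one_le_exp (32 * a)]
    _ = Real.exp (35 * K * dt) * N := by
        rw [← Real.exp_nat_mul, ← Real.exp_add, ha]
        ring_nf

end Stability

section APriori

variable {B K lam dt t : ℝ} {e : ℝ × ℂ → ℂ} {D : ℝ × ℂ → ℝ × ℂ →L[ℝ] ℂ}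
  {y w wt yh wh y' w' : ℂ}

theorem ImexStep.norm_yh_sub_y_le (hE : FieldBounds B K e D) (hdt : 0 ≤ dt) (ht : 0 ≤ t)
    (h : ImexStep e lam dt t y w wt yh wh y' w') : ‖yh - y‖ ≤ 2 * dt * B := by
  rw [h.yh_eq, sub_sub_cancel_left, norm_neg]
  refine (norm_stage_increment_le hdt _).trans ?_
  gcongr
  exact hE.norm_le _ ht

theorem ImexStep.norm_y'_sub_y_le (hE : FieldBounds B K e D) (hdt : 0 ≤ dt) (ht : 0 ≤ t)
    (h : ImexStep e lam dt t y w wt yh wh y' w') : ‖y' - y‖ ≤ dt * B := by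
  rw [h.y'_eq, sub_sub_cancel_left, norm_neg, norm_mul, norm_mul, Complex.norm_I, one_mul,
    Complex.norm_of_nonneg hdt]
  gcongr
  refine (norm_gam_combo_le (hE.norm_le _ ht) (hE.norm_le _ (stage_time_nonneg hdt ht))).trans_eq ?_
  ring

theorem FieldBounds.mul_add_mul_le (hE : FieldBounds B K e D) {r : ℝ} (hr : 0 ≤ r) :
    B * r + K * (r * B) ≤ 2 * B ^ 2 * r := by
  have hB := hE.B_pos
  calc B * r + K * (r * B) ≤ B * B * r + B * (r * B) := by
        gcongr
        · exact le_mul_of_one_le_left hB.le hE.one_le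
        · exact hE.K_le
    _ = 2 * B ^ 2 * r := by ring

/-- The deviation of `w` from the equilibrium `-(i / λ) e(t, y)` of the stiff equation. -/
noncomputable def deviation (e : ℝ × ℂ → ℂ) (lam t : ℝ) (y w : ℂ) : ℂ := w + I * e (t, y) / lam

theorem FieldBounds.norm_equilibrium_le (hE : FieldBounds B K e D) (hlam : 0 < lam) (ht : 0 ≤ t)
    (y : ℂ) : ‖I * e (t, y) / lam‖ ≤ B / lam := by
  rw [norm_div, norm_mul, Complex.norm_I, one_mul, Complex.norm_of_nonneg hlam.le]
  gcongr
  exact hE.norm_le _ ht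

theorem FieldBounds.norm_le_deviation_add (hE : FieldBounds B K e D) (hlam : 0 < lam) (ht : 0 ≤ t)
    (y w : ℂ) : ‖w‖ ≤ ‖deviation e lam t y w‖ + B / lam := by
  calc ‖w‖ = ‖deviation e lam t y w - I * e (t, y) / lam‖ := by rw [deviation, add_sub_cancel_right]
    _ ≤ ‖deviation e lam t y w‖ + B / lam :=
        norm_sub_le_of_le le_rfl (hE.norm_equilibrium_le hlam ht y)

theorem FieldBounds.norm_deviation_le (hE : FieldBounds B K e D) (hlam : 0 < lam) (ht : 0 ≤ t)
    (y w : ℂ) : ‖deviation e lam t y w‖ ≤ ‖w‖ + B / lam :=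
  norm_add_le_of_le le_rfl (hE.norm_equilibrium_le hlam ht y)

theorem ImexStep.linearStages_deviation (h : ImexStep e lam dt t y w wt yh wh y' w')
    (hlam : lam ≠ 0) : LinearStages lam dt (e (t, y + I * w) - e (t, y))
      (e (t + (2 - gam) * dt, yh + I * wh) - e (t, y)) (deviation e lam t y w)
      (deviation e lam t y wt) (deviation e lam t y wh) (deviation e lam t y w') :=
  h.toLinearStages.add_equilibrium hlam (e (t, y))

theorem FieldBounds.norm_force_sub_le (hE : FieldBounds B K e D) (hlam : 0 < lam) (ht : 0 ≤ t)
    (y w : ℂ) :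
    ‖e (t, y + I * w) - e (t, y)‖ ≤ K * (‖deviation e lam t y w‖ + B / lam) := by
  have h := hE.norm_sub_le_space ht y (y + I * w)
  rw [add_sub_cancel_left, norm_mul, Complex.norm_I, one_mul] at h
  exact h.trans (mul_le_mul_of_nonneg_left (hE.norm_le_deviation_add hlam ht y w) hE.K_nonneg)

theorem ImexStep.norm_wt_le (hE : FieldBounds B K e D) (hlam : 0 < lam) (hdt : 0 ≤ dt)
    (ht : 0 ≤ t) (h : ImexStep e lam dt t y w wt yh wh y' w') :
    ‖wt‖ ≤ Real.exp (K * dt) * (‖deviation e lam t y w‖ + 2 * (B / lam)) := by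
  have hB := hE.B_pos
  have hg := mul_le_mul_of_nonneg_left (hE.norm_force_sub_le hlam ht y w) hdt
  have hstage := (h.linearStages_deviation hlam.ne').norm_wt_le hdt
  have hwt := hE.norm_le_deviation_add hlam ht y wt
  set u := ‖deviation e lam t y w‖
  have hm : 0 ≤ B / lam := by positivity
  calc ‖wt‖ ≤ (K * dt + 1) * (u + B / lam) := by linarith
    _ ≤ Real.exp (K * dt) * (u + 2 * (B / lam)) := by
        gcongr
        · exact Real.add_one_le_exp _
        · linarith

theorem ImexStep.norm_last_force_sub_le (hE : FieldBounds B K e D) (hlam : 0 < lam) (hdt : 0 ≤ dt)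
    (ht : 0 ≤ t) (h : ImexStep e lam dt t y w wt yh wh y' w') :
    ‖e (t + (2 - gam) * dt, yh + I * wh) - e (t, y)‖ ≤
      K * (15 * ‖deviation e lam t y w‖ +
        7 * (K * dt) * (‖deviation e lam t y w‖ + B / lam) + B / lam) + dt * (4 * B ^ 2) := by
  have hK := hE.K_nonneg
  have hg := mul_le_mul_of_nonneg_left (hE.norm_force_sub_le hlam ht y w) hdt
  have hstage := (h.linearStages_deviation hlam.ne').norm_wh_le hdt
  have hwh := hE.norm_le_deviation_add hlam ht y wh
  have htime : |t + (2 - gam) * dt - t| ≤ 2 * dt := by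
    rw [add_sub_cancel_left, abs_of_nonneg (mul_nonneg (by linarith [gam_lt_one_third]) hdt)]
    gcongr
    linarith [gam_pos]
  have hspace : ‖yh + I * wh - y‖ ≤ 2 * dt * B + ‖wh‖ := by
    rw [add_sub_right_comm]
    exact norm_add_le_of_le (h.norm_yh_sub_y_le hE hdt ht) (by simp)
  set u := ‖deviation e lam t y w‖
  calc ‖e (t + (2 - gam) * dt, yh + I * wh) - e (t, y)‖
      ≤ B * |t + (2 - gam) * dt - t| + K * ‖yh + I * wh - y‖ :=
        hE.norm_sub_le ht (stage_time_nonneg hdt ht) _ _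
    _ ≤ B * (2 * dt) +
        K * (2 * dt * B + (15 * u + 7 * (K * dt) * (u + B / lam) + B / lam)) := by
        have hB := hE.B_pos
        gcongr
        linarith
    _ ≤ K * (15 * u + 7 * (K * dt) * (u + B / lam) + B / lam) + 2 * B ^ 2 * (2 * dt) := by
        linarith [hE.mul_add_mul_le (r := 2 * dt) (by positivity)]
    _ = K * (15 * u + 7 * (K * dt) * (u + B / lam) + B / lam) + dt * (4 * B ^ 2) := by ring

theorem FieldBounds.norm_deviation_sub_le (hE : FieldBounds B K e D) (hlam : 0 < lam)
    (hdt : 0 ≤ dt) (ht : 0 ≤ t) (hy : ‖y' - y‖ ≤ dt * B) :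
    ‖deviation e lam (t + dt) y' w - deviation e lam t y w‖ ≤ 2 * B ^ 2 * dt / lam := by
  calc ‖deviation e lam (t + dt) y' w - deviation e lam t y w‖
      = ‖e (t + dt, y') - e (t, y)‖ / lam := by
        rw [deviation, deviation, add_sub_add_left_eq_sub, ← sub_div, ← mul_sub, norm_div, norm_mul,
          Complex.norm_I, one_mul, Complex.norm_of_nonneg hlam.le]
    _ ≤ (B * dt + K * (dt * B)) / lam := by
        gcongr
        refine (hE.norm_sub_le ht (add_nonneg ht hdt) _ _).trans ?_
        rw [add_sub_cancel_left, abs_of_nonneg hdt]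
        gcongr
        exact hE.K_nonneg
    _ ≤ 2 * B ^ 2 * dt / lam := by
        gcongr
        exact hE.mul_add_mul_le hdt

theorem ImexStep.norm_deviation_le (hE : FieldBounds B K e D) (hlam : 0 < lam) (hdt : 0 ≤ dt)
    (ht : 0 ≤ t) (h : ImexStep e lam dt t y w wt yh wh y' w') :
    ‖deviation e lam (t + dt) y' w'‖ ≤
      Real.exp (16 * K * dt) * (‖deviation e lam t y w‖ + dt * (8 * B ^ 2 / lam)) := by
  have hB := hE.B_pos
  have hK := hE.K_nonneg
  have hdrift := hE.norm_deviation_sub_le (w := w') hlam hdt ht (h.norm_y'_sub_y_le hE hdt ht)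
  have hg₀ := mul_le_mul_of_nonneg_left (hE.norm_force_sub_le hlam ht y w) hdt
  have hw' := (h.linearStages_deviation hlam.ne').norm_w'_le hlam hdt (by positivity)
    (by positivity) (h.norm_last_force_sub_le hE hlam hdt ht)
  set u := ‖deviation e lam t y w‖
  set q := dt * (B ^ 2 / lam) with hq
  set a := K * dt with ha
  have hu0 : 0 ≤ u := norm_nonneg _
  have ha0 : 0 ≤ a := by positivity
  have hq0 : 0 ≤ q := by positivity
  have hm : a * (B / lam) ≤ q := by
    calc a * (B / lam) ≤ B * dt * (B / lam) := by rw [ha]; gcongr; exact hE.K_le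
      _ = q := by rw [hq]; ring
  calc ‖deviation e lam (t + dt) y' w'‖
      ≤ ‖deviation e lam t y w'‖ + 2 * B ^ 2 * dt / lam := norm_le_norm_add_const_of_dist_le
        (by simpa only [dist_eq_norm] using hdrift)
    _ ≤ (1 + 16 * a + 7 * a ^ 2) * u + (2 + 7 * a) * (a * (B / lam)) + 6 * q := by
        have e₁ : 2 * B ^ 2 * dt / lam = 2 * q := by rw [hq]; ring
        have e₂ : dt * (4 * B ^ 2 / lam) = 4 * q := by rw [hq]; ring
        rw [e₁]
        rw [e₂] at hw'
        linarith
    _ ≤ (1 + 16 * a + 7 * a ^ 2) * u + (2 + 7 * a) * q + 6 * q := by gcongr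
    _ ≤ (1 + 16 * a + (16 * a) ^ 2 / 2) * (u + 8 * q) := by
        nlinarith [mul_nonneg ha0 hq0, mul_nonneg (sq_nonneg a) hu0, mul_nonneg (sq_nonneg a) hq0]
    _ ≤ Real.exp (16 * K * dt) * (u + dt * (8 * B ^ 2 / lam)) := by
        have e₃ : dt * (8 * B ^ 2 / lam) = 8 * q := by rw [hq]; ring
        rw [e₃, mul_assoc 16]
        gcongr
        exact Real.quadratic_le_exp_of_nonneg (by positivity)

/-- The a priori bound on `w = ε v` up to time `t`, for the scheme and for the characteristics,
when `W₀` bounds the initial value. -/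
noncomputable def wBound (B K lam W₀ t : ℝ) : ℝ :=
  Real.exp (17 * K * t) * (W₀ + 8 * B ^ 2 * (1 + t) / lam)

theorem wBound_mono {W₀ s : ℝ} (hK : 0 ≤ K) (hlam : 0 ≤ lam) (hW₀ : 0 ≤ W₀) (hs : 0 ≤ s)
    (hst : s ≤ t) : wBound B K lam W₀ s ≤ wBound B K lam W₀ t := by
  rw [wBound, wBound]
  gcongr

theorem exp_mul_deviation_le_wBound (hE : FieldBounds B K e D) (hlam : 0 < lam) {k s W₀ u₀ : ℝ}
    (hk : k ≤ 17 * K) (hs : 0 ≤ s) (hu₀ : 0 ≤ u₀) (hu₀W : u₀ ≤ W₀ + B / lam) :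
    Real.exp (k * s) * (u₀ + s * (8 * B ^ 2 / lam) + 2 * (B / lam)) ≤ wBound B K lam W₀ s := by
  have hB := hE.B_pos
  have hm : B / lam ≤ B ^ 2 / lam := by
    gcongr
    exact le_self_pow₀ hE.one_le two_ne_zero
  have hm' : 0 ≤ B / lam := by positivity
  have hsplit : 8 * B ^ 2 * (1 + s) / lam = s * (8 * B ^ 2 / lam) + 8 * (B ^ 2 / lam) := by ring
  have hsum : u₀ + s * (8 * B ^ 2 / lam) + 2 * (B / lam) ≤
      W₀ + 8 * B ^ 2 * (1 + s) / lam := by linarith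
  rw [wBound]
  exact mul_le_mul (Real.exp_le_exp.2 (by gcongr)) hsum (by positivity) (Real.exp_nonneg _)

variable {ys ws wts yhs whs : ℕ → ℂ}

theorem norm_deviation_seq_le (hE : FieldBounds B K e D) (hlam : 0 < lam) (hdt : 0 ≤ dt)
    (h : ∀ n : ℕ, ImexStep e lam dt (n * dt) (ys n) (ws n) (wts n) (yhs n) (whs n) (ys (n + 1))
      (ws (n + 1))) (n : ℕ) :
    ‖deviation e lam (n * dt) (ys n) (ws n)‖ ≤ Real.exp (16 * K * (n * dt)) *
      (‖deviation e lam 0 (ys 0) (ws 0)‖ + n * dt * (8 * B ^ 2 / lam)) := by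
  have hK := hE.K_nonneg
  have hgr := le_exp_mul_of_succ_le (a := fun n : ℕ => ‖deviation e lam (n * dt) (ys n) (ws n)‖)
    (c := 16 * K * dt) (r := dt * (8 * B ^ 2 / lam)) (by positivity) (by positivity)
    (fun n _ => by
      simpa only [Nat.cast_succ, add_one_mul] using (h n).norm_deviation_le hE hlam hdt
        (by positivity)) (le_refl n)
  simp only [Nat.cast_zero, zero_mul] at hgr
  convert hgr using 2 <;> ring_nf

theorem norm_seq_le_wBound (hE : FieldBounds B K e D) (hlam : 0 < lam) (hdt : 0 ≤ dt)
    (h : ∀ n : ℕ, ImexStep e lam dt (n * dt) (ys n) (ws n) (wts n) (yhs n) (whs n) (ys (n + 1))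
      (ws (n + 1))) (n : ℕ) : ‖ws n‖ ≤ wBound B K lam ‖ws 0‖ (n * dt) := by
  have hB := hE.B_pos
  have hK := hE.K_nonneg
  have hm : 0 ≤ B / lam := by positivity
  have hn : 0 ≤ n * dt := by positivity
  have hexp : 1 ≤ Real.exp (16 * K * (n * dt)) := Real.one_le_exp (by positivity)
  have hdev := norm_deviation_seq_le hE hlam hdt h n
  have hw := hE.norm_le_deviation_add hlam hn (ys n) (ws n)
  have hend := exp_mul_deviation_le_wBound hE hlam (by linarith : 16 * K ≤ 17 * K) hn
    (norm_nonneg (deviation e lam 0 (ys 0) (ws 0))) (hE.norm_deviation_le hlam le_rfl _ _)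
  nlinarith

theorem norm_stage_seq_le_wBound (hE : FieldBounds B K e D) (hlam : 0 < lam) (hdt : 0 ≤ dt)
    (h : ∀ n : ℕ, ImexStep e lam dt (n * dt) (ys n) (ws n) (wts n) (yhs n) (whs n) (ys (n + 1))
      (ws (n + 1))) (n : ℕ) : ‖wts n‖ ≤ wBound B K lam ‖ws 0‖ ((n + 1 : ℕ) * dt) := by
  have hB := hE.B_pos
  have hK := hE.K_nonneg
  have hn : 0 ≤ n * dt := by positivity
  have hstep : (n + 1 : ℕ) * dt = n * dt + dt := by push_cast; ring
  set u₀ := ‖deviation e lam 0 (ys 0) (ws 0)‖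
  calc ‖wts n‖ ≤ Real.exp (K * dt) *
        (‖deviation e lam (n * dt) (ys n) (ws n)‖ + 2 * (B / lam)) :=
        (h n).norm_wt_le hE hlam hdt hn
    _ ≤ Real.exp (K * dt) * (Real.exp (16 * K * (n * dt)) * (u₀ + n * dt * (8 * B ^ 2 / lam)) +
        Real.exp (16 * K * (n * dt)) * (2 * (B / lam))) := by
        have hexp : 1 ≤ Real.exp (16 * K * (n * dt)) := Real.one_le_exp (by positivity)
        refine mul_le_mul_of_nonneg_left ?_ (Real.exp_nonneg _)
        exact add_le_add (norm_deviation_seq_le hE hlam hdt h n)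
          (le_mul_of_one_le_left (by positivity) hexp)
    _ = Real.exp (K * dt + 16 * K * (n * dt)) *
        (u₀ + n * dt * (8 * B ^ 2 / lam) + 2 * (B / lam)) := by rw [Real.exp_add]; ring
    _ ≤ Real.exp (17 * K * (n * dt + dt)) *
        (u₀ + (n * dt + dt) * (8 * B ^ 2 / lam) + 2 * (B / lam)) := by
        have : 0 ≤ K * dt := by positivity
        have : 0 ≤ K * (n * dt) := by positivity
        gcongr <;> linarith
    _ ≤ wBound B K lam ‖ws 0‖ ((n + 1 : ℕ) * dt) := by
        rw [hstep]
        exact exp_mul_deviation_le_wBound hE hlam le_rfl (by positivity) (norm_nonneg _)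
          (hE.norm_deviation_le hlam le_rfl _ _)

end APriori

section FlowBounds

variable {B K lam t : ℝ} {e : ℝ × ℂ → ℂ} {D : ℝ × ℂ → ℝ × ℂ →L[ℝ] ℂ} {y w : ℝ → ℂ}

theorem IsFlow.norm_y_sub_le (h : IsFlow e lam y w) (hE : FieldBounds B K e D) {s : ℝ}
    (hs : 0 ≤ s) (hst : s ≤ t) : ‖y t - y s‖ ≤ (t - s) * B := by
  rw [mul_comm, ← Real.norm_of_nonneg (sub_nonneg.2 hst)]
  refine (convex_Ici 0).norm_image_sub_le_of_norm_hasDerivWithin_le h.deriv_y (fun τ hτ => ?_) hs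
    (hs.trans hst)
  rw [norm_neg, norm_mul, Complex.norm_I, one_mul]
  exact hE.norm_le _ hτ

theorem IsFlow.hasDerivWithinAt_field (h : IsFlow e lam y w) (hE : FieldBounds B K e D)
    (ht : 0 ≤ t) : HasDerivWithinAt (fun s => e (s, y s))
      (D (t, y t) (1, -(I * e (t, y t + I * w t)))) (Set.Ici 0) t :=
  (hE.hasFDerivWithinAt (p := (t, y t)) ht).comp_hasDerivWithinAt t
    ((hasDerivWithinAt_id t _).prodMk (h.deriv_y t ht)) (fun _ hs => hs)

/-- The rotating factor removes the stiff term, so that no factor `λ` is left in the derivative. -/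
theorem IsFlow.hasDerivWithinAt_rotated_deviation (h : IsFlow e lam y w)
    (hE : FieldBounds B K e D) (hlam : lam ≠ 0) (ht : 0 ≤ t) :
    HasDerivWithinAt (fun s : ℝ => Complex.exp (I * lam * s) * deviation e lam s (y s) (w s))
      (Complex.exp (I * lam * t) * (e (t, y t + I * w t) - e (t, y t) +
        I * D (t, y t) (1, -(I * e (t, y t + I * w t))) / lam)) (Set.Ici 0) t := by
  have hrot : HasDerivWithinAt (fun s : ℝ => Complex.exp (I * lam * s))
      (Complex.exp (I * lam * t) * (I * lam)) (Set.Ici 0) t := by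
    simpa using (((hasDerivAt_id t).ofReal_comp.const_mul (I * lam : ℂ)).cexp).hasDerivWithinAt
  refine (hrot.mul ((h.deriv_w t ht).add
    (((h.hasDerivWithinAt_field hE ht).const_mul I).div_const (lam : ℂ)))).congr_deriv ?_
  rw [Pi.add_apply]
  field_simp [Complex.ofReal_ne_zero.2 hlam]
  linear_combination lam * e (t, y t) * Complex.I_sq

theorem IsFlow.norm_rotated_deriv_le (hE : FieldBounds B K e D) (hlam : 0 < lam) (ht : 0 ≤ t)
    (y w : ℂ) :
    ‖e (t, y + I * w) - e (t, y) + I * D (t, y) (1, -(I * e (t, y + I * w))) / lam‖ ≤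
      K * ‖deviation e lam t y w‖ + 2 * B ^ 2 / lam := by
  have hB := hE.B_pos
  have hvel : ‖((1 : ℝ), -(I * e (t, y + I * w)))‖ ≤ B := by
    rw [Prod.norm_def, norm_neg, norm_mul, Complex.norm_I, one_mul, norm_one]
    exact max_le hE.one_le (hE.norm_le _ ht)
  have hD : ‖I * D (t, y) (1, -(I * e (t, y + I * w))) / lam‖ ≤ B * B / lam := by
    rw [norm_div, norm_mul, Complex.norm_I, one_mul, Complex.norm_of_nonneg hlam.le]
    gcongr
    exact ContinuousLinearMap.le_of_opNorm_le_of_le _ (hE.norm_deriv_le (t, y) ht) hvel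
  calc _ ≤ K * (‖deviation e lam t y w‖ + B / lam) + B * B / lam :=
        norm_add_le_of_le (hE.norm_force_sub_le hlam ht y w) hD
    _ = K * ‖deviation e lam t y w‖ + (K * B + B * B) / lam := by ring
    _ ≤ K * ‖deviation e lam t y w‖ + (B * B + B * B) / lam := by
        gcongr
        exact hE.K_le
    _ = K * ‖deviation e lam t y w‖ + 2 * B ^ 2 / lam := by ring

theorem norm_exp_I_mul (r s : ℝ) : ‖Complex.exp (I * r * s)‖ = 1 := by
  rw [mul_assoc, mul_comm, ← Complex.ofReal_mul]
  exact Complex.norm_exp_ofReal_mul_I _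

theorem IsFlow.norm_deviation_le (h : IsFlow e lam y w) (hE : FieldBounds B K e D)
    (hlam : 0 < lam) (ht : 0 ≤ t) :
    ‖deviation e lam t (y t) (w t)‖ ≤
      Real.exp (K * t) * (‖deviation e lam 0 (y 0) (w 0)‖ + 2 * B ^ 2 / lam * t) := by
  have hderiv s (hs : 0 ≤ s) := h.hasDerivWithinAt_rotated_deviation hE hlam.ne' hs
  have hgr := norm_le_gronwallBound_of_norm_deriv_right_le
    (δ := ‖deviation e lam 0 (y 0) (w 0)‖) (K := K) (ε := 2 * B ^ 2 / lam) (a := 0) (b := t)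
    (fun s hs => ((hderiv s hs.1).mono Set.Icc_subset_Ici_self).continuousWithinAt)
    (fun s hs => (hderiv s hs.1).mono (Set.Ici_subset_Ici.2 hs.1))
    (by rw [norm_mul, norm_exp_I_mul, one_mul])
    (fun s hs => by
      rw [norm_mul, norm_mul, norm_exp_I_mul, one_mul, one_mul]
      exact IsFlow.norm_rotated_deriv_le hE hlam hs.1 (y s) (w s)) t ⟨ht, le_rfl⟩
  rw [norm_mul, norm_exp_I_mul, one_mul, sub_zero] at hgr
  exact hgr.trans (gronwallBound_le hE.K_nonneg (by positivity))

theorem IsFlow.norm_le_wBound (h : IsFlow e lam y w) (hE : FieldBounds B K e D)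
    (hlam : 0 < lam) (ht : 0 ≤ t) : ‖w t‖ ≤ wBound B K lam ‖w 0‖ t := by
  have hB := hE.B_pos
  have hK := hE.K_nonneg
  have hexp : 1 ≤ Real.exp (K * t) := Real.one_le_exp (by positivity)
  have hend := exp_mul_deviation_le_wBound hE hlam (by linarith : K ≤ 17 * K) ht
    (norm_nonneg (deviation e lam 0 (y 0) (w 0))) (hE.norm_deviation_le hlam le_rfl _ _)
  calc ‖w t‖ ≤ Real.exp (K * t) * (‖deviation e lam 0 (y 0) (w 0)‖ + 2 * B ^ 2 / lam * t) +
        B / lam := (hE.norm_le_deviation_add hlam ht (y t) (w t)).trans (by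
          gcongr; exact h.norm_deviation_le hE hlam ht)
    _ ≤ Real.exp (K * t) * (‖deviation e lam 0 (y 0) (w 0)‖ + t * (8 * B ^ 2 / lam)) +
        Real.exp (K * t) * (2 * (B / lam)) := by
        have hm : 0 ≤ B / lam := by positivity
        have e₁ : 2 * B ^ 2 / lam * t = 2 * (t * (B ^ 2 / lam)) := by ring
        have e₂ : t * (8 * B ^ 2 / lam) = 8 * (t * (B ^ 2 / lam)) := by ring
        rw [e₁, e₂]
        gcongr
        · linarith
        · nlinarith
    _ ≤ wBound B K lam ‖w 0‖ t := by
        rw [← mul_add]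
        exact hend

end FlowBounds

/-! ### The classical estimate -/

section Taylor

theorem norm_sub_quadratic_le {E : Type*} [NormedAddCommGroup E] [NormedSpace ℝ E] {f f' : ℝ → E}
    {a q : E} {b c C : ℝ} (hbc : b ≤ c)
    (hf : ∀ s ∈ Set.Icc b c, HasDerivWithinAt f (f' s) (Set.Icc b c) s)
    (hC : ∀ s ∈ Set.Icc b c, ‖f' s - a - (s - b) • q‖ ≤ C) :
    ‖f c - f b - (c - b) • a - ((c - b) ^ 2 / 2) • q‖ ≤ C * (c - b) := by
  have hderiv s (hs : s ∈ Set.Icc b c) :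
      HasDerivWithinAt (fun s => f s - (s - b) • a - ((s - b) ^ 2 / 2) • q)
        (f' s - a - (s - b) • q) (Set.Icc b c) s := by
    have hlin : HasDerivWithinAt (fun s => s - b) 1 (Set.Icc b c) s :=
      (hasDerivWithinAt_id s _).sub_const b
    refine (((hf s hs).sub (hlin.smul_const a)).sub
      (((hlin.pow 2).div_const 2).smul_const q)).congr_deriv ?_
    simp
  have h := (convex_Icc b c).norm_image_sub_le_of_norm_hasDerivWithin_le hderiv hC
    (Set.left_mem_Icc.2 hbc) (Set.right_mem_Icc.2 hbc)
  rw [Real.norm_of_nonneg (sub_nonneg.2 hbc)] at h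
  convert h using 2
  simp only [sub_self, zero_smul, ne_eq, OfNat.ofNat_ne_zero, not_false_eq_true, zero_pow, zero_div,
    sub_zero]
  abel

theorem norm_sub_linear_le {E : Type*} [NormedAddCommGroup E] [NormedSpace ℝ E] {f f' : ℝ → E}
    {a : E} {b c C : ℝ} (hbc : b ≤ c)
    (hf : ∀ s ∈ Set.Icc b c, HasDerivWithinAt f (f' s) (Set.Icc b c) s)
    (hC : ∀ s ∈ Set.Icc b c, ‖f' s - a‖ ≤ C) :
    ‖f c - f b - (c - b) • a‖ ≤ C * (c - b) := by
  simpa using norm_sub_quadratic_le (q := 0) hbc hf (by simpa using hC)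

variable {B K t : ℝ} {e : ℝ × ℂ → ℂ} {D : ℝ × ℂ → ℝ × ℂ →L[ℝ] ℂ}

theorem FieldBounds.norm_sub_linear_le (hE : FieldBounds B K e D) (ht : 0 ≤ t)
    {σ m η : ℝ} {x z δ : ℂ} (hσ : 0 ≤ σ) (hσm : σ ≤ m) (hz : ‖z - x‖ ≤ m)
    (hδ : ‖z - x - δ‖ ≤ η) :
    ‖e (t + σ, z) - e (t, x) - D (t, x) (σ, δ)‖ ≤ B * (m ^ 2 + η) := by
  have hB := hE.B_pos
  have htaylor := hE.norm_taylor_le (t, x) ht (t + σ, z) (add_nonneg ht hσ)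
  have hstep : ‖((t + σ, z) - (t, x) : ℝ × ℂ)‖ ≤ m := by
    rw [Prod.mk_sub_mk, add_sub_cancel_left, Prod.norm_def, Real.norm_of_nonneg hσ]
    exact max_le hσm hz
  have hD : ‖D (t, x) (0, z - x - δ)‖ ≤ B * η :=
    ContinuousLinearMap.le_of_opNorm_le_of_le _ (hE.norm_deriv_le (t, x) ht) (by
      simpa [Prod.norm_def] using hδ)
  have hsplit : e (t + σ, z) - e (t, x) - D (t, x) (σ, δ) =
      (e (t + σ, z) - e (t, x) - D (t, x) ((t + σ, z) - (t, x))) + D (t, x) (0, z - x - δ) := by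
    have hlin : D (t, x) ((t + σ, z) - (t, x)) = D (t, x) (σ, δ) + D (t, x) (0, z - x - δ) := by
      rw [← map_add]
      simp
    rw [hlin]
    ring
  rw [hsplit, mul_add]
  exact norm_add_le_of_le (htaylor.trans (by gcongr)) hD

end Taylor

section FlowTaylor

/-- The right-hand side of the equation `w' = e(t, y + i w) - i λ w`. -/
noncomputable def wRate (e : ℝ × ℂ → ℂ) (lam t : ℝ) (y w : ℂ) : ℂ := e (t, y + I * w) - I * lam * w

/-- The derivative of the field along a characteristic, whose position `y + i w` moves with
velocity `λ w`. -/
noncomputable def fieldRate (D : ℝ × ℂ → ℝ × ℂ →L[ℝ] ℂ) (lam t : ℝ) (y w : ℂ) : ℂ :=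
  D (t, y + I * w) (1, lam * w)

variable {B K P lam t s : ℝ} {e : ℝ × ℂ → ℂ} {D : ℝ × ℂ → ℝ × ℂ →L[ℝ] ℂ}

theorem FieldBounds.norm_wRate_le (hE : FieldBounds B K e D) (hlam : 0 ≤ lam) (ht : 0 ≤ t)
    {y w : ℂ} (hP : B + lam * ‖w‖ ≤ P) : ‖wRate e lam t y w‖ ≤ P := by
  refine (norm_sub_le_of_le (hE.norm_le _ ht) (le_of_eq ?_)).trans hP
  rw [norm_mul, norm_mul, Complex.norm_I, one_mul, Complex.norm_of_nonneg hlam]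

theorem FieldBounds.norm_fieldRate_le (hE : FieldBounds B K e D) (hlam : 0 ≤ lam) (ht : 0 ≤ t)
    {y w : ℂ} (hP : B + lam * ‖w‖ ≤ P) : ‖fieldRate D lam t y w‖ ≤ B * P := by
  refine ContinuousLinearMap.le_of_opNorm_le_of_le _ (hE.norm_deriv_le (t, _) ht) ?_
  have h := mul_nonneg hlam (norm_nonneg w)
  rw [Prod.norm_def, norm_one, norm_mul, Complex.norm_of_nonneg hlam]
  exact max_le (by linarith [hE.one_le]) (by linarith [hE.B_pos])

variable {y w : ℝ → ℂ}

theorem IsFlow.hasDerivWithinAt_position (h : IsFlow e lam y w) (ht : 0 ≤ t) :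
    HasDerivWithinAt (fun s => y s + I * w s) (lam * w t) (Set.Ici 0) t := by
  refine ((h.deriv_y t ht).add ((h.deriv_w t ht).const_mul I)).congr_deriv ?_
  linear_combination (-lam * w t) * Complex.I_sq

variable (hE : FieldBounds B K e D) (hlam : 0 ≤ lam) (h : IsFlow e lam y w) (ht : 0 ≤ t)
  (hts : t ≤ s) (hP : ∀ τ ∈ Set.Icc t s, B + lam * ‖w τ‖ ≤ P)
include hE hlam h ht hts hP

theorem IsFlow.norm_w_sub_le : ‖w s - w t‖ ≤ P * (s - t) := by
  simpa using norm_sub_linear_le (a := 0) hts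
    (fun τ hτ => (h.deriv_w τ (ht.trans hτ.1)).mono fun _ hσ => ht.trans hσ.1)
    (fun τ hτ => by
      rw [sub_zero]
      exact hE.norm_wRate_le hlam (ht.trans hτ.1) (hP τ hτ))

theorem IsFlow.norm_position_sub_le : ‖(y s + I * w s) - (y t + I * w t)‖ ≤ P * (s - t) := by
  simpa using norm_sub_linear_le (a := 0) hts
    (fun τ hτ => (h.hasDerivWithinAt_position (ht.trans hτ.1)).mono fun _ hσ => ht.trans hσ.1)
    (fun τ hτ => by
      rw [sub_zero, norm_mul, Complex.norm_of_nonneg hlam]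
      linarith [hP τ hτ, hE.B_pos])

theorem IsFlow.norm_position_sub_linear_le :
    ‖(y s + I * w s) - (y t + I * w t) - ((s - t : ℝ) : ℂ) * (lam * w t)‖ ≤
      lam * P * (s - t) ^ 2 := by
  rw [← Complex.real_smul]
  refine (norm_sub_linear_le (C := lam * (P * (s - t))) hts
    (fun τ hτ => (h.hasDerivWithinAt_position (ht.trans hτ.1)).mono fun _ hσ => ht.trans hσ.1)
    (fun τ hτ => ?_)).trans_eq (by ring)
  have hP0 : 0 ≤ P := (norm_nonneg _).trans (hE.norm_wRate_le (y := y τ) hlam ht (hP τ hτ))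
  rw [← mul_sub, norm_mul, Complex.norm_of_nonneg hlam]
  gcongr
  refine (h.norm_w_sub_le hE hlam ht hτ.1 fun σ hσ => hP σ ⟨hσ.1, hσ.2.trans hτ.2⟩).trans ?_
  gcongr
  exact hτ.2

theorem IsFlow.norm_field_sub_le :
    ‖e (s, y s + I * w s) - e (t, y t + I * w t)‖ ≤ 2 * B * P * (s - t) := by
  have hB := hE.B_pos
  have hP1 : 1 ≤ P := by
    have := mul_nonneg hlam (norm_nonneg (w t))
    linarith [hP t (Set.left_mem_Icc.2 hts), hE.one_le]
  calc _ ≤ B * |s - t| + K * ‖(y s + I * w s) - (y t + I * w t)‖ :=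
        hE.norm_sub_le ht (ht.trans hts) _ _
    _ ≤ B * (P * (s - t)) + B * (P * (s - t)) := by
        rw [abs_of_nonneg (sub_nonneg.2 hts)]
        gcongr
        · exact le_mul_of_one_le_left (sub_nonneg.2 hts) hP1
        · exact hE.K_le
        · exact h.norm_position_sub_le hE hlam ht hts hP
    _ = 2 * B * P * (s - t) := by ring

theorem IsFlow.norm_field_sub_linear_le :
    ‖e (s, y s + I * w s) - e (t, y t + I * w t) - (s - t) • fieldRate D lam t (y t) (w t)‖ ≤
      B * (P ^ 2 + lam * P) * (s - t) ^ 2 := by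
  have hP1 : 1 ≤ P := by
    have := mul_nonneg hlam (norm_nonneg (w t))
    linarith [hP t (Set.left_mem_Icc.2 hts), hE.one_le]
  have htaylor := hE.norm_sub_linear_le ht (sub_nonneg.2 hts)
    (le_mul_of_one_le_left (sub_nonneg.2 hts) hP1) (h.norm_position_sub_le hE hlam ht hts hP)
    (h.norm_position_sub_linear_le hE hlam ht hts hP)
  have hdir : (s - t, ((s - t : ℝ) : ℂ) * (lam * w t)) = (s - t) • ((1 : ℝ), lam * w t) := by
    simp
  rw [add_sub_cancel, hdir, map_smul] at htaylor
  exact htaylor.trans_eq (by ring)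

theorem IsFlow.norm_w_sub_linear_le :
    ‖w s - w t - (s - t) • wRate e lam t (y t) (w t)‖ ≤ (2 * B + lam) * P * (s - t) ^ 2 := by
  refine (norm_sub_linear_le (C := (2 * B + lam) * P * (s - t)) hts
    (fun τ hτ => (h.deriv_w τ (ht.trans hτ.1)).mono fun _ hσ => ht.trans hσ.1)
    (fun τ hτ => ?_)).trans_eq (by ring)
  have hP' σ (hσ : σ ∈ Set.Icc t τ) : B + lam * ‖w σ‖ ≤ P := hP σ ⟨hσ.1, hσ.2.trans hτ.2⟩
  have hP0 : 0 ≤ P := (norm_nonneg _).trans (hE.norm_wRate_le (y := y τ) hlam ht (hP τ hτ))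
  have hB := hE.B_pos
  calc _ = ‖(e (τ, y τ + I * w τ) - e (t, y t + I * w t)) - I * lam * (w τ - w t)‖ := by
        rw [wRate]; ring_nf
    _ ≤ 2 * B * P * (τ - t) + lam * (P * (τ - t)) := by
        refine norm_sub_le_of_le (h.norm_field_sub_le hE hlam ht hτ.1 hP') ?_
        rw [norm_mul, norm_mul, Complex.norm_I, one_mul, Complex.norm_of_nonneg hlam]
        gcongr
        exact h.norm_w_sub_le hE hlam ht hτ.1 hP'
    _ = (2 * B + lam) * P * (τ - t) := by ring
    _ ≤ (2 * B + lam) * P * (s - t) := by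
        gcongr
        exact hτ.2

theorem IsFlow.norm_y_sub_quadratic_le :
    ‖y s - y t + I * ((s - t) • e (t, y t + I * w t) +
        ((s - t) ^ 2 / 2) • fieldRate D lam t (y t) (w t))‖ ≤
      B * (P ^ 2 + lam * P) * (s - t) ^ 3 := by
  have hP0 : 0 ≤ P := (norm_nonneg _).trans
    (hE.norm_wRate_le (y := y t) hlam ht (hP t (Set.left_mem_Icc.2 hts)))
  have hB := hE.B_pos
  have hquad := norm_sub_quadratic_le (a := -(I * e (t, y t + I * w t)))
    (q := -(I * fieldRate D lam t (y t) (w t)))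
    (C := B * (P ^ 2 + lam * P) * (s - t) ^ 2) hts
    (fun τ hτ => (h.deriv_y τ (ht.trans hτ.1)).mono fun _ hσ => ht.trans hσ.1) (fun τ hτ => ?_)
  · convert hquad using 1
    · simp only [Complex.real_smul]
      ring_nf
    · ring
  have hG := h.norm_field_sub_linear_le hE hlam ht hτ.1
    fun σ hσ => hP σ ⟨hσ.1, hσ.2.trans hτ.2⟩
  calc _ = ‖-(I * (e (τ, y τ + I * w τ) - e (t, y t + I * w t) -
          (τ - t) • fieldRate D lam t (y t) (w t)))‖ := by
        simp only [Complex.real_smul]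
        ring_nf
    _ ≤ B * (P ^ 2 + lam * P) * (τ - t) ^ 2 := by
        rwa [norm_neg, norm_mul, Complex.norm_I, one_mul]
    _ ≤ B * (P ^ 2 + lam * P) * (s - t) ^ 2 := by
        gcongr
        · exact sub_nonneg.2 hτ.1
        · exact hτ.2

theorem IsFlow.norm_w_sub_quadratic_le :
    ‖w s - w t - (s - t) • wRate e lam t (y t) (w t) - ((s - t) ^ 2 / 2) •
        (fieldRate D lam t (y t) (w t) - I * lam * wRate e lam t (y t) (w t))‖ ≤
      (B * (P ^ 2 + lam * P) + lam * ((2 * B + lam) * P)) * (s - t) ^ 3 := by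
  have hP0 : 0 ≤ P := (norm_nonneg _).trans
    (hE.norm_wRate_le (y := y t) hlam ht (hP t (Set.left_mem_Icc.2 hts)))
  have hB := hE.B_pos
  refine (norm_sub_quadratic_le
    (C := (B * (P ^ 2 + lam * P) + lam * ((2 * B + lam) * P)) * (s - t) ^ 2) hts
    (fun τ hτ => (h.deriv_w τ (ht.trans hτ.1)).mono fun _ hσ => ht.trans hσ.1)
    (fun τ hτ => ?_)).trans_eq (by ring)
  have hP' σ (hσ : σ ∈ Set.Icc t τ) : B + lam * ‖w σ‖ ≤ P := hP σ ⟨hσ.1, hσ.2.trans hτ.2⟩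
  calc _ = ‖(e (τ, y τ + I * w τ) - e (t, y t + I * w t) -
          (τ - t) • fieldRate D lam t (y t) (w t)) -
          I * lam * (w τ - w t - (τ - t) • wRate e lam t (y t) (w t))‖ := by
        simp only [Complex.real_smul, wRate]
        ring_nf
    _ ≤ B * (P ^ 2 + lam * P) * (τ - t) ^ 2 + lam * ((2 * B + lam) * P * (τ - t) ^ 2) := by
        refine norm_sub_le_of_le (h.norm_field_sub_linear_le hE hlam ht hτ.1 hP') ?_
        rw [norm_mul, norm_mul, Complex.norm_I, one_mul, Complex.norm_of_nonneg hlam]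
        gcongr
        exact h.norm_w_sub_linear_le hE hlam ht hτ.1 hP'
    _ = (B * (P ^ 2 + lam * P) + lam * ((2 * B + lam) * P)) * (τ - t) ^ 2 := by ring
    _ ≤ (B * (P ^ 2 + lam * P) + lam * ((2 * B + lam) * P)) * (s - t) ^ 2 := by
        gcongr
        · exact sub_nonneg.2 hτ.1
        · exact hτ.2

end FlowTaylor

section SchemeTaylor

variable {B K P lam dt t : ℝ} {e : ℝ × ℂ → ℂ} {D : ℝ × ℂ → ℝ × ℂ →L[ℝ] ℂ}
  {y w wt yh wh y' w' : ℂ}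

/-- The common rate of change of `w` in the two linearly implicit stages from the time `t`. -/
noncomputable def stageRate (e : ℝ × ℂ → ℂ) (lam dt t : ℝ) (y w : ℂ) : ℂ :=
  wRate e lam t y w / implicitFactor lam dt

theorem ofReal_gam_sq : (gam : ℂ) ^ 2 = 2 * gam - 1 / 2 := by
  have h := congrArg Complex.ofReal gam_sq
  push_cast at h
  exact h

theorem wRate_sub_stageRate (e : ℝ × ℂ → ℂ) (lam dt t : ℝ) (y w : ℂ) :
    wRate e lam t y w - stageRate e lam dt t y w =
      I * (gam * lam * dt * stageRate e lam dt t y w) := by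
  have h : implicitFactor lam dt * stageRate e lam dt t y w = wRate e lam t y w :=
    mul_div_cancel₀ _ (implicitFactor_ne_zero lam dt)
  rw [implicitFactor] at h
  push_cast at h
  linear_combination -h

theorem lam_mul_eq_I_mul_wRate_sub (e : ℝ × ℂ → ℂ) (lam t : ℝ) (y w : ℂ) :
    lam * w = I * (wRate e lam t y w - e (t, y + I * w)) := by
  rw [wRate]
  linear_combination lam * w * Complex.I_sq

/-- The displacement of the last position stage, to first order in the time step. -/
noncomputable def lastStageShift (e : ℝ × ℂ → ℂ) (lam dt t : ℝ) (y w : ℂ) : ℂ :=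
  dt * (I * wRate e lam t y w) - I * ((2 - gam) * dt * e (t, y + I * w))

theorem deriv_gam_combo_eq_fieldRate :
    (1 - gam) * D (t, y + I * w) (0, gam * dt * (I * wRate e lam t y w)) +
        gam * D (t, y + I * w) ((2 - gam) * dt, lastStageShift e lam dt t y w) =
      dt / 2 * fieldRate D lam t y w := by
  have hdir : (1 - gam) • ((0 : ℝ), gam * dt * (I * wRate e lam t y w)) +
      gam • ((2 - gam) * dt, lastStageShift e lam dt t y w) = (dt / 2) • ((1 : ℝ), lam * w) := by
    rw [lam_mul_eq_I_mul_wRate_sub e lam t y w, lastStageShift]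
    refine Prod.ext ?_ ?_
    · simp only [Prod.smul_mk, Prod.mk_add_mk, smul_eq_mul]
      linear_combination -dt * gam_sq
    · simp only [Prod.smul_mk, Prod.mk_add_mk, Complex.real_smul]
      push_cast
      linear_combination -dt * I * (wRate e lam t y w - e (t, y + I * w)) * ofReal_gam_sq
  have hlin := congrArg (D (t, y + I * w)) hdir
  rw [map_add, map_smul, map_smul, map_smul] at hlin
  simpa only [fieldRate, Complex.real_smul, Complex.ofReal_sub, Complex.ofReal_one,
    Complex.ofReal_div, Complex.ofReal_ofNat] using hlin

theorem ImexStep.force_sub_eq_stageRate (h : ImexStep e lam dt t y w wt yh wh y' w') :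
    e (t, y + I * w) - I * lam * wt = stageRate e lam dt t y w := by
  rw [stageRate, eq_div_iff (implicitFactor_ne_zero lam dt), implicitFactor, wRate]
  push_cast
  linear_combination -I * lam * h.wt_eq

theorem ImexStep.wt_sub_w (h : ImexStep e lam dt t y w wt yh wh y' w') :
    wt - w = gam * dt * stageRate e lam dt t y w := by
  rw [← h.force_sub_eq_stageRate]
  linear_combination h.wt_eq

theorem ImexStep.wh_sub_w (h : ImexStep e lam dt t y w wt yh wh y' w') :
    wh - w = (2 - gam) * dt * stageRate e lam dt t y w := by
  rw [← h.force_sub_eq_stageRate]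
  linear_combination h.wh_eq

theorem ImexStep.implicitFactor_mul_w'_sub_w (h : ImexStep e lam dt t y w wt yh wh y' w') :
    implicitFactor lam dt * (w' - w) =
      dt * ((1 - gam) * stageRate e lam dt t y w + gam * wRate e lam t y w +
        gam * (e (t + (2 - gam) * dt, yh + I * wh) - e (t, y + I * w))) := by
  rw [implicitFactor, wRate, ← h.force_sub_eq_stageRate]
  push_cast
  linear_combination h.w'_eq

/-- The second-order terms cancel because `γ (2 - γ) = 1 / 2`. -/
theorem ImexStep.implicitFactor_mul_w'_residual (h : ImexStep e lam dt t y w wt yh wh y' w') :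
    implicitFactor lam dt * (w' - w - dt * wRate e lam t y w -
        dt ^ 2 / 2 * (fieldRate D lam t y w - I * lam * wRate e lam t y w)) =
      gam * dt * (e (t + (2 - gam) * dt, yh + I * wh) - e (t, y + I * w) -
          (2 - gam) * dt * fieldRate D lam t y w) -
        dt * ((1 - gam) * (gam * lam * dt) ^ 2 * stageRate e lam dt t y w) -
        I * (gam * lam * dt) * (dt ^ 2 / 2 *
          (fieldRate D lam t y w - I * lam * wRate e lam t y w)) := by
  have hrate := wRate_sub_stageRate e lam dt t y w
  have hw' := h.implicitFactor_mul_w'_sub_w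
  rw [implicitFactor] at *
  push_cast at *
  linear_combination hw' + (1 - gam) * dt * (I * gam * lam * dt - 1) * hrate -
    dt ^ 2 * (fieldRate D lam t y w - I * lam * wRate e lam t y w) * ofReal_gam_sq +
    (gam * lam * dt) ^ 2 * dt * (1 - gam) * stageRate e lam dt t y w * Complex.I_sq

theorem norm_le_norm_implicitFactor_mul (lam dt : ℝ) (z : ℂ) :
    ‖z‖ ≤ ‖implicitFactor lam dt * z‖ := by
  rw [norm_mul]
  exact le_mul_of_one_le_left (norm_nonneg z) (one_le_norm_implicitFactor lam dt)

theorem norm_gam_mul_le (z : ℂ) : ‖gam * z‖ ≤ ‖z‖ / 3 := by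
  rw [norm_mul, Complex.norm_of_nonneg gam_pos.le]
  linarith [mul_le_mul_of_nonneg_right gam_lt_one_third.le (norm_nonneg z)]

theorem norm_gam_lam_dt_mul_le (hlam : 0 ≤ lam) (hdt : 0 ≤ dt) (z : ℂ) :
    ‖gam * lam * dt * z‖ ≤ lam * dt * ‖z‖ / 3 := by
  have h := norm_gam_mul_le (lam * dt * z)
  rw [norm_mul (lam * dt : ℂ), norm_mul (lam : ℂ), Complex.norm_of_nonneg hlam,
    Complex.norm_of_nonneg hdt] at h
  rwa [mul_assoc (gam : ℂ), mul_assoc (gam : ℂ)]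

theorem norm_one_sub_gam_mul_le (z : ℂ) : ‖(1 - gam) * z‖ ≤ ‖z‖ := by
  have h := gam_pos
  have h' := gam_lt_one_third
  rw [← Complex.ofReal_one, ← Complex.ofReal_sub, norm_mul,
    Complex.norm_of_nonneg (by linarith)]
  exact mul_le_of_le_one_left (norm_nonneg z) (by linarith)

theorem le_of_add_mul_norm_le (hlam : 0 ≤ lam) (hP : B + lam * ‖w‖ ≤ P) : B ≤ P :=
  (le_add_of_nonneg_right (mul_nonneg hlam (norm_nonneg w))).trans hP

variable (hE : FieldBounds B K e D) (hlam : 0 ≤ lam) (hdt : 0 ≤ dt) (ht : 0 ≤ t)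
  (hP : B + lam * ‖w‖ ≤ P)
include hE hlam ht hP

theorem FieldBounds.norm_stageRate_le : ‖stageRate e lam dt t y w‖ ≤ P := by
  refine (norm_le_norm_implicitFactor_mul lam dt _).trans ?_
  rw [stageRate, mul_div_cancel₀ _ (implicitFactor_ne_zero lam dt)]
  exact hE.norm_wRate_le hlam ht hP

include hdt

theorem FieldBounds.norm_implicit_increment_le :
    ‖gam * lam * dt * stageRate e lam dt t y w‖ ≤ lam * dt * P / 3 := by
  refine (norm_gam_lam_dt_mul_le hlam hdt _).trans ?_
  gcongr
  exact hE.norm_stageRate_le hlam ht hP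

theorem FieldBounds.norm_stageRate_sub_wRate_le :
    ‖stageRate e lam dt t y w - wRate e lam t y w‖ ≤ lam * dt * P := by
  have hinc := hE.norm_implicit_increment_le (y := y) hlam hdt ht hP
  rw [norm_sub_rev, wRate_sub_stageRate, norm_mul, Complex.norm_I, one_mul]
  linarith [norm_nonneg (gam * lam * dt * stageRate e lam dt t y w)]

theorem FieldBounds.norm_third_order_stage_le :
    ‖(1 - gam) * (gam * lam * dt) ^ 2 * stageRate e lam dt t y w‖ ≤
      B * P * (P + lam ^ 2) * dt ^ 2 := by
  have hP0 : 0 ≤ P := hE.B_pos.le.trans (le_of_add_mul_norm_le hlam hP)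
  have hB := hE.one_le
  rw [mul_assoc, sq, mul_assoc]
  calc _ ≤ lam * dt * (lam * dt * P / 3) / 3 := by
        refine (norm_one_sub_gam_mul_le _).trans ((norm_gam_lam_dt_mul_le hlam hdt _).trans ?_)
        gcongr
        exact hE.norm_implicit_increment_le hlam hdt ht hP
    _ ≤ 1 * P * (0 + lam ^ 2) * dt ^ 2 := by
        nlinarith [(by positivity : 0 ≤ lam ^ 2 * dt ^ 2 * P)]
    _ ≤ B * P * (P + lam ^ 2) * dt ^ 2 := by gcongr

theorem FieldBounds.norm_second_order_term_le :
    ‖gam * lam * dt * (dt ^ 2 / 2 * (fieldRate D lam t y w - I * lam * wRate e lam t y w))‖ ≤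
      B * P * (P + lam ^ 2) * dt ^ 3 := by
  have hP1 : 1 ≤ P := hE.one_le.trans (le_of_add_mul_norm_le hlam hP)
  have hB := hE.one_le
  refine (norm_gam_lam_dt_mul_le hlam hdt _).trans ?_
  have hacc : ‖fieldRate D lam t y w - I * lam * wRate e lam t y w‖ ≤ B * P + lam * P := by
    refine norm_sub_le_of_le (hE.norm_fieldRate_le hlam ht hP) ?_
    rw [norm_mul, norm_mul, Complex.norm_I, one_mul, Complex.norm_of_nonneg hlam]
    gcongr
    exact hE.norm_wRate_le hlam ht hP
  have hdt2 : ‖(dt ^ 2 / 2 : ℂ)‖ = dt ^ 2 / 2 := by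
    rw [norm_div, norm_pow, Complex.norm_of_nonneg hdt, Complex.norm_ofNat]
  rw [norm_mul, hdt2]
  calc _ ≤ lam * dt * (dt ^ 2 / 2 * (B * P + B * lam * P)) / 3 := by
        gcongr
        refine hacc.trans ?_
        gcongr
        exact le_mul_of_one_le_left hlam hB
    _ = B * P * ((lam + lam ^ 2) / 6) * dt ^ 3 := by ring
    _ ≤ B * P * (P + lam ^ 2) * dt ^ 3 := by
        gcongr
        nlinarith [sq_nonneg (lam - 1)]

variable (h : ImexStep e lam dt t y w wt yh wh y' w')
include h

theorem ImexStep.norm_wt_sub_w_le : ‖wt - w‖ ≤ dt * P := by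
  rw [h.wt_sub_w, mul_assoc]
  refine (norm_gam_mul_le _).trans ?_
  rw [norm_mul, Complex.norm_of_nonneg hdt]
  have hr := mul_le_mul_of_nonneg_left (hE.norm_stageRate_le (dt := dt) (y := y) hlam ht hP) hdt
  linarith [mul_nonneg hdt (norm_nonneg (stageRate e lam dt t y w))]

theorem ImexStep.norm_field_wt_sub_le :
    ‖e (t, y + I * wt) - e (t, y + I * w)‖ ≤ B * (dt * P) := by
  have hB := hE.B_pos
  refine (hE.norm_sub_le_position ht y wt y w).trans ?_
  rw [sub_self, norm_zero, zero_add]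
  gcongr
  · exact hE.K_le
  · exact h.norm_wt_sub_w_le hE hlam hdt ht hP

theorem ImexStep.norm_hat_position_sub_le :
    ‖(yh + I * wh) - (y + I * w)‖ ≤ 4 * P * dt := by
  have hBP := le_of_add_mul_norm_le hlam hP
  calc _ = ‖I * ((2 - gam) * dt * (stageRate e lam dt t y w - e (t, y + I * wt)))‖ := by
        rw [h.yh_eq]
        congr 1
        linear_combination I * h.wh_sub_w
    _ ≤ 2 * dt * (P + B) := (norm_stage_increment_le hdt _).trans (by
        gcongr
        exact norm_sub_le_of_le (hE.norm_stageRate_le hlam ht hP) (hE.norm_le _ ht))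
    _ ≤ 4 * P * dt := by nlinarith

theorem ImexStep.norm_hat_position_sub_linear_le :
    ‖(yh + I * wh) - (y + I * w) - ((2 - gam) * dt : ℝ) * (lam * w)‖ ≤
      2 * P * (lam + B) * dt ^ 2 := by
  calc _ = ‖I * ((2 - gam) * dt * ((stageRate e lam dt t y w - wRate e lam t y w) -
        (e (t, y + I * wt) - e (t, y + I * w))))‖ := by
        rw [h.yh_eq, lam_mul_eq_I_mul_wRate_sub e lam t y w]
        push_cast
        congr 1
        linear_combination I * h.wh_sub_w
    _ ≤ 2 * dt * (lam * dt * P + B * (dt * P)) := (norm_stage_increment_le hdt _).trans (by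
        gcongr
        exact norm_sub_le_of_le (hE.norm_stageRate_sub_wRate_le hlam hdt ht hP)
          (h.norm_field_wt_sub_le hE hlam hdt ht hP))
    _ = 2 * P * (lam + B) * dt ^ 2 := by ring

theorem ImexStep.norm_hat_field_sub_linear_le :
    ‖e (t + (2 - gam) * dt, yh + I * wh) - e (t, y + I * w) -
        ((2 - gam) * dt) • fieldRate D lam t y w‖ ≤ 19 * (B * P * (P + lam ^ 2)) * dt ^ 2 := by
  have hBP := le_of_add_mul_norm_le hlam hP
  have hB := hE.one_le
  have hP0 : 0 ≤ P := by linarith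
  have hγ := gam_pos
  have hγ' := gam_lt_one_third
  have htaylor := hE.norm_sub_linear_le ht (σ := (2 - gam) * dt)
    (mul_nonneg (by linarith) hdt) (by gcongr; linarith)
    (h.norm_hat_position_sub_le hE hlam hdt ht hP)
    (h.norm_hat_position_sub_linear_le hE hlam hdt ht hP)
  have hdir : ((2 - gam) * dt, (((2 - gam) * dt : ℝ) : ℂ) * (lam * w)) =
      ((2 - gam) * dt) • ((1 : ℝ), lam * w) := by simp
  rw [hdir, map_smul] at htaylor
  have hlam2 : 2 * lam ≤ P + lam ^ 2 := by nlinarith [sq_nonneg (lam - 1)]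
  calc _ ≤ B * P * (16 * P + 2 * lam + 2 * B) * dt ^ 2 := htaylor.trans_eq (by ring)
    _ ≤ B * P * (19 * (P + lam ^ 2)) * dt ^ 2 := by
        gcongr
        nlinarith [sq_nonneg lam]
    _ = 19 * (B * P * (P + lam ^ 2)) * dt ^ 2 := by ring

theorem ImexStep.norm_hat_field_sub_le :
    ‖e (t + (2 - gam) * dt, yh + I * wh) - e (t, y + I * w)‖ ≤ 6 * B * P * dt := by
  have hB := hE.one_le
  have hBP := le_of_add_mul_norm_le hlam hP
  have hγ' := gam_lt_one_third
  have hγ := gam_pos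
  have hpos := mul_nonneg (by linarith : 0 ≤ 2 - gam) hdt
  calc _ ≤ B * |t + (2 - gam) * dt - t| + K * ‖(yh + I * wh) - (y + I * w)‖ :=
        hE.norm_sub_le ht (add_nonneg ht hpos) _ _
    _ ≤ B * (2 * P * dt) + B * (4 * P * dt) := by
        rw [add_sub_cancel_left, abs_of_nonneg hpos]
        gcongr
        · nlinarith
        · exact hE.K_le
        · exact h.norm_hat_position_sub_le hE hlam hdt ht hP
    _ = 6 * B * P * dt := by ring

theorem ImexStep.norm_w'_sub_w_le : ‖w' - w‖ ≤ 2 * P * dt := by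
  have hBP := le_of_add_mul_norm_le hlam hP
  have hforce := norm_sub_le_of_le
    (hE.norm_le (t + (2 - gam) * dt, yh + I * wh) (stage_time_nonneg hdt ht))
    (hE.norm_le (t, y + I * w) ht)
  have hcombo := norm_gam_combo_le (hE.norm_stageRate_le (dt := dt) (y := y) hlam ht hP)
    (hE.norm_wRate_le (y := y) hlam ht hP)
  refine (norm_le_norm_implicitFactor_mul lam dt _).trans ?_
  rw [h.implicitFactor_mul_w'_sub_w, norm_mul, Complex.norm_of_nonneg hdt, mul_comm (2 * P)]
  gcongr
  refine (norm_add_le_of_le hcombo (norm_gam_mul_le _)).trans ?_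
  linarith [hE.B_pos]

theorem ImexStep.norm_w'_sub_linear_le :
    ‖w' - w - dt * wRate e lam t y w‖ ≤ 2 * P * (lam + B) * dt ^ 2 := by
  have hγ := norm_gam_mul_le (e (t + (2 - gam) * dt, yh + I * wh) - e (t, y + I * w))
  have hforce := h.norm_hat_field_sub_le hE hlam hdt ht hP
  have hrate : ‖gam * lam * dt * wRate e lam t y w‖ ≤ lam * dt * P := by
    have hp : lam * dt * ‖wRate e lam t y w‖ ≤ lam * dt * P := by
      gcongr
      exact hE.norm_wRate_le hlam ht hP
    linarith [norm_gam_lam_dt_mul_le hlam hdt (wRate e lam t y w),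
      (by positivity : 0 ≤ lam * dt * ‖wRate e lam t y w‖)]
  calc _ ≤ ‖implicitFactor lam dt * (w' - w - dt * wRate e lam t y w)‖ :=
        norm_le_norm_implicitFactor_mul lam dt _
    _ = dt * ‖(1 - gam) * (stageRate e lam dt t y w - wRate e lam t y w) +
          gam * (e (t + (2 - gam) * dt, yh + I * wh) - e (t, y + I * w)) -
          I * (gam * lam * dt * wRate e lam t y w)‖ := by
        rw [mul_sub, h.implicitFactor_mul_w'_sub_w, ← Complex.norm_of_nonneg hdt, ← norm_mul,
          Complex.norm_of_nonneg hdt, implicitFactor]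
        push_cast
        ring_nf
    _ ≤ dt * (lam * dt * P + 6 * B * P * dt / 3 + lam * dt * P) := by
        gcongr
        refine norm_sub_le_of_le (norm_add_le_of_le ((norm_one_sub_gam_mul_le _).trans
          (hE.norm_stageRate_sub_wRate_le hlam hdt ht hP)) (by linarith)) ?_
        rwa [norm_mul, Complex.norm_I, one_mul]
    _ = 2 * P * (lam + B) * dt ^ 2 := by ring

theorem ImexStep.norm_w'_residual_le :
    ‖w' - w - dt * wRate e lam t y w -
        dt ^ 2 / 2 * (fieldRate D lam t y w - I * lam * wRate e lam t y w)‖ ≤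
      9 * (B * P * (P + lam ^ 2)) * dt ^ 3 := by
  have hP1 : 1 ≤ P := hE.one_le.trans (le_of_add_mul_norm_le hlam hP)
  have hB := hE.one_le
  set L := B * P * (P + lam ^ 2)
  have hforce : ‖gam * dt * (e (t + (2 - gam) * dt, yh + I * wh) - e (t, y + I * w) -
      (2 - gam) * dt * fieldRate D lam t y w)‖ ≤ 7 * L * dt ^ 3 := by
    have hfield := h.norm_hat_field_sub_linear_le hE hlam hdt ht hP
    rw [Complex.real_smul] at hfield
    push_cast at hfield
    rw [mul_assoc]
    refine (norm_gam_mul_le _).trans ?_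
    rw [norm_mul, Complex.norm_of_nonneg hdt]
    have hL0 : 0 ≤ L * dt ^ 3 := by positivity
    linarith [mul_le_mul_of_nonneg_left hfield hdt]
  have hstage : ‖dt * ((1 - gam) * (gam * lam * dt) ^ 2 * stageRate e lam dt t y w)‖ ≤
      L * dt ^ 3 := by
    rw [norm_mul, Complex.norm_of_nonneg hdt]
    linarith [mul_le_mul_of_nonneg_left
      (hE.norm_third_order_stage_le (dt := dt) (y := y) hlam hdt ht hP) hdt]
  have hsecond : ‖I * (gam * lam * dt) * (dt ^ 2 / 2 *
      (fieldRate D lam t y w - I * lam * wRate e lam t y w))‖ ≤ L * dt ^ 3 := by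
    rw [mul_assoc, norm_mul, Complex.norm_I, one_mul]
    exact hE.norm_second_order_term_le hlam hdt ht hP
  have htotal := (norm_le_norm_implicitFactor_mul lam dt _).trans_eq
    (congrArg norm (h.implicitFactor_mul_w'_residual (D := D)))
  refine htotal.trans ((norm_sub_le_of_le (norm_sub_le_of_le hforce hstage) hsecond).trans ?_)
  linarith

theorem ImexStep.norm_field_wt_sub_linear_le :
    ‖e (t, y + I * wt) - e (t, y + I * w) -
        D (t, y + I * w) (0, gam * dt * (I * wRate e lam t y w))‖ ≤
      2 * (B * P * (P + lam ^ 2)) * dt ^ 2 := by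
  have hP1 : 1 ≤ P := hE.one_le.trans (le_of_add_mul_norm_le hlam hP)
  have hB := hE.one_le
  have hz : ‖y + I * wt - (y + I * w)‖ ≤ P * dt := by
    refine (norm_add_I_mul_sub_le y wt y w).trans ?_
    rw [sub_self, norm_zero, zero_add, mul_comm]
    exact h.norm_wt_sub_w_le hE hlam hdt ht hP
  have hδ : ‖y + I * wt - (y + I * w) - gam * dt * (I * wRate e lam t y w)‖ ≤
      lam * P * dt ^ 2 := by
    calc _ = ‖gam * (dt * (I * (stageRate e lam dt t y w - wRate e lam t y w)))‖ := by
          congr 1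
          linear_combination I * h.wt_sub_w
      _ ≤ dt * ‖stageRate e lam dt t y w - wRate e lam t y w‖ := by
          refine (norm_gam_mul_le _).trans ?_
          rw [norm_mul, norm_mul, Complex.norm_I, one_mul, Complex.norm_of_nonneg hdt]
          exact div_le_self (by positivity) (by norm_num)
      _ ≤ dt * (lam * dt * P) := by
          gcongr
          exact hE.norm_stageRate_sub_wRate_le hlam hdt ht hP
      _ = lam * P * dt ^ 2 := by ring
  have htaylor := hE.norm_sub_linear_le ht le_rfl (by positivity : 0 ≤ P * dt) hz hδ
  rw [add_zero] at htaylor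
  calc _ ≤ B * P * (P + lam) * dt ^ 2 := htaylor.trans_eq (by ring)
    _ ≤ B * P * (2 * (P + lam ^ 2)) * dt ^ 2 := by
        gcongr
        nlinarith [sq_nonneg (lam - 1)]
    _ = 2 * (B * P * (P + lam ^ 2)) * dt ^ 2 := by ring

theorem ImexStep.norm_last_position_sub_le :
    ‖yh + I * w' - (y + I * w)‖ ≤ 4 * P * dt := by
  have hBP := le_of_add_mul_norm_le hlam hP
  have hyh := h.norm_yh_sub_y_le hE hdt ht
  have hw' := h.norm_w'_sub_w_le hE hlam hdt ht hP
  refine (norm_add_I_mul_sub_le yh w' y w).trans ?_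
  nlinarith

theorem ImexStep.norm_last_position_sub_linear_le :
    ‖yh + I * w' - (y + I * w) - lastStageShift e lam dt t y w‖ ≤
      P * (4 * B + 2 * lam) * dt ^ 2 := by
  calc _ = ‖I * (w' - w - dt * wRate e lam t y w) -
        I * ((2 - gam) * dt * (e (t, y + I * wt) - e (t, y + I * w)))‖ := by
        rw [lastStageShift, h.yh_eq]
        ring_nf
    _ ≤ 2 * P * (lam + B) * dt ^ 2 + 2 * dt * (B * (dt * P)) := by
        refine norm_sub_le_of_le ?_ ((norm_stage_increment_le hdt _).trans ?_)
        · rw [norm_mul, Complex.norm_I, one_mul]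
          exact h.norm_w'_sub_linear_le hE hlam hdt ht hP
        · gcongr
          exact h.norm_field_wt_sub_le hE hlam hdt ht hP
    _ = P * (4 * B + 2 * lam) * dt ^ 2 := by ring

theorem ImexStep.norm_last_field_sub_linear_le :
    ‖e (t + (2 - gam) * dt, yh + I * w') - e (t, y + I * w) -
        D (t, y + I * w) ((2 - gam) * dt, lastStageShift e lam dt t y w)‖ ≤
      21 * (B * P * (P + lam ^ 2)) * dt ^ 2 := by
  have hBP := le_of_add_mul_norm_le hlam hP
  have hB := hE.one_le
  have hP0 : 0 ≤ P := by linarith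
  have hγ := gam_pos
  have hγ' := gam_lt_one_third
  have htaylor := hE.norm_sub_linear_le ht (σ := (2 - gam) * dt)
    (mul_nonneg (by linarith) hdt) (by gcongr; linarith)
    (h.norm_last_position_sub_le hE hlam hdt ht hP)
    (h.norm_last_position_sub_linear_le hE hlam hdt ht hP)
  calc _ ≤ B * P * (16 * P + 4 * B + 2 * lam) * dt ^ 2 := htaylor.trans_eq (by ring)
    _ ≤ B * P * (21 * (P + lam ^ 2)) * dt ^ 2 := by
        gcongr
        nlinarith [sq_nonneg (lam - 1), sq_nonneg lam]
    _ = 21 * (B * P * (P + lam ^ 2)) * dt ^ 2 := by ring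

theorem ImexStep.norm_y'_residual_le :
    ‖y' - y + I * (dt * e (t, y + I * w) + dt ^ 2 / 2 * fieldRate D lam t y w)‖ ≤
      9 * (B * P * (P + lam ^ 2)) * dt ^ 3 := by
  have hP0 : 0 ≤ P := hE.B_pos.le.trans (le_of_add_mul_norm_le hlam hP)
  have hB := hE.B_pos
  have hwt := h.norm_field_wt_sub_linear_le hE hlam hdt ht hP
  have hlast := h.norm_last_field_sub_linear_le hE hlam hdt ht hP
  set δ₀ := D (t, y + I * w) (0, gam * dt * (I * wRate e lam t y w))
  set δ₁ := D (t, y + I * w) ((2 - gam) * dt, lastStageShift e lam dt t y w)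
  have hcombo : (1 - gam) * δ₀ + gam * δ₁ = dt / 2 * fieldRate D lam t y w :=
    deriv_gam_combo_eq_fieldRate
  set L := B * P * (P + lam ^ 2)
  calc _ = ‖I * (dt * ((1 - gam) * (e (t, y + I * wt) - e (t, y + I * w) - δ₀) +
        gam * (e (t + (2 - gam) * dt, yh + I * w') - e (t, y + I * w) - δ₁)))‖ := by
        rw [h.y'_eq, ← norm_neg]
        congr 1
        linear_combination I * dt * hcombo
    _ ≤ dt * ((1 - gam) * (2 * L * dt ^ 2) + gam * (21 * L * dt ^ 2)) := by
        rw [norm_mul, norm_mul, Complex.norm_I, one_mul, Complex.norm_of_nonneg hdt]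
        gcongr
        exact norm_gam_combo_le hwt hlast
    _ = (2 + 19 * gam) * (L * dt ^ 3) := by ring
    _ ≤ 9 * (L * dt ^ 3) := by
        gcongr
        linarith [gam_lt_one_third]
    _ = 9 * L * dt ^ 3 := by ring

end SchemeTaylor

section ClassicalError

variable {B K P lam dt t : ℝ} {e : ℝ × ℂ → ℂ} {D : ℝ × ℂ → ℝ × ℂ →L[ℝ] ℂ} {y w : ℝ → ℂ}

theorem IsFlow.norm_sub_imexStep_le (hE : FieldBounds B K e D) (hlam : 0 ≤ lam) (hdt : 0 ≤ dt)
    (ht : 0 ≤ t) (hflow : IsFlow e lam y w)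
    (hP : ∀ τ ∈ Set.Icc t (t + dt), B + lam * ‖w τ‖ ≤ P) {wt yh wh y' w' : ℂ}
    (h : ImexStep e lam dt t (y t) (w t) wt yh wh y' w') :
    ‖y' - y (t + dt)‖ + ‖w' - w (t + dt)‖ ≤ 24 * (B * P * (P + lam ^ 2)) * dt ^ 3 := by
  have hts : t ≤ t + dt := le_add_of_nonneg_right hdt
  have hPt := hP t (Set.left_mem_Icc.2 hts)
  have hB := hE.one_le
  have hP1 : 1 ≤ P := hB.trans (le_of_add_mul_norm_le hlam hPt)
  have hlam_sq : 2 * lam ≤ P + lam ^ 2 := by nlinarith [sq_nonneg (lam - 1)]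
  set L := B * P * (P + lam ^ 2)
  have hLy : B * (P ^ 2 + lam * P) ≤ 2 * L := by
    calc B * (P ^ 2 + lam * P) = B * P * (P + lam) := by ring
      _ ≤ B * P * (2 * (P + lam ^ 2)) := by
          gcongr
          nlinarith
      _ = 2 * L := by ring
  have hLw : lam * ((2 * B + lam) * P) ≤ 2 * L := by
    calc lam * ((2 * B + lam) * P) ≤ lam * ((2 * B + B * lam) * P) := by
          gcongr
          exact le_mul_of_one_le_left hlam hB
      _ = B * P * (2 * lam + lam ^ 2) := by ring
      _ ≤ B * P * (2 * (P + lam ^ 2)) := by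
          gcongr
          linarith
      _ = 2 * L := by ring
  have hy := hflow.norm_y_sub_quadratic_le hE hlam ht hts hP
  have hw := hflow.norm_w_sub_quadratic_le hE hlam ht hts hP
  simp only [add_sub_cancel_left, Complex.real_smul] at hy hw
  push_cast at hy hw
  have hy_err := norm_sub_le_of_le (h.norm_y'_residual_le hE hlam hdt ht hPt) hy
  have hw_err := norm_sub_le_of_le (h.norm_w'_residual_le hE hlam hdt ht hPt) hw
  rw [add_sub_add_right_eq_sub, sub_sub_sub_cancel_right] at hy_err
  rw [sub_sub_sub_cancel_right, sub_sub_sub_cancel_right, sub_sub_sub_cancel_right] at hw_err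
  have hdt3 : 0 ≤ dt ^ 3 := by positivity
  nlinarith [mul_le_mul_of_nonneg_right hLy hdt3, mul_le_mul_of_nonneg_right hLw hdt3]

theorem IsFlow.classical_error (hE : FieldBounds B K e D) (hlam : 0 < lam) (hdt : 0 ≤ dt)
    (hflow : IsFlow e lam y w) {ys ws wts yhs whs : ℕ → ℂ}
    (h : ∀ n : ℕ, ImexStep e lam dt (n * dt) (ys n) (ws n) (wts n) (yhs n) (whs n)
      (ys (n + 1)) (ws (n + 1)))
    (hy0 : ys 0 = y 0) (hw0 : ws 0 = w 0) (N : ℕ)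
    (hP : ∀ τ ∈ Set.Icc 0 (N * dt), B + lam * ‖w τ‖ ≤ P) :
    ‖ys N - y (N * dt)‖ + ‖ws N - w (N * dt)‖ ≤
      Real.exp (35 * K * (N * dt)) * (N * dt) * (24 * (B * P * (P + lam ^ 2)) * dt ^ 2) := by
  have hK := hE.K_nonneg
  have hB := hE.B_pos
  have hP0 : 0 ≤ P := hB.le.trans
    (le_of_add_mul_norm_le hlam.le (hP 0 (Set.left_mem_Icc.2 (by positivity))))
  have hstep : ∀ n < N, ‖ys (n + 1) - y ((n + 1 : ℕ) * dt)‖ + ‖ws (n + 1) - w ((n + 1 : ℕ) * dt)‖ ≤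
      Real.exp (35 * K * dt) * (‖ys n - y (n * dt)‖ + ‖ws n - w (n * dt)‖ +
        24 * (B * P * (P + lam ^ 2)) * dt ^ 3) := by
    intro n hn
    have ht : 0 ≤ n * dt := by positivity
    have hsucc : ((n + 1 : ℕ) : ℝ) * dt = n * dt + dt := by push_cast; ring
    obtain ⟨⟨⟨vt, zh, vh⟩, z', v'⟩, hz, -⟩ :=
      existsUnique_imexStep e lam dt (n * dt) (y (n * dt)) (w (n * dt))
    have hlocal := hflow.norm_sub_imexStep_le hE hlam.le hdt ht (fun τ hτ => hP τ
      ⟨ht.trans hτ.1, hτ.2.trans (hsucc.symm.trans_le (by gcongr; exact hn))⟩) hz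
    have hstab := (h n).stability hE hlam hdt ht hz
    have hexp := le_mul_of_one_le_left ((by positivity : (0 : ℝ) ≤ _).trans hlocal)
      (Real.one_le_exp (by positivity : 0 ≤ 35 * K * dt))
    rw [hsucc]
    linarith [norm_sub_le_norm_sub_add_norm_sub (ys (n + 1)) z' (y (n * dt + dt)),
      norm_sub_le_norm_sub_add_norm_sub (ws (n + 1)) v' (w (n * dt + dt))]
  have hgronwall := le_exp_mul_of_succ_le
    (a := fun n => ‖ys n - y (n * dt)‖ + ‖ws n - w (n * dt)‖)
    (by positivity : 0 ≤ 35 * K * dt) (by positivity) hstep le_rfl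
  refine hgronwall.trans_eq ?_
  simp only [Nat.cast_zero, zero_mul, hy0, hw0, sub_self, norm_zero, add_zero, zero_add]
  ring_nf

end ClassicalError

/-! ### The uniform estimate -/

section LimitStep

variable {B K dt t : ℝ} {e : ℝ × ℂ → ℂ} {D : ℝ × ℂ → ℝ × ℂ →L[ℝ] ℂ}

/-- The intermediate stage of `limitStep`. -/
noncomputable def limitStage (e : ℝ × ℂ → ℂ) (dt t : ℝ) (z : ℂ) : ℂ :=
  z - I * ((2 - gam) * dt * e (t, z))

/-- One step of the explicit second-order scheme for the guiding center equation `z' = -i e(t, z)`,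
obtained from the full scheme as `ε → 0`. -/
noncomputable def limitStep (e : ℝ × ℂ → ℂ) (dt t : ℝ) (z : ℂ) : ℂ :=
  z - I * (dt * ((1 - gam) * e (t, z) + gam * e (t + (2 - gam) * dt, limitStage e dt t z)))

variable (hE : FieldBounds B K e D) (hdt : 0 ≤ dt) (ht : 0 ≤ t)
include hE hdt ht

theorem FieldBounds.norm_limitStage_sub_le (a b : ℂ) :
    ‖limitStage e dt t a - limitStage e dt t b‖ ≤ (1 + 2 * (dt * K)) * ‖a - b‖ := by
  calc _ = ‖(a - b) - I * ((2 - gam) * dt * (e (t, a) - e (t, b)))‖ := by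
        rw [limitStage, limitStage]; ring_nf
    _ ≤ ‖a - b‖ + 2 * dt * (K * ‖a - b‖) := norm_sub_le_of_le le_rfl
        ((norm_stage_increment_le hdt _).trans (by gcongr; exact hE.norm_sub_le_space ht b a))
    _ = (1 + 2 * (dt * K)) * ‖a - b‖ := by ring

theorem FieldBounds.norm_limitStep_sub_sub_le (a b : ℂ) :
    ‖limitStep e dt t a - limitStep e dt t b - (a - b)‖ ≤
      dt * K * (1 + dt * K) * ‖a - b‖ := by
  have hK := hE.K_nonneg
  set N := ‖a - b‖
  calc _ = ‖I * (dt * ((1 - gam) * (e (t, a) - e (t, b)) +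
        gam * (e (t + (2 - gam) * dt, limitStage e dt t a) -
          e (t + (2 - gam) * dt, limitStage e dt t b))))‖ := by
        rw [limitStep, limitStep, ← norm_neg]; ring_nf
    _ ≤ dt * ((1 - gam) * (K * N) + gam * (K * ((1 + 2 * (dt * K)) * N))) := by
        rw [norm_mul, norm_mul, Complex.norm_I, one_mul, Complex.norm_of_nonneg hdt]
        gcongr
        refine norm_gam_combo_le (hE.norm_sub_le_space ht b a)
          ((hE.norm_sub_le_space (stage_time_nonneg hdt ht) _ _).trans ?_)
        gcongr
        exact hE.norm_limitStage_sub_le hdt ht a b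
    _ = dt * K * (1 + 2 * gam * (dt * K)) * N := by ring
    _ ≤ dt * K * (1 + dt * K) * N := by
        have hγ : 2 * gam * (dt * K) ≤ dt * K :=
          mul_le_of_le_one_left (by positivity) (by linarith [gam_lt_one_third])
        gcongr

theorem FieldBounds.norm_limitStep_sub_le (a b : ℂ) :
    ‖limitStep e dt t a - limitStep e dt t b‖ ≤ Real.exp (2 * K * dt) * ‖a - b‖ := by
  have hK := hE.K_nonneg
  have ha : 0 ≤ 2 * (dt * K) := by positivity
  calc _ ≤ ‖a - b‖ + dt * K * (1 + dt * K) * ‖a - b‖ := norm_le_norm_add_const_of_dist_le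
        (by simpa only [dist_eq_norm] using hE.norm_limitStep_sub_sub_le hdt ht a b)
    _ = (1 + dt * K + (dt * K) ^ 2) * ‖a - b‖ := by ring
    _ ≤ (1 + 2 * (dt * K) + (2 * (dt * K)) ^ 2 / 2) * ‖a - b‖ := by
        gcongr ?_ * _
        nlinarith [sq_nonneg (dt * K)]
    _ ≤ Real.exp (2 * K * dt) * ‖a - b‖ := by
        gcongr
        rw [(by ring : 2 * K * dt = 2 * (dt * K))]
        exact Real.quadratic_le_exp_of_nonneg ha

theorem FieldBounds.norm_limitStep_sub_quadratic_le (z : ℂ) :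
    ‖limitStep e dt t z - z + I * (dt * e (t, z) + dt ^ 2 / 2 * D (t, z) (1, -(I * e (t, z))))‖ ≤
      dt * (2 * B ^ 3 * dt ^ 2) := by
  have hB := hE.one_le
  have hγ := gam_pos
  have hγ' := gam_lt_one_third
  have hstage : ‖limitStage e dt t z - z‖ ≤ 2 * dt * B := by
    rw [limitStage, sub_sub_cancel_left, norm_neg]
    exact (norm_stage_increment_le hdt _).trans (by gcongr; exact hE.norm_le _ ht)
  have htaylor := hE.norm_sub_linear_le (σ := (2 - gam) * dt) (m := 2 * dt * B) ht
    (mul_nonneg (by linarith) hdt) (by nlinarith [mul_nonneg hdt (sub_nonneg.2 hB)]) hstage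
    (δ := limitStage e dt t z - z) (by rw [sub_self, norm_zero])
  have hdir : ((2 - gam) * dt, limitStage e dt t z - z) =
      ((2 - gam) * dt) • ((1 : ℝ), -(I * e (t, z))) := by
    ext
    · simp
    · simp only [limitStage, Prod.smul_snd, Complex.real_smul]
      push_cast
      ring
  rw [hdir, map_smul, Complex.real_smul] at htaylor
  push_cast at htaylor
  calc _ = ‖I * (dt * (gam * (e (t + (2 - gam) * dt, limitStage e dt t z) - e (t, z) -
        (2 - gam) * dt * D (t, z) (1, -(I * e (t, z))))))‖ := by
        rw [← norm_neg, limitStep]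
        congr 1
        linear_combination -I * dt ^ 2 * D (t, z) (1, -(I * e (t, z))) * ofReal_gam_sq
    _ ≤ dt * (B * ((2 * dt * B) ^ 2 + 0) / 3) := by
        rw [norm_mul, norm_mul, Complex.norm_I, one_mul, Complex.norm_of_nonneg hdt]
        gcongr
        exact (norm_gam_mul_le _).trans (by gcongr)
    _ = dt * (4 / 3 * B ^ 3 * dt ^ 2) := by ring
    _ ≤ dt * (2 * B ^ 3 * dt ^ 2) := by
        gcongr
        norm_num

end LimitStep

section CorrectedCenter

variable {B K W lam dt t s : ℝ} {e : ℝ × ℂ → ℂ} {D : ℝ × ℂ → ℝ × ℂ →L[ℝ] ℂ}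

/-- The derivative of a field in the position variable, read off its full derivative `D`. -/
noncomputable def spaceDeriv (D : ℝ × ℂ → ℝ × ℂ →L[ℝ] ℂ) (t : ℝ) (y : ℂ) : ℂ →L[ℝ] ℂ :=
  (D (t, y)).comp (ContinuousLinearMap.inr ℝ ℝ ℂ)

/-- The guiding center shifted by a term of order `1 / λ`, which cancels the leading oscillation of
`y` along the flow and, at the discrete level, along the scheme. -/
noncomputable def correctedCenter (D : ℝ × ℂ → ℝ × ℂ →L[ℝ] ℂ) (lam t : ℝ) (y w : ℂ) : ℂ :=
  y - I * spaceDeriv D t y w / lam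

theorem spaceDeriv_ofReal_mul (D : ℝ × ℂ → ℝ × ℂ →L[ℝ] ℂ) (t r : ℝ) (y z : ℂ) :
    spaceDeriv D t y (r * z) = r * spaceDeriv D t y z := by
  rw [← Complex.real_smul, map_smul, Complex.real_smul]

variable (hE : FieldBounds B K e D) (ht : 0 ≤ t)
include hE ht

theorem FieldBounds.norm_spaceDeriv_le (y : ℂ) {w : ℂ} (hw : ‖w‖ ≤ W) :
    ‖spaceDeriv D t y w‖ ≤ B * W :=
  (hE.norm_deriv_inr_le (t, y) ht w).trans
    (mul_le_mul hE.K_le hw (norm_nonneg w) hE.B_pos.le)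

theorem FieldBounds.norm_field_add_sub_le (y : ℂ) {w : ℂ} (hw : ‖w‖ ≤ W) :
    ‖e (t, y + I * w) - e (t, y)‖ ≤ B * W := by
  refine (hE.norm_sub_le_space ht y (y + I * w)).trans ?_
  rw [add_sub_cancel_left, norm_mul, Complex.norm_I, one_mul]
  exact mul_le_mul hE.K_le hw (norm_nonneg w) hE.B_pos.le

theorem FieldBounds.norm_field_add_sub_spaceDeriv_le (y : ℂ) {w : ℂ} (hw : ‖w‖ ≤ W) :
    ‖e (t, y + I * w) - e (t, y) - spaceDeriv D t y (I * w)‖ ≤ B * W ^ 2 := by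
  have hIw : ‖I * w‖ ≤ W := by rwa [norm_mul, Complex.norm_I, one_mul]
  have h := hE.norm_sub_linear_le ht le_rfl ((norm_nonneg w).trans hw) (x := y) (z := y + I * w)
    (δ := I * w) (η := 0) (by rwa [add_sub_cancel_left]) (by simp)
  rw [add_zero, add_zero] at h
  exact h

theorem FieldBounds.norm_spaceDeriv_sub_le {r : ℝ} (hts : t ≤ s) (hr : s - t ≤ r) {y z w : ℂ}
    (hz : ‖z - y‖ ≤ r) (hw : ‖w‖ ≤ W) :
    ‖spaceDeriv D s z w - spaceDeriv D t y w‖ ≤ B * r * W := by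
  have hB := hE.B_pos
  have hop : ‖D (s, z) - D (t, y)‖ ≤ B * r := by
    refine (hE.norm_deriv_sub_le (t, y) ht (s, z) (ht.trans hts)).trans ?_
    gcongr
    rw [Prod.mk_sub_mk, Prod.norm_def, Real.norm_of_nonneg (sub_nonneg.2 hts)]
    exact max_le hr hz
  exact ContinuousLinearMap.le_of_opNorm_le_of_le (D (s, z) - D (t, y)) (x := (0, w)) hop
    (by simpa [Prod.norm_def] using hw)

theorem FieldBounds.norm_correctedCenter_sub_le (hlam : 0 ≤ lam) (y : ℂ) {w : ℂ} (hw : ‖w‖ ≤ W) :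
    ‖correctedCenter D lam t y w - y‖ ≤ B * W / lam := by
  rw [correctedCenter, sub_sub_cancel_left, norm_neg, norm_div, norm_mul, Complex.norm_I, one_mul,
    Complex.norm_of_nonneg hlam]
  gcongr
  exact hE.norm_spaceDeriv_le ht y hw

theorem FieldBounds.norm_limitStep_sub_correctedCenter_le (hlam : 1 ≤ lam) (hdt : 0 ≤ dt) (y : ℂ)
    {w : ℂ} (hw : ‖w‖ ≤ W) :
    ‖limitStep e dt t y - limitStep e dt t (correctedCenter D lam t y w) -
      (y - correctedCenter D lam t y w)‖ ≤ dt * (B ^ 2 * W / lam + B ^ 3 * dt * W) := by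
  have hB := hE.one_le
  have hK := hE.K_nonneg
  have hlam0 : 0 < lam := by linarith
  have hW : 0 ≤ W := (norm_nonneg w).trans hw
  have hcorr := hE.norm_correctedCenter_sub_le ht hlam0.le y hw
  rw [norm_sub_rev] at hcorr
  calc _ ≤ dt * B * (1 + dt * B) * (B * W / lam) :=
        (hE.norm_limitStep_sub_sub_le hdt ht y _).trans (by gcongr <;> exact hE.K_le)
    _ = dt * (B ^ 2 * W / lam + B ^ 3 * dt * (W / lam)) := by ring
    _ ≤ dt * (B ^ 2 * W / lam + B ^ 3 * dt * W) := by
        gcongr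
        exact div_le_self hW hlam

omit hE ht in
theorem corrected_defect_le (hB : 1 ≤ B) (hlam : 0 < lam) (hdt : 0 ≤ dt) (hW : 0 ≤ W) :
    (B ^ 2 / lam + B * W ^ 2 + 2 * B ^ 2 * dt * W + 5 * B ^ 3 * dt ^ 2) +
        (B ^ 2 * W / lam + B ^ 3 * dt * W) + B ^ 2 * W / lam ≤
      7 * B ^ 3 * ((1 + W) / lam + W ^ 2 + dt ^ 2) := by
  calc _ = B ^ 2 * (1 + 2 * W) / lam + B ^ 1 * W ^ 2 + 2 * B ^ 2 * dt * W +
        B ^ 3 * dt * W + 5 * B ^ 3 * dt ^ 2 := by ring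
    _ ≤ B ^ 3 * (1 + 2 * W) / lam + B ^ 3 * W ^ 2 + 2 * B ^ 3 * dt * W + B ^ 3 * dt * W +
        5 * B ^ 3 * dt ^ 2 := by gcongr <;> norm_num
    _ = B ^ 3 * ((1 + 2 * W) / lam + (W ^ 2 + 3 * dt * W + 5 * dt ^ 2)) := by ring
    _ ≤ B ^ 3 * (7 * (1 + W) / lam + 7 * (W ^ 2 + dt ^ 2)) := by
        gcongr
        · linarith
        · nlinarith [sq_nonneg (dt - W)]
    _ = 7 * B ^ 3 * ((1 + W) / lam + W ^ 2 + dt ^ 2) := by ring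

theorem FieldBounds.norm_correctedCenter_sub_limitStep_le (hlam : 1 ≤ lam) (hdt : 0 ≤ dt)
    {y y' w w' : ℂ} (hy : ‖y' - y‖ ≤ dt * B) (hw : ‖w‖ ≤ W) (hw' : ‖w'‖ ≤ W)
    (hres : ‖y' - limitStep e dt t y - I * spaceDeriv D t y (w' - w) / lam‖ ≤
      dt * (B ^ 2 / lam + B * W ^ 2 + 2 * B ^ 2 * dt * W + 5 * B ^ 3 * dt ^ 2)) :
    ‖correctedCenter D lam (t + dt) y' w' - limitStep e dt t (correctedCenter D lam t y w)‖ ≤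
      dt * (7 * B ^ 3 * ((1 + W) / lam + W ^ 2 + dt ^ 2)) := by
  have hlam0 : 0 < lam := by linarith
  have hderiv : ‖I * (spaceDeriv D (t + dt) y' w' - spaceDeriv D t y w') / lam‖ ≤
      dt * (B ^ 2 * W / lam) := by
    rw [norm_div, norm_mul, Complex.norm_I, one_mul, Complex.norm_of_nonneg hlam0.le]
    calc _ ≤ B * (dt * B) * W / lam := by
          gcongr
          refine hE.norm_spaceDeriv_sub_le ht (le_add_of_nonneg_right hdt) ?_ hy hw'
          rw [add_sub_cancel_left]
          exact le_mul_of_one_le_right hdt hE.one_le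
      _ = dt * (B ^ 2 * W / lam) := by ring
  have hsplit : correctedCenter D lam (t + dt) y' w' -
      limitStep e dt t (correctedCenter D lam t y w) =
      (y' - limitStep e dt t y - I * spaceDeriv D t y (w' - w) / lam) +
        (limitStep e dt t y - limitStep e dt t (correctedCenter D lam t y w) -
          (y - correctedCenter D lam t y w)) -
        I * (spaceDeriv D (t + dt) y' w' - spaceDeriv D t y w') / lam := by
    rw [correctedCenter, correctedCenter, map_sub]
    ring
  rw [hsplit]
  refine (norm_sub_le_of_le (norm_add_le_of_le hres
    (hE.norm_limitStep_sub_correctedCenter_le ht hlam hdt y hw)) hderiv).trans ?_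
  rw [← mul_add, ← mul_add]
  gcongr
  exact corrected_defect_le hE.one_le hlam0 hdt ((norm_nonneg w).trans hw)

end CorrectedCenter

section SchemeDefect

variable {B K W lam dt t : ℝ} {e : ℝ × ℂ → ℂ} {D : ℝ × ℂ → ℝ × ℂ →L[ℝ] ℂ}
  {y w wt yh wh y' w' : ℂ}

/-- Only the stiff term is of order `λ`, so its average over the stages is of order `1 / λ`. -/
theorem ImexStep.velocity_average_eq (hlam : lam ≠ 0)
    (h : ImexStep e lam dt t y w wt yh wh y' w') :
    dt * ((1 - gam) * (I * wt) + gam * (I * w')) =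
      (dt / lam : ℝ) * ((1 - gam) * e (t, y + I * w) +
        gam * e (t + (2 - gam) * dt, yh + I * wh)) - (w' - w) / lam := by
  have hlam' : (lam : ℂ) ≠ 0 := Complex.ofReal_ne_zero.2 hlam
  push_cast
  field_simp
  linear_combination h.w'_eq

variable (hE : FieldBounds B K e D) (hdt : 0 ≤ dt) (ht : 0 ≤ t)
  (h : ImexStep e lam dt t y w wt yh wh y' w')
include hE hdt ht h

theorem ImexStep.norm_yh_sub_limitStage_le (hwt : ‖wt‖ ≤ W) :
    ‖yh - limitStage e dt t y‖ ≤ 2 * dt * (B * W) := by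
  calc _ = ‖I * ((2 - gam) * dt * (e (t, y + I * wt) - e (t, y)))‖ := by
        rw [h.yh_eq, limitStage, ← norm_neg]
        ring_nf
    _ ≤ 2 * dt * (B * W) := (norm_stage_increment_le hdt _).trans (by
        gcongr
        exact hE.norm_field_add_sub_le ht y hwt)

theorem ImexStep.norm_last_field_sub_limit_le (hwt : ‖wt‖ ≤ W) (hw' : ‖w'‖ ≤ W) :
    ‖e (t + (2 - gam) * dt, yh + I * w') - e (t + (2 - gam) * dt, limitStage e dt t y) -
        spaceDeriv D t y (I * w')‖ ≤ B * W ^ 2 + 4 * B ^ 2 * dt * W := by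
  have hB := hE.one_le
  have hγ := gam_pos
  have ht' := stage_time_nonneg hdt ht
  have htt' : t ≤ t + (2 - gam) * dt :=
    le_add_of_nonneg_right (mul_nonneg (by linarith [gam_lt_one_third]) hdt)
  have hIw' : ‖I * w'‖ ≤ W := by rwa [norm_mul, Complex.norm_I, one_mul]
  have hspace : ‖e (t + (2 - gam) * dt, yh) - e (t + (2 - gam) * dt, limitStage e dt t y)‖ ≤
      2 * B ^ 2 * dt * W := by
    calc _ ≤ B * (2 * dt * (B * W)) := (hE.norm_sub_le_space ht' _ _).trans (by
          gcongr
          · exact hE.K_le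
          · exact h.norm_yh_sub_limitStage_le hE hdt ht hwt)
      _ = 2 * B ^ 2 * dt * W := by ring
  have hderiv : ‖spaceDeriv D (t + (2 - gam) * dt) yh (I * w') - spaceDeriv D t y (I * w')‖ ≤
      2 * B ^ 2 * dt * W := by
    refine (hE.norm_spaceDeriv_sub_le ht htt' ?_ (h.norm_yh_sub_y_le hE hdt ht)
      hIw').trans_eq (by ring)
    nlinarith [mul_nonneg hdt (sub_nonneg.2 hB)]
  refine (le_of_eq ?_).trans ((norm_add_le_of_le (norm_add_le_of_le
    (hE.norm_field_add_sub_spaceDeriv_le ht' yh hw') hderiv) hspace).trans_eq (by ring))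
  congr 1
  ring

theorem ImexStep.norm_sub_limitStep_le (hlam : 0 < lam) (hwt : ‖wt‖ ≤ W) (hw' : ‖w'‖ ≤ W) :
    ‖y' - limitStep e dt t y - I * spaceDeriv D t y (w' - w) / lam‖ ≤
      dt * (B ^ 2 / lam + B * W ^ 2 + 2 * B ^ 2 * dt * W) := by
  have hB := hE.B_pos
  have hW : 0 ≤ W := (norm_nonneg wt).trans hwt
  set ĝ := (1 - gam) * e (t, y + I * w) + gam * e (t + (2 - gam) * dt, yh + I * wh) with hĝ
  have hforce : ‖ĝ‖ ≤ B := by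
    refine (norm_gam_combo_le (hE.norm_le _ ht)
      (hE.norm_le (_, yh + I * wh) (stage_time_nonneg hdt ht))).trans_eq (by ring)
  have havg : dt * ((1 - gam) * spaceDeriv D t y (I * wt) + gam * spaceDeriv D t y (I * w')) =
      (dt / lam : ℝ) * spaceDeriv D t y ĝ - spaceDeriv D t y (w' - w) / lam := by
    have hmap := congrArg (spaceDeriv D t y) (h.velocity_average_eq hlam.ne')
    rw [← hĝ, div_eq_inv_mul _ (lam : ℂ), ← Complex.ofReal_one, ← Complex.ofReal_sub,
      ← Complex.ofReal_inv, map_sub] at hmap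
    simp only [spaceDeriv_ofReal_mul, map_add] at hmap
    rw [div_eq_inv_mul _ (lam : ℂ), ← Complex.ofReal_inv, ← hmap]
    push_cast
    rfl
  set L := spaceDeriv D t y
  calc _ = ‖I * (dt * ((1 - gam) * (e (t, y + I * wt) - e (t, y) - L (I * wt)) +
        gam * (e (t + (2 - gam) * dt, yh + I * w') -
          e (t + (2 - gam) * dt, limitStage e dt t y) - L (I * w')))) +
        I * ((dt / lam : ℝ) * L ĝ)‖ := by
        rw [h.y'_eq, limitStep, ← norm_neg]
        congr 1
        linear_combination I * havg
    _ ≤ dt * ((1 - gam) * (B * W ^ 2) + gam * (B * W ^ 2 + 4 * B ^ 2 * dt * W)) +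
        dt / lam * (B * B) := by
        refine norm_add_le_of_le ?_ ?_
        · rw [norm_mul, norm_mul, Complex.norm_I, one_mul, Complex.norm_of_nonneg hdt]
          gcongr
          exact norm_gam_combo_le (hE.norm_field_add_sub_spaceDeriv_le ht y hwt)
            (h.norm_last_field_sub_limit_le hE hdt ht hwt hw')
        · rw [norm_mul, norm_mul, Complex.norm_I, one_mul,
            Complex.norm_of_nonneg (by positivity : 0 ≤ dt / lam)]
          gcongr
          exact hE.norm_spaceDeriv_le ht y hforce
    _ = dt * (B ^ 2 / lam + B * W ^ 2 + 2 * (2 * gam) * (B ^ 2 * dt * W)) := by ring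
    _ ≤ dt * (B ^ 2 / lam + B * W ^ 2 + 2 * 1 * (B ^ 2 * dt * W)) := by
        gcongr
        linarith [gam_lt_one_third]
    _ = dt * (B ^ 2 / lam + B * W ^ 2 + 2 * B ^ 2 * dt * W) := by ring

end SchemeDefect

section FlowDefect

variable {B K W lam dt t s : ℝ} {e : ℝ × ℂ → ℂ} {D : ℝ × ℂ → ℝ × ℂ →L[ℝ] ℂ} {y w : ℝ → ℂ}

/-- Subtracting the correction with frozen coefficients removes the oscillating part
`-i D_x e (i w)` of the velocity of `y`. -/
theorem IsFlow.hasDerivWithinAt_sub_spaceDeriv (h : IsFlow e lam y w) (hlam : lam ≠ 0)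
    (hs : 0 ≤ s) (t : ℝ) (z : ℂ) :
    HasDerivWithinAt (fun τ => y τ - I * spaceDeriv D t z (w τ) / lam)
      (-(I * (e (s, y s + I * w s) - spaceDeriv D t z (I * w s))) -
        I * spaceDeriv D t z (e (s, y s + I * w s)) / lam) (Set.Ici 0) s := by
  have hcorr := (((spaceDeriv D t z).hasFDerivAt.comp_hasDerivWithinAt s
    (h.deriv_w s hs)).const_mul I).div_const (lam : ℂ)
  refine ((h.deriv_y s hs).sub hcorr).congr_deriv ?_
  have hlam' : (lam : ℂ) ≠ 0 := Complex.ofReal_ne_zero.2 hlam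
  rw [map_sub, (by ring : I * lam * w s = lam * (I * w s)), spaceDeriv_ofReal_mul]
  field_simp
  ring

variable (hE : FieldBounds B K e D) (h : IsFlow e lam y w) (ht : 0 ≤ t) (hts : t ≤ s)
  (hsdt : s - t ≤ dt) (hW : ∀ τ ∈ Set.Icc t s, ‖w τ‖ ≤ W)
include hE h ht hts hsdt

theorem IsFlow.norm_y_sub_le_mul : ‖y s - y t‖ ≤ dt * B :=
  (h.norm_y_sub_le hE ht hts).trans (mul_le_mul_of_nonneg_right hsdt hE.B_pos.le)

include hW

theorem IsFlow.norm_y_sub_linear_le :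
    ‖y s - y t - -((s - t : ℝ) * (I * e (t, y t)))‖ ≤ dt * (2 * B ^ 2 * dt + B * W) := by
  have hB := hE.B_pos
  have hW0 : 0 ≤ W := (norm_nonneg _).trans (hW s (Set.right_mem_Icc.2 hts))
  have hdt : 0 ≤ dt := by linarith
  have hlin := norm_sub_linear_le (a := -(I * e (t, y t))) (C := 2 * B ^ 2 * dt + B * W) hts
    (fun τ hτ => (h.deriv_y τ (ht.trans hτ.1)).mono fun _ hσ => ht.trans hσ.1) fun τ hτ => ?_
  · rw [Complex.real_smul, mul_neg] at hlin
    exact hlin.trans (by rw [mul_comm]; gcongr)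
  have hτdt : τ - t ≤ dt := by linarith [hτ.2]
  calc _ = ‖e (τ, y τ + I * w τ) - e (t, y t)‖ := by
        rw [← neg_add', norm_neg, ← sub_eq_add_neg, ← mul_sub, norm_mul, Complex.norm_I, one_mul]
    _ ≤ B * W + (B * dt + K * (dt * B)) := by
        refine (norm_sub_le_norm_sub_add_norm_sub _ (e (τ, y τ)) _).trans (add_le_add
          (hE.norm_field_add_sub_le (ht.trans hτ.1) _ (hW τ hτ))
          ((hE.norm_sub_le ht (ht.trans hτ.1) _ _).trans ?_))
        rw [abs_of_nonneg (sub_nonneg.2 hτ.1)]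
        have hK := hE.K_nonneg
        gcongr
        exact h.norm_y_sub_le_mul hE ht hτ.1 hτdt
    _ ≤ B * W + 2 * B ^ 2 * dt := by gcongr; exact hE.mul_add_mul_le hdt
    _ = 2 * B ^ 2 * dt + B * W := by ring

theorem IsFlow.norm_center_field_sub_linear_le :
    ‖e (s, y s) - e (t, y t) - (s - t : ℝ) * D (t, y t) (1, -(I * e (t, y t)))‖ ≤
      B ^ 2 * dt * W + 3 * B ^ 3 * dt ^ 2 := by
  have hB := hE.one_le
  have hdt : 0 ≤ dt := by linarith
  have htaylor := hE.norm_sub_linear_le ht (sub_nonneg.2 hts)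
    (hsdt.trans (le_mul_of_one_le_right hdt hB)) (h.norm_y_sub_le_mul hE ht hts hsdt)
    (h.norm_y_sub_linear_le hE ht hts hsdt hW)
  have hdir : (s - t, -((s - t : ℝ) * (I * e (t, y t)))) =
      (s - t) • ((1 : ℝ), -(I * e (t, y t))) := by simp
  rw [add_sub_cancel, hdir, map_smul, Complex.real_smul] at htaylor
  exact htaylor.trans_eq (by ring)

theorem IsFlow.norm_corrected_velocity_sub_linear_le (hlam : 0 < lam) :
    ‖-(I * (e (s, y s + I * w s) - spaceDeriv D t (y t) (I * w s))) -
        I * spaceDeriv D t (y t) (e (s, y s + I * w s)) / lam - -(I * e (t, y t)) -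
        (s - t) • -(I * D (t, y t) (1, -(I * e (t, y t))))‖ ≤
      B ^ 2 / lam + B * W ^ 2 + 2 * B ^ 2 * dt * W + 3 * B ^ 3 * dt ^ 2 := by
  have hB := hE.one_le
  have hs : 0 ≤ s := ht.trans hts
  have hws := hW s (Set.right_mem_Icc.2 hts)
  have hIws : ‖I * w s‖ ≤ W := by rwa [norm_mul, Complex.norm_I, one_mul]
  have hdt : 0 ≤ dt := by linarith
  have hosc := hE.norm_field_add_sub_spaceDeriv_le hs (y s) hws
  have hderiv := hE.norm_spaceDeriv_sub_le ht hts (hsdt.trans (le_mul_of_one_le_right hdt hB))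
    (h.norm_y_sub_le_mul hE ht hts hsdt) hIws
  have hslow := h.norm_center_field_sub_linear_le hE ht hts hsdt hW
  have hforce : ‖spaceDeriv D t (y t) (e (s, y s + I * w s)) / lam‖ ≤ B * B / lam := by
    rw [norm_div, Complex.norm_of_nonneg hlam.le]
    gcongr
    exact hE.norm_spaceDeriv_le ht (y t) (hE.norm_le _ hs)
  have hsum := norm_add_le_of_le (norm_add_le_of_le (norm_add_le_of_le hosc hderiv) hslow) hforce
  have hrotate (z : ℂ) : ‖z‖ = ‖-(I * z)‖ := by rw [norm_neg, norm_mul, Complex.norm_I, one_mul]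
  rw [hrotate] at hsum
  refine (le_of_eq ?_).trans (hsum.trans_eq (by ring))
  rw [Complex.real_smul]
  congr 1
  ring

omit hts hsdt hW in
theorem IsFlow.norm_sub_limitStep_le (hlam : 0 < lam) (hdt : 0 ≤ dt)
    (hW : ∀ τ ∈ Set.Icc t (t + dt), ‖w τ‖ ≤ W) :
    ‖y (t + dt) - limitStep e dt t (y t) - I * spaceDeriv D t (y t) (w (t + dt) - w t) / lam‖ ≤
      dt * (B ^ 2 / lam + B * W ^ 2 + 2 * B ^ 2 * dt * W + 5 * B ^ 3 * dt ^ 2) := by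
  have hflow := norm_sub_quadratic_le (le_add_of_nonneg_right hdt)
    (fun s hs => (h.hasDerivWithinAt_sub_spaceDeriv (D := D) hlam.ne' (ht.trans hs.1) t (y t)).mono
      fun _ hσ => ht.trans hσ.1)
    (fun s hs => h.norm_corrected_velocity_sub_linear_le (dt := dt) hE ht hs.1
      (by linarith [hs.2]) (fun τ hτ => hW τ ⟨hτ.1, hτ.2.trans hs.2⟩) hlam)
  have hlimit := hE.norm_limitStep_sub_quadratic_le hdt ht (y t)
  rw [add_sub_cancel_left, Complex.real_smul, Complex.real_smul] at hflow
  push_cast at hflow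
  refine (le_of_eq ?_).trans ((norm_sub_le_of_le hflow hlimit).trans_eq ?_)
  · rw [map_sub]
    congr 1
    ring
  · ring

end FlowDefect

section UniformError

variable {B K W lam dt t : ℝ} {e : ℝ × ℂ → ℂ} {D : ℝ × ℂ → ℝ × ℂ →L[ℝ] ℂ} {y w : ℝ → ℂ}

theorem IsFlow.norm_correctedCenter_step_le (hE : FieldBounds B K e D) (hlam : 1 ≤ lam)
    (hdt : 0 ≤ dt) (ht : 0 ≤ t) (hflow : IsFlow e lam y w) {y₀ w₀ wt yh wh y₁ w₁ : ℂ}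
    (h : ImexStep e lam dt t y₀ w₀ wt yh wh y₁ w₁)
    (hW : ∀ τ ∈ Set.Icc t (t + dt), ‖w τ‖ ≤ W) (hw₀ : ‖w₀‖ ≤ W) (hwt : ‖wt‖ ≤ W)
    (hw₁ : ‖w₁‖ ≤ W) :
    ‖correctedCenter D lam (t + dt) y₁ w₁ -
        correctedCenter D lam (t + dt) (y (t + dt)) (w (t + dt))‖ ≤
      Real.exp (2 * K * dt) *
        (‖correctedCenter D lam t y₀ w₀ - correctedCenter D lam t (y t) (w t)‖ +
          2 * (dt * (7 * B ^ 3 * ((1 + W) / lam + W ^ 2 + dt ^ 2)))) := by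
  have hB := hE.B_pos
  have hK := hE.K_nonneg
  have hlam0 : 0 < lam := by linarith
  have hW0 : 0 ≤ W := (norm_nonneg _).trans hw₀
  have htdt : t ≤ t + dt := le_add_of_nonneg_right hdt
  have hscheme := hE.norm_correctedCenter_sub_limitStep_le ht hlam hdt
    (h.norm_y'_sub_y_le hE hdt ht) hw₀ hw₁
    ((h.norm_sub_limitStep_le hE hdt ht hlam0 hwt hw₁).trans
      (mul_le_mul_of_nonneg_left (le_add_of_nonneg_right (by positivity)) hdt))
  have hexact := hE.norm_correctedCenter_sub_limitStep_le ht hlam hdt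
    (hflow.norm_y_sub_le_mul hE ht htdt (add_sub_cancel_left _ _).le)
    (hW _ ⟨le_rfl, htdt⟩) (hW _ ⟨htdt, le_rfl⟩) (hflow.norm_sub_limitStep_le hE ht hlam0 hdt hW)
  have hlip := hE.norm_limitStep_sub_le hdt ht (correctedCenter D lam t y₀ w₀)
    (correctedCenter D lam t (y t) (w t))
  set r := dt * (7 * B ^ 3 * ((1 + W) / lam + W ^ 2 + dt ^ 2))
  have hexp := le_mul_of_one_le_left (by positivity : 0 ≤ 2 * r)
    (Real.one_le_exp (by positivity : 0 ≤ 2 * K * dt))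
  rw [norm_sub_rev] at hexact
  rw [mul_add]
  refine ((norm_sub_le_norm_sub_add_norm_sub _ _ _).trans (add_le_add hscheme
    ((norm_sub_le_norm_sub_add_norm_sub _ _ _).trans (add_le_add hlip hexact)))).trans ?_
  linarith

variable {ys ws wts yhs whs : ℕ → ℂ} {N : ℕ} (hE : FieldBounds B K e D) (hlam : 1 ≤ lam)
  (hdt : 0 ≤ dt) (hflow : IsFlow e lam y w)
  (h : ∀ n : ℕ, ImexStep e lam dt (n * dt) (ys n) (ws n) (wts n) (yhs n) (whs n)
    (ys (n + 1)) (ws (n + 1)))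
  (hy0 : ys 0 = y 0) (hw0 : ws 0 = w 0) (hW : ∀ τ ∈ Set.Icc 0 (N * dt), ‖w τ‖ ≤ W)
  (hws : ∀ n ≤ N, ‖ws n‖ ≤ W) (hwts : ∀ n < N, ‖wts n‖ ≤ W)
include hE hlam hdt hflow h hy0 hw0 hW hws hwts

theorem IsFlow.norm_correctedCenter_sub_le :
    ‖correctedCenter D lam (N * dt) (ys N) (ws N) -
        correctedCenter D lam (N * dt) (y (N * dt)) (w (N * dt))‖ ≤
      Real.exp (2 * K * (N * dt)) * (N * dt) *
        (14 * B ^ 3 * ((1 + W) / lam + W ^ 2 + dt ^ 2)) := by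
  have hB := hE.B_pos
  have hK := hE.K_nonneg
  have hW0 : 0 ≤ W := (norm_nonneg _).trans (hws N le_rfl)
  set gap : ℕ → ℝ := fun n => ‖correctedCenter D lam (n * dt) (ys n) (ws n) -
    correctedCenter D lam (n * dt) (y (n * dt)) (w (n * dt))‖ with hgap
  have hstep : ∀ n < N, gap (n + 1) ≤ Real.exp (2 * K * dt) *
      (gap n + 2 * (dt * (7 * B ^ 3 * ((1 + W) / lam + W ^ 2 + dt ^ 2)))) := by
    intro n hn
    have ht : 0 ≤ n * dt := by positivity
    have hsucc : ((n + 1 : ℕ) : ℝ) * dt = n * dt + dt := by push_cast; ring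
    have hend : n * dt + dt ≤ N * dt := hsucc.symm.trans_le (by gcongr; exact hn)
    simp only [hgap, hsucc]
    exact hflow.norm_correctedCenter_step_le hE hlam hdt ht (h n)
      (fun τ hτ => hW τ ⟨ht.trans hτ.1, hτ.2.trans hend⟩) (hws n hn.le) (hwts n hn) (hws (n + 1) hn)
  refine (le_exp_mul_of_succ_le (by positivity) (by positivity) hstep le_rfl).trans_eq ?_
  simp only [hgap, Nat.cast_zero, zero_mul, hy0, hw0, sub_self, norm_zero, zero_add]
  ring_nf

theorem IsFlow.uniform_error :
    ‖ys N - y (N * dt)‖ ≤ Real.exp (2 * K * (N * dt)) * (N * dt) *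
      (14 * B ^ 3 * ((1 + W) / lam + W ^ 2 + dt ^ 2)) + 2 * (B * W / lam) := by
  have hlam0 : 0 ≤ lam := by linarith
  have ht : 0 ≤ N * dt := by positivity
  have hmain := hflow.norm_correctedCenter_sub_le hE hlam hdt h hy0 hw0 hW hws hwts
  have hscheme := hE.norm_correctedCenter_sub_le ht hlam0 (ys N) (hws N le_rfl)
  have hexact := hE.norm_correctedCenter_sub_le ht hlam0 (y (N * dt))
    (hW _ (Set.right_mem_Icc.2 ht))
  rw [norm_sub_rev] at hscheme
  linarith [norm_sub_le_norm_sub_add_norm_sub (ys N)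
      (correctedCenter D lam (N * dt) (ys N) (ws N)) (y (N * dt)),
    norm_sub_le_norm_sub_add_norm_sub (correctedCenter D lam (N * dt) (ys N) (ws N))
      (correctedCenter D lam (N * dt) (y (N * dt)) (w (N * dt))) (y (N * dt))]

end UniformError

section ErrorScales

variable {B K Z S V ε t dt : ℝ}

/-- The factor common to all error bounds; here `V` stands for the norm of the initial velocity. -/
noncomputable def errorGrowth (K ε V t : ℝ) : ℝ :=
  Real.exp (69 * K * t) * (1 + t) ^ 3 * (1 + ε ^ 2 + V ^ 2)

theorem wBound_le (hB : 1 ≤ B) (hε : 0 < ε) (hV : 0 ≤ V) (ht : 0 ≤ t) :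
    wBound B K (1 / ε ^ 2) (ε * V) t ≤
      8 * B ^ 2 * (Real.exp (17 * K * t) * (1 + t)) * (ε * (V + ε)) := by
  have hone : 1 ≤ 8 * B ^ 2 * (1 + t) := by nlinarith
  calc _ = Real.exp (17 * K * t) * (ε * V + 8 * B ^ 2 * (1 + t) * ε ^ 2) := by
        rw [wBound, div_div_eq_mul_div, div_one]
    _ ≤ Real.exp (17 * K * t) *
        (8 * B ^ 2 * (1 + t) * (ε * V) + 8 * B ^ 2 * (1 + t) * ε ^ 2) := by
        refine mul_le_mul_of_nonneg_left (add_le_add_left ?_ _) (Real.exp_nonneg _)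
        exact le_mul_of_one_le_left (by positivity) hone
    _ = 8 * B ^ 2 * (Real.exp (17 * K * t) * (1 + t)) * (ε * (V + ε)) := by ring

theorem stiff_scale_le (hε : 0 < ε) :
    (V + ε) / ε * ((V + ε) / ε + (1 / ε ^ 2) ^ 2) ≤
      2 * ((1 + ε ^ 2 + V ^ 2) * (1 / ε ^ 5 * (1 + ε ^ 3))) := by
  calc _ = 1 / ε ^ 5 * ((V + ε) ^ 2 * ε ^ 3 + (V + ε)) := by field_simp
    _ ≤ 1 / ε ^ 5 * (2 * (1 + ε ^ 2 + V ^ 2) * ε ^ 3 + 2 * (1 + ε ^ 2 + V ^ 2)) := by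
        gcongr
        · nlinarith [sq_nonneg (V - ε)]
        · nlinarith [sq_nonneg (V - 1), sq_nonneg (ε - 1)]
    _ = 2 * ((1 + ε ^ 2 + V ^ 2) * (1 / ε ^ 5 * (1 + ε ^ 3))) := by ring

theorem classical_constant_le (hB : 1 ≤ B) (hZ : 1 ≤ Z) (hε : 0 < ε) (hV : 0 ≤ V) (hS₀ : 0 ≤ S)
    (hS : S ≤ 8 * B ^ 2 * Z * (ε * (V + ε))) :
    B * (B + 1 / ε ^ 2 * S) * (B + 1 / ε ^ 2 * S + (1 / ε ^ 2) ^ 2) ≤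
      162 * B ^ 7 * Z ^ 2 * ((1 + ε ^ 2 + V ^ 2) * (1 / ε ^ 5 * (1 + ε ^ 3))) := by
  have hU : 1 ≤ (V + ε) / ε := by rw [le_div_iff₀ hε]; linarith
  have hstiff := stiff_scale_le (V := V) hε
  have hlamS : 1 / ε ^ 2 * S ≤ 8 * B ^ 2 * Z * ((V + ε) / ε) := by
    calc _ ≤ 1 / ε ^ 2 * (8 * B ^ 2 * Z * (ε * (V + ε))) := by gcongr
      _ = 8 * B ^ 2 * Z * ((V + ε) / ε) := by field_simp
  set U := (V + ε) / ε
  set l := 1 / ε ^ 2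
  have hP : B + l * S ≤ 9 * B ^ 3 * Z * U := by
    have hZU : 1 ≤ Z * U := one_le_mul_of_one_le_of_one_le hZ hU
    calc B + l * S ≤ B ^ 3 * (Z * U) + 8 * B ^ 3 * Z * U := by
          refine add_le_add ?_ (hlamS.trans (by gcongr; norm_num))
          exact (le_self_pow₀ hB three_ne_zero).trans (le_mul_of_one_le_right (by positivity) hZU)
      _ = 9 * B ^ 3 * Z * U := by ring
  calc _ ≤ B * (9 * B ^ 3 * Z * U) * (9 * B ^ 3 * Z * U + 9 * B ^ 3 * Z * l ^ 2) := by
        have hone : 1 ≤ 9 * B ^ 3 * Z := one_le_mul_of_one_le_of_one_le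
          (one_le_mul_of_one_le_of_one_le (by norm_num) (one_le_pow₀ hB)) hZ
        gcongr
        exact le_mul_of_one_le_left (by positivity) hone
    _ = 81 * B ^ 7 * Z ^ 2 * (U * (U + l ^ 2)) := by ring
    _ ≤ 81 * B ^ 7 * Z ^ 2 * (2 * ((1 + ε ^ 2 + V ^ 2) * (1 / ε ^ 5 * (1 + ε ^ 3)))) := by gcongr
    _ = 162 * B ^ 7 * Z ^ 2 * ((1 + ε ^ 2 + V ^ 2) * (1 / ε ^ 5 * (1 + ε ^ 3))) := by ring

theorem add_le_one_add_sq_add_sq (ε V : ℝ) : V + ε ≤ 1 + ε ^ 2 + V ^ 2 := by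
  nlinarith [sq_nonneg (V - 1 / 2), sq_nonneg (ε - 1 / 2)]

theorem uniform_defect_le (hB : 1 ≤ B) (hZ : 1 ≤ Z) (hε : 0 < ε) (hε₁ : ε ≤ 1) (hV : 0 ≤ V)
    (hS₀ : 0 ≤ S) (hS : S ≤ 8 * B ^ 2 * Z * (ε * (V + ε))) :
    (1 + S) / (1 / ε ^ 2) + S ^ 2 + dt ^ 2 ≤
      137 * B ^ 4 * Z ^ 2 * (1 + ε ^ 2 + V ^ 2) * (ε ^ 2 + dt ^ 2) := by
  have hsum := add_le_one_add_sq_add_sq ε V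
  have hsum_sq : (V + ε) ^ 2 ≤ 2 * (1 + ε ^ 2 + V ^ 2) := by nlinarith [sq_nonneg (V - ε)]
  have hm : 1 ≤ 1 + ε ^ 2 + V ^ 2 := by nlinarith
  set m := 1 + ε ^ 2 + V ^ 2
  have hone : 1 ≤ B ^ 4 * Z ^ 2 * m := one_le_mul_of_one_le_of_one_le
    (one_le_mul_of_one_le_of_one_le (one_le_pow₀ hB) (one_le_pow₀ hZ)) hm
  have hS_le : S ≤ 8 * B ^ 4 * Z ^ 2 * m := by
    calc S ≤ 8 * B ^ 2 * Z * (1 * m) := hS.trans (by gcongr)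
      _ = 8 * B ^ 2 * Z * m := by ring
      _ ≤ 8 * B ^ 4 * Z ^ 2 * m := by
          gcongr
          · norm_num
          · exact le_self_pow₀ hZ two_ne_zero
  have hS_sq : S ^ 2 ≤ 128 * B ^ 4 * Z ^ 2 * m * ε ^ 2 := by
    calc S ^ 2 ≤ (8 * B ^ 2 * Z * (ε * (V + ε))) ^ 2 := by gcongr
      _ = 64 * B ^ 4 * Z ^ 2 * ε ^ 2 * (V + ε) ^ 2 := by ring
      _ ≤ 64 * B ^ 4 * Z ^ 2 * ε ^ 2 * (2 * m) := by gcongr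
      _ = 128 * B ^ 4 * Z ^ 2 * m * ε ^ 2 := by ring
  calc _ = (1 + S) * ε ^ 2 + S ^ 2 + 1 * dt ^ 2 := by rw [div_div_eq_mul_div, div_one, one_mul]
    _ ≤ (B ^ 4 * Z ^ 2 * m + 8 * B ^ 4 * Z ^ 2 * m) * ε ^ 2 + 128 * B ^ 4 * Z ^ 2 * m * ε ^ 2 +
        137 * (B ^ 4 * Z ^ 2 * m) * dt ^ 2 := by
        gcongr
        linarith
    _ = 137 * B ^ 4 * Z ^ 2 * m * (ε ^ 2 + dt ^ 2) := by ring

theorem le_errorGrowth (hK : 0 ≤ K) (ht : 0 ≤ t) : t ≤ errorGrowth K ε V t := by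
  have hexp : 1 ≤ Real.exp (69 * K * t) := Real.one_le_exp (by positivity)
  have hm : 1 ≤ 1 + ε ^ 2 + V ^ 2 := by nlinarith [sq_nonneg ε, sq_nonneg V]
  have ht' : t ≤ (1 + t) ^ 3 := (le_add_of_nonneg_left zero_le_one).trans
    (le_self_pow₀ (le_add_of_nonneg_right ht) three_ne_zero)
  rw [errorGrowth, mul_right_comm]
  exact ht'.trans (le_mul_of_one_le_left (by positivity) (one_le_mul_of_one_le_of_one_le hexp hm))

theorem exp_mul_le_errorGrowth {k : ℝ} {j : ℕ} (hk : k ≤ 69) (hj : j ≤ 3) (hK : 0 ≤ K)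
    (ht : 0 ≤ t) :
    Real.exp (k * K * t) * (1 + t) ^ j * (1 + ε ^ 2 + V ^ 2) ≤ errorGrowth K ε V t := by
  rw [errorGrowth]
  gcongr
  linarith

theorem uniform_constant_le (hB : 1 ≤ B) (hK : 0 ≤ K) (ht : 0 ≤ t) (hε : 0 < ε) (hε₁ : ε ≤ 1)
    (hV : 0 ≤ V) (hS₀ : 0 ≤ S)
    (hS : S ≤ 8 * B ^ 2 * (Real.exp (17 * K * t) * (1 + t)) * (ε * (V + ε))) :
    Real.exp (2 * K * t) * t * (14 * B ^ 3 * ((1 + S) / (1 / ε ^ 2) + S ^ 2 + dt ^ 2)) +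
        2 * (B * S / (1 / ε ^ 2)) ≤
      1918 * B ^ 7 * (errorGrowth K ε V t * (ε ^ 2 + dt ^ 2)) := by
  have hZ : 1 ≤ Real.exp (17 * K * t) * (1 + t) := one_le_mul_of_one_le_of_one_le
    (Real.one_le_exp (by positivity)) (le_add_of_nonneg_right ht)
  have hdefect := uniform_defect_le (dt := dt) hB hZ hε hε₁ hV hS₀ hS
  set X := (1 + S) / (1 / ε ^ 2) + S ^ 2 + dt ^ 2 with hX
  have hcorr : B * (S / (1 / ε ^ 2)) ≤ B ^ 3 * X := by
    gcongr
    · exact le_self_pow₀ hB three_ne_zero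
    · rw [hX, add_div, add_assoc]
      linarith [(by positivity : 0 ≤ 1 / (1 / ε ^ 2) + (S ^ 2 + dt ^ 2))]
  have hexp : Real.exp (36 * K * t) = Real.exp (2 * K * t) * Real.exp (17 * K * t) ^ 2 := by
    rw [← Real.exp_nat_mul, ← Real.exp_add]
    ring_nf
  calc _ ≤ Real.exp (2 * K * t) * t * (14 * B ^ 3 * X) +
        Real.exp (2 * K * t) * (14 * B ^ 3 * X) := by
        have hX₀ : 0 ≤ B ^ 3 * X := by positivity
        rw [mul_div_assoc]
        refine add_le_add_right (le_trans ?_ (le_mul_of_one_le_left (by positivity)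
          (Real.one_le_exp (by positivity)))) _
        linarith
    _ = Real.exp (2 * K * t) * (1 + t) * (14 * B ^ 3 * X) := by ring
    _ ≤ Real.exp (2 * K * t) * (1 + t) * (14 * B ^ 3 * (137 * B ^ 4 *
        (Real.exp (17 * K * t) * (1 + t)) ^ 2 * (1 + ε ^ 2 + V ^ 2) * (ε ^ 2 + dt ^ 2))) := by
        gcongr
    _ = 1918 * B ^ 7 * (Real.exp (36 * K * t) * (1 + t) ^ 3 * (1 + ε ^ 2 + V ^ 2) *
        (ε ^ 2 + dt ^ 2)) := by
        rw [hexp]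
        ring
    _ ≤ 1918 * B ^ 7 * (errorGrowth K ε V t * (ε ^ 2 + dt ^ 2)) := by
        gcongr
        exact exp_mul_le_errorGrowth (by norm_num) le_rfl hK ht

end ErrorScales

section ScaledErrors

variable {B K ε V dt : ℝ} {e : ℝ × ℂ → ℂ} {D : ℝ × ℂ → ℝ × ℂ →L[ℝ] ℂ} {y w : ℝ → ℂ}
  {ys ws wts yhs whs : ℕ → ℂ} (hE : FieldBounds B K e D) (hε : 0 < ε) (hdt : 0 ≤ dt)
  (hflow : IsFlow e (1 / ε ^ 2) y w)
  (h : ∀ n : ℕ, ImexStep e (1 / ε ^ 2) dt (n * dt) (ys n) (ws n) (wts n) (yhs n) (whs n)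
    (ys (n + 1)) (ws (n + 1)))
  (hy0 : ys 0 = y 0) (hw0 : ws 0 = w 0) (hV : ‖w 0‖ = ε * V) (N : ℕ)

include hE hε hflow hV in
theorem IsFlow.norm_le_wBound_of_le {s t : ℝ} (hs : 0 ≤ s) (hst : s ≤ t) :
    ‖w s‖ ≤ wBound B K (1 / ε ^ 2) (ε * V) t :=
  hV ▸ (hflow.norm_le_wBound hE (by positivity) hs).trans
    (wBound_mono hE.K_nonneg (by positivity) (norm_nonneg _) hs hst)

include hE hdt hflow h hy0 in
theorem IsFlow.norm_seq_sub_le : ‖ys N - y (N * dt)‖ ≤ 2 * B * (N * dt) := by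
  have hscheme : ‖ys N - ys 0‖ ≤ N * (dt * B) := by
    have hsum := dist_le_range_sum_of_dist_le (f := ys) (d := fun _ => dt * B) N fun {n} _ => by
      rw [dist_comm, dist_eq_norm]
      exact (h n).norm_y'_sub_y_le hE hdt (by positivity)
    rwa [dist_comm, dist_eq_norm, Finset.sum_const, Finset.card_range, nsmul_eq_mul] at hsum
  have hexact := hflow.norm_y_sub_le hE le_rfl (by positivity : 0 ≤ N * dt)
  rw [norm_sub_rev, sub_zero, ← hy0] at hexact
  linarith [norm_sub_le_norm_sub_add_norm_sub (ys N) (ys 0) (y (N * dt))]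

include hE hε hdt hflow h hy0 hw0 hV

theorem IsFlow.classical_error_le (hV₀ : 0 ≤ V) :
    ‖ys N - y (N * dt)‖ + ‖ws N - w (N * dt)‖ ≤
      3888 * B ^ 7 * (errorGrowth K ε V (N * dt) * (dt ^ 2 / ε ^ 5 * (1 + ε ^ 3))) := by
  have hK := hE.K_nonneg
  have hB := hE.B_pos
  have ht : 0 ≤ N * dt := by positivity
  have hS₀ := (norm_nonneg _).trans (hflow.norm_le_wBound_of_le hE hε hV ht le_rfl)
  have herror := hflow.classical_error
    (P := B + 1 / ε ^ 2 * wBound B K (1 / ε ^ 2) (ε * V) (N * dt)) hE (by positivity)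
    hdt h hy0 hw0 N fun τ hτ => by
      gcongr
      exact hflow.norm_le_wBound_of_le hE hε hV hτ.1 hτ.2
  set t := N * dt
  set Z := Real.exp (17 * K * t) * (1 + t) with hZ
  have hZ₁ : 1 ≤ Z := one_le_mul_of_one_le_of_one_le (Real.one_le_exp (by positivity))
    (le_add_of_nonneg_right ht)
  have hexp : Real.exp (69 * K * t) = Real.exp (35 * K * t) * Real.exp (17 * K * t) ^ 2 := by
    rw [← Real.exp_nat_mul, ← Real.exp_add]
    ring_nf
  have hconst := classical_constant_le hE.one_le hZ₁ hε hV₀ hS₀ (wBound_le hE.one_le hε hV₀ ht)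
  calc _ ≤ Real.exp (35 * K * t) * t * (24 * (162 * B ^ 7 * Z ^ 2 *
        ((1 + ε ^ 2 + V ^ 2) * (1 / ε ^ 5 * (1 + ε ^ 3)))) * dt ^ 2) :=
        herror.trans (mul_le_mul_of_nonneg_left (mul_le_mul_of_nonneg_right
          (mul_le_mul_of_nonneg_left hconst (by norm_num)) (sq_nonneg dt)) (by positivity))
    _ ≤ Real.exp (35 * K * t) * (1 + t) * (24 * (162 * B ^ 7 * Z ^ 2 *
        ((1 + ε ^ 2 + V ^ 2) * (1 / ε ^ 5 * (1 + ε ^ 3)))) * dt ^ 2) := by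
        gcongr
        linarith
    _ = 3888 * B ^ 7 * (errorGrowth K ε V t * (dt ^ 2 / ε ^ 5 * (1 + ε ^ 3))) := by
        rw [errorGrowth, hexp, hZ]
        ring

theorem IsFlow.uniform_error_le_of_le_one (hV₀ : 0 ≤ V) (hε₁ : ε ≤ 1) :
    ‖ys N - y (N * dt)‖ ≤ 1918 * B ^ 7 * (errorGrowth K ε V (N * dt) * (ε ^ 2 + dt ^ 2)) := by
  have hK := hE.K_nonneg
  have ht : 0 ≤ N * dt := by positivity
  have hlam : 1 ≤ 1 / ε ^ 2 := by
    rw [one_le_div (by positivity)]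
    exact pow_le_one₀ hε.le hε₁
  have hlam₀ : 0 < 1 / ε ^ 2 := by positivity
  have hle {s : ℝ} (hs : 0 ≤ s) (hst : s ≤ N * dt) :
      wBound B K (1 / ε ^ 2) ‖ws 0‖ s ≤ wBound B K (1 / ε ^ 2) (ε * V) (N * dt) := by
    rw [hw0, hV]
    exact wBound_mono hK hlam₀.le (by positivity) hs hst
  have herror := hflow.uniform_error hE hlam hdt h hy0 hw0
    (fun τ hτ => hflow.norm_le_wBound_of_le hE hε hV hτ.1 hτ.2)
    (fun n hn => (norm_seq_le_wBound hE hlam₀ hdt h n).trans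
      (hle (by positivity) (by gcongr)))
    (fun n hn => (norm_stage_seq_le_wBound hE hlam₀ hdt h n).trans
      (hle (by positivity) (by gcongr; exact hn)))
  exact herror.trans (uniform_constant_le hE.one_le hK ht hε hε₁ hV₀ ((norm_nonneg _).trans
    (hflow.norm_le_wBound_of_le hE hε hV ht le_rfl)) (wBound_le hE.one_le hε hV₀ ht))

theorem IsFlow.uniform_error_le (hV₀ : 0 ≤ V) :
    ‖ys N - y (N * dt)‖ ≤
      1918 * B ^ 7 * (errorGrowth K ε V (N * dt) * (min 1 (ε ^ 2) + dt ^ 2)) := by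
  have hB := hE.one_le
  have ht : 0 ≤ N * dt := by positivity
  have hgrowth := le_errorGrowth (ε := ε) (V := V) hE.K_nonneg ht
  rcases le_total ε 1 with hε₁ | hε₁
  · rw [min_eq_right (pow_le_one₀ hε.le hε₁)]
    exact hflow.uniform_error_le_of_le_one hE hε hdt h hy0 hw0 hV N hV₀ hε₁
  · rw [min_eq_left (one_le_pow₀ hε₁)]
    calc _ ≤ 2 * B * (N * dt) := hflow.norm_seq_sub_le hE hdt h hy0 N
      _ ≤ 1918 * B ^ 7 * (errorGrowth K ε V (N * dt) * 1) := by
          rw [mul_one]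
          gcongr
          · norm_num
          · exact le_self_pow₀ hB (by norm_num)
      _ ≤ 1918 * B ^ 7 * (errorGrowth K ε V (N * dt) * (1 + dt ^ 2)) := by
          have hgrowth₀ := ht.trans hgrowth
          gcongr
          exact le_add_of_nonneg_right (sq_nonneg dt)

omit hy0 in
theorem IsFlow.norm_velocity_sub_le (hV₀ : 0 ≤ V) :
    ‖ws N - w (N * dt)‖ ≤ 16 * B ^ 7 * (errorGrowth K ε V (N * dt) * ε) := by
  have hB := hE.one_le
  have hK := hE.K_nonneg
  have ht : 0 ≤ N * dt := by positivity
  have hws := norm_seq_le_wBound hE (by positivity) hdt h N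
  rw [hw0, hV] at hws
  have hwt := hflow.norm_le_wBound_of_le hE hε hV ht le_rfl
  have hS := wBound_le (K := K) hE.one_le hε hV₀ ht
  set t := N * dt
  calc _ ≤ 2 * (8 * B ^ 2 * (Real.exp (17 * K * t) * (1 + t)) * (ε * (V + ε))) := by
        linarith [norm_sub_le (ws N) (w t)]
    _ ≤ 2 * (8 * B ^ 7 * (Real.exp (17 * K * t) * (1 + t)) * (ε * (1 + ε ^ 2 + V ^ 2))) := by
        have hsum := add_le_one_add_sq_add_sq ε V
        gcongr
        norm_num
    _ = 16 * B ^ 7 * (Real.exp (17 * K * t) * (1 + t) ^ 1 * (1 + ε ^ 2 + V ^ 2) * ε) := by ring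
    _ ≤ 16 * B ^ 7 * (errorGrowth K ε V t * ε) := by
        gcongr
        exact exp_mul_le_errorGrowth (by norm_num) (by norm_num) hK ht

end ScaledErrors

section SchemeErrors

variable {B ε dt : ℝ} {E : ℝ × Plane → Plane} {D : ℝ × ℂ → ℝ × ℂ →L[ℝ] ℂ}
  {x₀ v₀ : Plane} {x v : ℝ → Plane} {T : Trajectory}

theorem norm_guidingCenter_sub (ε : ℝ) (T : Trajectory) (n : ℕ) (x v : Plane) :
    ‖T.y n - guidingCenter ε x v‖ = ‖toComplex (T.y n) - toComplex (guidingCenter ε x v)‖ := by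
  rw [← map_sub, LinearIsometryEquiv.norm_map]

theorem norm_position_sub_le_add (ε : ℝ) (T : Trajectory) (n : ℕ) (x v : Plane) :
    ‖T.x ε n - x‖ ≤ ‖toComplex (T.y n) - toComplex (guidingCenter ε x v)‖ +
      ‖ε * toComplex (T.v n) - ε * toComplex v‖ := by
  rw [← toComplex.norm_map, Trajectory.x, map_sub, map_add, map_smul, toComplex_perp,
    toComplex_guidingCenter, Complex.real_smul]
  calc _ = ‖toComplex (T.y n) - (toComplex x - I * (ε * toComplex v)) +
        I * (ε * toComplex (T.v n) - ε * toComplex v)‖ := by ring_nf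
    _ ≤ _ := by
        refine (norm_add_le _ _).trans_eq ?_
        rw [norm_mul, Complex.norm_I, one_mul]

theorem norm_mul_toComplex (hε : 0 ≤ ε) (v : Plane) : ‖(ε : ℂ) * toComplex v‖ = ε * ‖v‖ := by
  rw [norm_mul, Complex.norm_of_nonneg hε, LinearIsometryEquiv.norm_map]

variable (hE : FieldBounds B (Kx E) (complexField E) D) (hε : 0 < ε) (hdt : 0 < dt)
  (hchar : IsCharacteristic E ε x₀ v₀ x v) (hT : SolvesScheme E ε dt x₀ v₀ T) (n : ℕ)
include hE hε hdt hchar hT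

theorem SolvesScheme.classical_error :
    ‖toComplex (T.y n) - toComplex (guidingCenter ε (x (n * dt)) (v (n * dt)))‖ +
        ‖ε * toComplex (T.v n) - ε * toComplex (v (n * dt))‖ ≤
      3888 * B ^ 7 * (errorGrowth (Kx E) ε ‖v₀‖ (n * dt) * (dt ^ 2 / ε ^ 5 * (1 + ε ^ 3))) := by
  obtain ⟨⟨hy0, hv0⟩, hstep⟩ := (solvesScheme_iff hdt.ne').1 hT
  exact (hchar.isFlow hε.ne').classical_error_le hE hε hdt.le hstep
    (by rw [hy0, hchar.x_zero, hchar.v_zero]) (by rw [hv0, hchar.v_zero])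
    (by rw [norm_mul_toComplex hε.le, hchar.v_zero]) n (norm_nonneg v₀)

theorem SolvesScheme.uniform_error :
    ‖toComplex (T.y n) - toComplex (guidingCenter ε (x (n * dt)) (v (n * dt)))‖ ≤
      1918 * B ^ 7 * (errorGrowth (Kx E) ε ‖v₀‖ (n * dt) * (min 1 (ε ^ 2) + dt ^ 2)) := by
  obtain ⟨⟨hy0, hv0⟩, hstep⟩ := (solvesScheme_iff hdt.ne').1 hT
  exact (hchar.isFlow hε.ne').uniform_error_le hE hε hdt.le hstep
    (by rw [hy0, hchar.x_zero, hchar.v_zero]) (by rw [hv0, hchar.v_zero])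
    (by rw [norm_mul_toComplex hε.le, hchar.v_zero]) n (norm_nonneg v₀)

theorem SolvesScheme.norm_velocity_sub_le :
    ‖ε * toComplex (T.v n) - ε * toComplex (v (n * dt))‖ ≤
      16 * B ^ 7 * (errorGrowth (Kx E) ε ‖v₀‖ (n * dt) * ε) := by
  obtain ⟨⟨-, hv0⟩, hstep⟩ := (solvesScheme_iff hdt.ne').1 hT
  exact (hchar.isFlow hε.ne').norm_velocity_sub_le hE hε hdt.le hstep
    (by rw [hv0, hchar.v_zero]) (by rw [norm_mul_toComplex hε.le, hchar.v_zero]) n (norm_nonneg v₀)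

theorem SolvesScheme.norm_position_sub_le :
    ‖T.x ε n - x (n * dt)‖ ≤ 3888 * B ^ 7 * (errorGrowth (Kx E) ε ‖v₀‖ (n * dt) *
      min (dt ^ 2 / ε ^ 5 * (1 + ε ^ 3)) (ε + dt ^ 2)) := by
  have hB := hE.B_pos
  have ht : 0 ≤ n * dt := by positivity
  have hgrowth := ht.trans (le_errorGrowth (ε := ε) (V := ‖v₀‖) hE.K_nonneg ht)
  have hsplit := norm_position_sub_le_add ε T n (x (n * dt)) (v (n * dt))
  rw [mul_min_of_nonneg _ _ hgrowth, mul_min_of_nonneg _ _ (by positivity)]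
  refine le_min (hsplit.trans (hT.classical_error hE hε hdt hchar n)) ?_
  calc _ ≤ 1918 * B ^ 7 * (errorGrowth (Kx E) ε ‖v₀‖ (n * dt) * (min 1 (ε ^ 2) + dt ^ 2)) +
        16 * B ^ 7 * (errorGrowth (Kx E) ε ‖v₀‖ (n * dt) * ε) :=
        hsplit.trans (add_le_add (hT.uniform_error hE hε hdt hchar n)
          (hT.norm_velocity_sub_le hE hε hdt hchar n))
    _ ≤ 1918 * B ^ 7 * (errorGrowth (Kx E) ε ‖v₀‖ (n * dt) * (ε + dt ^ 2)) +
        1970 * B ^ 7 * (errorGrowth (Kx E) ε ‖v₀‖ (n * dt) * (ε + dt ^ 2)) := by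
        have hmin : min 1 (ε ^ 2) ≤ ε := by
          rcases le_total ε 1 with hε₁ | hε₁
          · exact (min_le_right _ _).trans (pow_le_of_le_one hε.le hε₁ two_ne_zero)
          · exact (min_le_left _ _).trans hε₁
        gcongr
        · norm_num
        · exact le_add_of_nonneg_right (sq_nonneg dt)
    _ = 3888 * B ^ 7 * (errorGrowth (Kx E) ε ‖v₀‖ (n * dt) * (ε + dt ^ 2)) := by ring

theorem SolvesScheme.norm_guidingCenter_sub_le :
    ‖T.y n - guidingCenter ε (x (n * dt)) (v (n * dt))‖ ≤
      3888 * B ^ 7 * (errorGrowth (Kx E) ε ‖v₀‖ (n * dt) *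
        min (dt ^ 2 / ε ^ 5 * (1 + ε ^ 3)) (ε ^ 2 + dt ^ 2)) := by
  have hB := hE.B_pos
  have ht : 0 ≤ n * dt := by positivity
  have hgrowth := ht.trans (le_errorGrowth (ε := ε) (V := ‖v₀‖) hE.K_nonneg ht)
  rw [norm_guidingCenter_sub, mul_min_of_nonneg _ _ hgrowth, mul_min_of_nonneg _ _ (by positivity)]
  refine le_min ((le_add_of_nonneg_right (norm_nonneg _)).trans
    (hT.classical_error hE hε hdt hchar n)) ((hT.uniform_error hE hε hdt hchar n).trans ?_)
  gcongr
  · norm_num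
  · exact min_le_right _ _

end SchemeErrors

end GuidingCenter

open GuidingCenter in
theorem theorem5p1 :
    -- the scheme has a unique solution
    (∀ (E : ℝ × Plane → Plane) (ε dt : ℝ), 0 < ε → 0 < dt → ∀ x₀ v₀ : Plane,
      ∃! T : Trajectory, SolvesScheme E ε dt x₀ v₀ T) ∧
    -- error estimate on the space variable
    (∃ C₀ : ℝ, ∀ E : ℝ × Plane → Plane, FieldW2Infty E → ∃ C : ℝ,
      ∀ (ε dt : ℝ), 0 < ε → 0 < dt → ∀ (x₀ v₀ : Plane) (x v : ℝ → Plane) (T : Trajectory),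
        IsCharacteristic E ε x₀ v₀ x v → SolvesScheme E ε dt x₀ v₀ T → ∀ n : ℕ,
          ‖T.x ε n - x (n * dt)‖ ≤
            C * (Real.exp (C₀ * Kx E * (n * dt)) * (1 + n * dt) ^ 3 * (1 + ε ^ 2 + ‖v₀‖ ^ 2) *
              min (dt ^ 2 / ε ^ 5 * (1 + ε ^ 3)) (ε + dt ^ 2))) ∧
    -- error estimate on the guiding center variable
    (∃ C₀ : ℝ, ∀ E : ℝ × Plane → Plane, FieldW2Infty E → ∃ C : ℝ,
      ∀ (ε dt : ℝ), 0 < ε → 0 < dt → ∀ (x₀ v₀ : Plane) (x v : ℝ → Plane) (T : Trajectory),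
        IsCharacteristic E ε x₀ v₀ x v → SolvesScheme E ε dt x₀ v₀ T → ∀ n : ℕ,
          ‖T.y n - guidingCenter ε (x (n * dt)) (v (n * dt))‖ ≤
            C * (Real.exp (C₀ * Kx E * (n * dt)) * (1 + n * dt) ^ 4 * (1 + ε ^ 2 + ‖v₀‖ ^ 2) *
              min (dt ^ 2 / ε ^ 5 * (1 + ε ^ 3)) (ε ^ 2 + dt ^ 2))) := by
  refine ⟨fun E ε dt hε hdt x₀ v₀ => existsUnique_solvesScheme E hε.ne' hdt.ne' x₀ v₀,
    ⟨69, fun E hE => ?_⟩, ⟨69, fun E hE => ?_⟩⟩ <;>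
    obtain ⟨B, D, hB⟩ := hE.exists_fieldBounds
  · refine ⟨3888 * B ^ 7, fun ε dt hε hdt x₀ v₀ x v T hchar hT n => ?_⟩
    exact hT.norm_position_sub_le hB hε hdt hchar n
  · refine ⟨3888 * B ^ 7, fun ε dt hε hdt x₀ v₀ x v T hchar hT n => ?_⟩
    have hB₀ := hB.B_pos
    refine (hT.norm_guidingCenter_sub_le hB hε hdt hchar n).trans ?_
    rw [errorGrowth]
    gcongr
    · exact le_add_of_nonneg_right (by positivity)
    · norm_num
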